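/- **Setting.** Let $u:[0,\infty)\to(0,\infty)$ be (strictly) increasing and convex, with $\int_0^\infty \frac{dt}{u(t)}=1$ and $\sup_{t\ge 0}(1+u(t))e^{-\tau t}<\infty$ for every $\tau>0$. Let $U(x)=u^{-1}(|x|)$ if $|x|\ge u(0)$ and $U(x)=0$ if $|x|<u(0)$. Fix $R\ge 1$, $0<\varepsilon\le 2^{-8}$, an adaptation rate $0<a\le \frac1{100}$ and $A>0$, and put $C=10^3a^{-1}$. Intervals are bounded, half-open and of positive length $|I|$; $c(I)$ is the midpoint of $I$, $rI$ is the interval with midpoint $c(I)$ and length $r|I|$, and $\mathcal D(I)$ is the set of dyadic subintervals of $I$ (obtained from $I$ by repeated bisection). Write $\langle b,\varphi\rangle=\int b\,\overline{\varphi}$, $\widehat\varphi(\zeta)=\int\varphi(x)e^{-2\pi i\zeta x}\,dx$ and $\mathsf M_pf(x)=\sup_{I\ni x}\big(|I|^{-1}\int_I|f|^p\big)^{1/p}$. A *top datum* is a pair $(I,\xi)$ of an interval $I$ and a frequency $\xi\in\mathbb R$. A smooth function $\varphi$ is *$u$-adapted* to $(I,\xi)$ if $$\Big|\big(e^{-2\pi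 i\xi\cdot}\varphi\big)^{(j)}(x)\Big|\le A\,|I|^{-\frac12-j}\exp\Big(-a\,U\big(\tfrac{|x-c(I)|}{|I|}\big)\Big)\qquad\forall x\in\mathbb R,\ j\in\{0,1\}.$$ A family $\boldsymbol\varphi=\{\varphi_J:J\in\mathcal D(I)\}$ is a *collection of $u$-adapted wave packets* with top datum $(I,\xi)$ if each $\varphi_J$ is smooth and $u$-adapted to $(J,\xi)$ and, for some $\xi_J\in\mathbb R$ with $|\xi_J-\xi|\le R|J|^{-1}$, the support of $\widehat{\varphi_J}$ is contained in the interval of length $\varepsilon|J|^{-1}$ centered at $\xi_J$. It is a collection *with mean zero* with respect to $(I,\xi)$ if moreover $|\xi_J-\xi|\ge|J|^{-1}$ for all $J\in\mathcal D(I)$. **Proposition 3.1.** There is a constant $c>0$, depending only on $u,R,a,A$, such that the following holds. Let $k\ge1$ and let $\mathcal T$ be a set of top data with $$\Big\|\sum_{(I,\xi)\in\mathcal T}\mathbf 1_{3u(Ck)I}\Big\|_\infty\le 2^k .$$ Let $1\le p<2$, $f\in L^p(\mathbb R)$, $\lambda>0$ and $E_\lambda=\{x:\mathsf M_pf(x)>\lambda\}$.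 Then there is a decomposition $f=g+b$ into measurable functions such that $$\|g\|_2\le c\,\lambda^{2-p}\|f\|_p^{p-1}\Big(u(Ck)^2\log u(Ck)\,\Big\|\sum_{(I,\xi)\in\mathcal T}\mathbf 1_I\Big\|_1\Big)^{\frac1p-\frac12}$$ and such that, for each $(I,\xi)\in\mathcal T$: 1. for every collection $\boldsymbol\varphi$ of $u$-adapted wave packets with top datum $(I,\xi)$, the integrals $\langle b,\varphi_J\rangle$, $J\in\mathcal D(I)$, converge absolutely and $$\sup_{J\in\mathcal D(I),\ J\not\subset E_\lambda}\frac{|\langle b,\varphi_J\rangle|}{|J|^{1/2}}\le c\,2^{-4k}\lambda ;$$ 2. for every collection $\boldsymbol\varphi$ of $u$-adapted wave packets with mean zero with respect to $(I,\xi)$ and every $J_0\in\mathcal D(I)$ with $J_0\not\subset E_\lambda$, $$\Big(\frac1{|J_0|}\sum_{J\in\mathcal D(I),\ J\subset J_0,\ J\not\subset E_\lambda}|\langle b,\varphi_J\rangle|^2\Big)^{\frac12}\le c\,2^{-4k}\lambda .$$ (In the bound for $\|g\|_2$ both sides are elements of $[0,\infty]$, with $0\cdot\infty=0$ and $0^0=1$.)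 -/

import Mathlib

open MeasureTheory Set
open scoped ENNReal FourierTransform ContDiff ComplexConjugate

namespace MFCZ

noncomputable section

/-- A bounded nondegenerate interval of the real line, in the half-open convention
`[left, left + len)` that is customary for dyadic grids. -/
@[ext] structure Ival where
  left : ℝ
  len : ℝ
  len_pos : 0 < len

namespace Ival

/-- The underlying set. -/
def toSet (I : Ival) : Set ℝ := Ico I.left (I.left + I.len)

/-- The midpoint `c(I)`. -/
def center (I : Ival) : ℝ := I.left + I.len / 2

/-- The set underlying the dilate `r I`: same midpoint, length `r |I|`. -/
def dilate (r : ℝ) (I : Ival) : Set ℝ :=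
  Ico (I.center - r * I.len / 2) (I.center + r * I.len / 2)

/-- `𝒟(I)`: the dyadic subintervals of `I`, obtained by repeatedly bisecting `I`. -/
def dyadic (I : Ival) : Set Ival :=
  {J | ∃ n m : ℕ, m < 2 ^ n ∧ J.left = I.left + m * (I.len / 2 ^ n) ∧ J.len = I.len / 2 ^ n}

end Ival

/-- The standing hypotheses on `u : [0,∞) → (0,∞)` (values of `u` at negative arguments are
irrelevant): positive, increasing, convex, normalized Osgood condition, and subexponential growth.
The Bochner integral takes the value `1 ≠ 0`, so `1/u` is integrable. -/
structure IsOsgood (u : ℝ → ℝ) : Prop where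
  pos : ∀ t, 0 ≤ t → 0 < u t
  strictMono : StrictMonoOn u (Ici 0)
  convex : ConvexOn ℝ (Ici 0) u
  integral_eq : ∫ t in Ioi (0 : ℝ), 1 / u t = 1
  growth : ∀ τ : ℝ, 0 < τ → BddAbove ((fun t => (1 + |u t|) * Real.exp (-τ * t)) '' Ici 0)

open Classical in
/-- The evenly extended inverse `U` of `u`: `U(x) = u⁻¹(|x|)` if `|x| ≥ u(0)`, and `0` otherwise. -/
def evenInv (u : ℝ → ℝ) (x : ℝ) : ℝ :=
  if u 0 ≤ |x| then Function.invFunOn u (Ici 0) |x| else 0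

/-- `φ` is a smooth function that is `u`-adapted to the top datum `(I, ξ)`, with adaptation rate
`a` and implicit constant `A` (`L²` normalization). -/
def IsAdapted (u : ℝ → ℝ) (a A : ℝ) (I : Ival) (ξ : ℝ) (φ : ℝ → ℂ) : Prop :=
  ContDiff ℝ ∞ φ ∧
  ∀ x : ℝ, ∀ j : ℕ, j ≤ 1 →
    ‖iteratedDeriv j (fun y : ℝ => Complex.exp (-2 * Real.pi * Complex.I * ξ * y) * φ y) x‖ ≤
      A * I.len ^ (-(1 / 2 : ℝ) - j) * Real.exp (-a * evenInv u (|x - I.center| / I.len))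

/-- `{φ J : J ∈ 𝒟(I)}` is a collection of `u`-adapted wave packets with top datum `(I, ξ)` and
frequency centers `ξ_J = η J`. -/
def IsWavePacketsWith (u : ℝ → ℝ) (R ε a A : ℝ) (I : Ival) (ξ : ℝ) (η : Ival → ℝ)
    (φ : Ival → ℝ → ℂ) : Prop :=
  ∀ J ∈ I.dyadic,
    IsAdapted u a A J ξ (φ J) ∧
    tsupport (𝓕 (φ J)) ⊆ Icc (η J - ε / J.len / 2) (η J + ε / J.len / 2) ∧
    |η J - ξ| ≤ R / J.len

/-- `{φ J : J ∈ 𝒟(I)}` is a collection of `u`-adapted wave packets with top datum `(I, ξ)`. -/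
def IsWavePackets (u : ℝ → ℝ) (R ε a A : ℝ) (I : Ival) (ξ : ℝ) (φ : Ival → ℝ → ℂ) : Prop :=
  ∃ η : Ival → ℝ, IsWavePacketsWith u R ε a A I ξ η φ

/-- `{φ J : J ∈ 𝒟(I)}` is a collection of `u`-adapted wave packets with mean zero with respect to
the top datum `(I, ξ)`. -/
def IsMeanZeroWavePackets (u : ℝ → ℝ) (R ε a A : ℝ) (I : Ival) (ξ : ℝ) (φ : Ival → ℝ → ℂ) : Prop :=
  ∃ η : Ival → ℝ, IsWavePacketsWith u R ε a A I ξ η φ ∧ ∀ J ∈ I.dyadic, 1 / J.len ≤ |η J - ξ|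

/-- The `p`-th Hardy–Littlewood maximal function
`M_p f(x) = sup_{I ∋ x} (|I|⁻¹ ∫_I |f|^p)^{1/p}`. -/
def maximal (p : ℝ) (f : ℝ → ℂ) (x : ℝ) : ℝ≥0∞ :=
  ⨆ (I : Ival) (_ : x ∈ I.toSet), ((∫⁻ y in I.toSet, ‖f y‖ₑ ^ p) / ENNReal.ofReal I.len) ^ (1 / p)

/-- The exceptional set `E_λ = {x : M_p f(x) > λ}`. -/
def excSet (p : ℝ) (f : ℝ → ℂ) (lam : ℝ) : Set ℝ :=
  {x | ENNReal.ofReal lam < maximal p f x}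

/-- The counting function `∑_{(I, ξ) ∈ 𝒯} 1_{r I}` of the `r`-dilated spatial intervals of a
collection `𝒯` of top data. -/
def counting (T : Set (Ival × ℝ)) (r : ℝ) (x : ℝ) : ℝ≥0∞ :=
  ∑' d : T, (Ival.dilate r d.1.1).indicator 1 x

/-- The pairing `⟨b, φ⟩ = ∫ b φ̄`. -/
def pair (b φ : ℝ → ℂ) : ℂ := ∫ x, b x * conj (φ x)

end

end MFCZ

/-!
The function `f` is split at the open set `E = {M_p f > lam}`. It has finite measure by the weak
type inequality, and is the disjoint union of Whitney intervals `Q`, chosen so that the distance to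
the complement of `E` is at least `500 |Q|` on `3Q`, while `∫_Q |f|^p ≤ 2048 lam^p |Q|`. Write
`M = u (1000 k / a)`. A top datum `(I, ξ)` is near `Q` if `Q ⊆ 3M I`; let `n_Q` be the number of
near tops, and let `V_Q` be the span of the functions `x^m e^{2πiξx}` with `m < D`, where
`D = ⌈(R + 1) M⌉`, and `ξ` the frequency of a near top.

The good function is the sum of `f` on the part of the complement of `E` met by some `3M I`, where
`|f| ≤ lam`, and of the functions `G_Q` on `3Q`, where `G_Q ∈ V_Q` represents `v ↦ ∫_Q f conj v` in
`L²(3Q)`. The space `V_Q` is invariant under translations. Averaging its reproducing kernel over an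
interval and translating gives `sup_Q |v|² ≤ dim V_Q |Q|⁻¹ ∫_{3Q} |v|²`, and from this
`∫_{3Q} |G_Q|² ≲ lam² (D n_Q)^(2/p - 1) |Q|` (`exists_local_projection`). As `n_Q` is bounded by the
counting function on `Q`, Hölder's inequality with exponents `1 - θ` and `θ = 2/p - 1` turns the sum
over `Q` into the bound for `‖g‖₂` (`lintegral_good_le`).

The bad function consists of the remainders `β_Q = f 1_Q - G_Q 1_{3Q}`, orthogonal to `V_Q`, and of
a function bounded by `lam` that vanishes on all `3M I`. Let `φ` be a packet on `J ∈ 𝒟(I)` with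
`J ⊄ E`. Because `J` meets the complement of `E`, the interval `Q` is short compared with `|J|` plus
its distance from `J`. There are three cases (`norm_pair_le_of_isWhitney`). If `Q` is farther from
`J` than about `M |J|`, then `U ≥ 1000 k / a` there, and up to a constant `exp (-a U)` is at most
`e^{-500k}` times any negative power of the relative distance. If moreover `(I, ξ)` is near `Q`, the
derivative condition with a single cancellation gains `|Q| / |J|`, and otherwise `Q` is at distance
at least `|I|`, which gains `|J| / |I|`. In the remaining case `(I, ξ)` is near `Q`, and `φ` has
its spectrum within `(R + 1) / |J|` of `ξ`, so the Taylor polynomial of degree less than `D` of the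
exponentials in the Fourier inversion formula approximates `φ` on `3Q` within `X^D / D!`, with `X`
at most `D / 25` (`exists_expPoly_norm_sub_le`). This is at most `e^{-D} ≤ e^{-500k}`, still with a
gain `|Q| / |J|`.

The factor `e^{-500k}` absorbs the mass `∫ |β_Q| ≲ lam D 2^k |Q| ≲ lam e^{2k} |Q|` and leaves
`2^{-4k}`. The gains make the bounds at a fixed point summable over the scales of `J`, with no
orthogonality between different packets: the pairings are dominated by integrals of `packetWeight`,
which satisfy a Carleson packing condition (`tsum_lintegral_packetWeight_le`).
-/

namespace MFCZ

/-! ### The majorant `u` and its inverse -/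

namespace IsOsgood

/-- Strict monotonicity bounds `u` from below near the endpoint `0`, and convexity bounds it from
above, so that `u` cannot jump there. -/
theorem continuousOn {u : ℝ → ℝ} (hu : IsOsgood u) : ContinuousOn u (Ici 0) := by
  intro x hx
  rcases eq_or_lt_of_le (show (0 : ℝ) ≤ x from hx) with rfl | hx
  · have h1 : Filter.Tendsto (fun x : ℝ => (1 - x) * u 0 + x * u 1) (nhdsWithin 0 (Ici 0))
        (nhds (u 0)) := by
      have : Continuous (fun x : ℝ => (1 - x) * u 0 + x * u 1) := by fun_prop
      have h := this.tendsto 0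
      simp only [sub_zero, one_mul, zero_mul, add_zero] at h
      exact h.mono_left nhdsWithin_le_nhds
    refine tendsto_of_tendsto_of_tendsto_of_le_of_le' tendsto_const_nhds h1 ?_ ?_
    · filter_upwards [self_mem_nhdsWithin] with y hy
      exact hu.strictMono.monotoneOn self_mem_Ici hy hy
    · have : Iio (1 : ℝ) ∈ nhdsWithin (0 : ℝ) (Ici 0) :=
        mem_nhdsWithin_of_mem_nhds (Iio_mem_nhds one_pos)
      filter_upwards [self_mem_nhdsWithin, this] with y hy hy1
      have := hu.convex.2 (self_mem_Ici (a := (0 : ℝ))) (show (1 : ℝ) ∈ Ici 0 by simp)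
        (show 0 ≤ 1 - y by simp at hy1; linarith) (show 0 ≤ y from hy) (by ring)
      simpa using this
  · have h := hu.convex.continuousOn_interior
    rw [interior_Ici] at h
    exact (h.continuousAt (Ioi_mem_nhds hx)).continuousWithinAt

/-- `1 / u` is decreasing with integral `1`, so `t / u t ≤ ∫₀ᵗ 1 / u ≤ 1`. -/
theorem le_self {u : ℝ → ℝ} (hu : IsOsgood u) {t : ℝ} (ht : 0 ≤ t) : t ≤ u t := by
  have hint : IntegrableOn (fun t => 1 / u t) (Ioi 0) := by
    by_contra h
    have := hu.integral_eq
    rw [integral_undef h] at this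
    norm_num at this
  have hpos := hu.pos t ht
  have h1 : ∫ s in Ioc 0 t, 1 / u t ≤ ∫ s in Ioc 0 t, 1 / u s := by
    refine setIntegral_mono_on (by simp) (hint.mono_set Ioc_subset_Ioi_self) measurableSet_Ioc ?_
    intro s hs
    exact one_div_le_one_div_of_le (hu.pos s hs.1.le)
      (hu.strictMono.monotoneOn hs.1.le ht hs.2)
  have h2 : ∫ s in Ioc 0 t, 1 / u s ≤ ∫ s in Ioi 0, 1 / u s := by
    refine setIntegral_mono_set hint ?_ (Filter.Eventually.of_forall Ioc_subset_Ioi_self)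
    filter_upwards [ae_restrict_mem measurableSet_Ioi] with s hs
    exact (one_div_pos.2 (hu.pos s (le_of_lt hs))).le
  rw [hu.integral_eq] at h2
  have h3 : ∫ s in Ioc 0 t, 1 / u t = t * (1 / u t) := by
    simp [ht]
  rw [h3] at h1
  have := h1.trans h2
  rwa [mul_one_div, div_le_one hpos] at this

theorem exists_eq {u : ℝ → ℝ} (hu : IsOsgood u) {s : ℝ} (hs : u 0 ≤ s) :
    ∃ t ∈ Ici (0 : ℝ), u t = s := by
  have hs0 : 0 ≤ s := (hu.pos 0 le_rfl).le.trans hs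
  obtain ⟨t, ht, rfl⟩ := intermediate_value_Icc hs0
    (hu.continuousOn.mono Icc_subset_Ici_self) ⟨hs, hu.le_self hs0⟩
  exact ⟨t, ht.1, rfl⟩

theorem evenInv_spec {u : ℝ → ℝ} (hu : IsOsgood u) {s : ℝ} (hs : u 0 ≤ s) :
    0 ≤ evenInv u s ∧ u (evenInv u s) = s := by
  have h0 : |s| = s := abs_of_nonneg ((hu.pos 0 le_rfl).le.trans hs)
  have h := hu.exists_eq hs
  rw [evenInv, h0, if_pos hs]
  exact ⟨Function.invFunOn_mem h, Function.invFunOn_eq h⟩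

theorem le_evenInv {u : ℝ → ℝ} (hu : IsOsgood u) {t s : ℝ} (ht : 0 ≤ t) (hs : u t ≤ s) :
    t ≤ evenInv u s := by
  have h0 : u 0 ≤ s := (hu.strictMono.monotoneOn self_mem_Ici ht ht).trans hs
  obtain ⟨h1, h2⟩ := hu.evenInv_spec h0
  rw [← h2] at hs
  exact (hu.strictMono.le_iff_le ht h1).1 hs

theorem exists_le_exp {u : ℝ → ℝ} (hu : IsOsgood u) {τ : ℝ} (hτ : 0 < τ) :
    ∃ B : ℝ, 1 ≤ B ∧ ∀ t, 0 ≤ t → 1 + u t ≤ B * Real.exp (τ * t) := by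
  obtain ⟨B, hB⟩ := hu.growth τ hτ
  refine ⟨max B 1, le_max_right _ _, fun t ht => ?_⟩
  have h := hB (mem_image_of_mem _ (show t ∈ Ici (0 : ℝ) from ht))
  simp only [abs_of_pos (hu.pos t ht)] at h
  have h2 : Real.exp (-τ * t) * Real.exp (τ * t) = 1 := by
    rw [← Real.exp_add]; simp
  have h3 : (1 + u t) * Real.exp (-τ * t) * Real.exp (τ * t) ≤ max B 1 * Real.exp (τ * t) := by
    gcongr
    exact h.trans (le_max_left _ _)
  rwa [mul_assoc, h2, mul_one] at h3

/-- Subexponential growth of `u` means that `exp (-b U)` decays faster than any power. -/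
theorem exists_decay {u : ℝ → ℝ} (hu : IsOsgood u) {b : ℝ} (hb : 0 < b) (n : ℕ) :
    ∃ C : ℝ, 1 ≤ C ∧ ∀ s, 0 ≤ s → Real.exp (-b * evenInv u s) * (1 + s) ^ n ≤ C := by
  obtain ⟨B, hB1, hB⟩ := hu.exists_le_exp (τ := b / (n + 1)) (by positivity)
  have hu0 := hu.pos 0 le_rfl
  refine ⟨max (B ^ n) ((1 + u 0) ^ n), (one_le_pow₀ hB1).trans (le_max_left _ _), fun s hs => ?_⟩
  by_cases h : u 0 ≤ s
  · obtain ⟨h1, h2⟩ := hu.evenInv_spec h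
    set t := evenInv u s
    have h3 := hB t h1
    rw [h2] at h3
    refine le_trans ?_ (le_max_left _ _)
    have h4 : (1 + s) ^ n ≤ B ^ n * Real.exp (n * (b / (n + 1) * t)) := by
      rw [Real.exp_nat_mul, ← mul_pow]
      exact pow_le_pow_left₀ (by positivity) h3 n
    have h5 : Real.exp (n * (b / (n + 1) * t)) ≤ Real.exp (b * t) := by
      apply Real.exp_le_exp.2
      have : (n : ℝ) * (b / (n + 1) * t) = (n / (n + 1)) * (b * t) := by ring
      rw [this]
      have h6 : (n : ℝ) / (n + 1) ≤ 1 := by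
        rw [div_le_one (by positivity)]; linarith
      exact mul_le_of_le_one_left (by positivity) h6
    calc Real.exp (-b * t) * (1 + s) ^ n
        ≤ Real.exp (-b * t) * (B ^ n * Real.exp (b * t)) := by
          gcongr
          exact h4.trans (by gcongr)
      _ = B ^ n * (Real.exp (-b * t) * Real.exp (b * t)) := by ring
      _ = B ^ n := by rw [← Real.exp_add]; simp
  · rw [evenInv, abs_of_nonneg hs, if_neg h]
    simp only [mul_zero, Real.exp_zero, one_mul]
    refine le_trans ?_ (le_max_right _ _)
    push Not at h
    gcongr

end IsOsgood

/-! ### Local projections onto translation invariant spaces -/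

theorem memLp_two_restrict_Ico {v : ℝ → ℂ} (hv : Continuous v) (α β : ℝ) :
    MemLp v 2 (volume.restrict (Ico α β)) := by
  obtain ⟨C, hC⟩ := (isCompact_Icc (a := α) (b := β)).exists_bound_of_continuousOn hv.continuousOn
  refine MemLp.of_bound hv.aestronglyMeasurable C ?_
  filter_upwards [ae_restrict_mem measurableSet_Ico] with x hx
  exact hC x (Ico_subset_Icc_self hx)

theorem integrableOn_Ico {v : ℝ → ℝ} (hv : Continuous v) (α β : ℝ) :
    IntegrableOn v (Ico α β) :=
  hv.continuousOn.integrableOn_Icc.mono_set Ico_subset_Icc_self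

theorem integrableOn_Ico_complex {v : ℝ → ℂ} (hv : Continuous v) (α β : ℝ) :
    IntegrableOn v (Ico α β) :=
  hv.continuousOn.integrableOn_Icc.mono_set Ico_subset_Icc_self

/-- A finite dimensional space of continuous functions has an `L²(α, β)`-orthonormal family
consisting of members of the space and reproducing all of them on `[α, β)`. Functions in the space
may vanish on the interval, so the family can be smaller than the dimension. -/
theorem exists_orthonormal_functions (V : Submodule ℂ (ℝ → ℂ)) [FiniteDimensional ℂ V]
    (hc : ∀ v ∈ V, Continuous v) (α β : ℝ) :
    ∃ m ≤ Module.finrank ℂ V, ∃ e : Fin m → ℝ → ℂ, (∀ i, e i ∈ V) ∧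
      (∀ i j, ∫ x in Ico α β, e i x * conj (e j x) = if i = j then 1 else 0) ∧
      ∀ v ∈ V, ∀ x ∈ Ico α β, v x = ∑ i, (∫ y in Ico α β, v y * conj (e i y)) * e i x := by
  set μ : Measure ℝ := volume.restrict (Ico α β) with hμ
  let T : V →ₗ[ℂ] Lp ℂ 2 μ :=
    { toFun := fun v => (memLp_two_restrict_Ico (hc v v.2) α β).toLp v
      map_add' := fun v w => rfl
      map_smul' := fun c v => rfl }
  have hT : ∀ v : V, T v =ᵐ[μ] v := fun v =>
    (memLp_two_restrict_Ico (hc v v.2) α β).coeFn_toLp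
  have hinner : ∀ v w : V, inner ℂ (T w) (T v) = ∫ x in Ico α β, v.1 x * conj (w.1 x) := by
    intro v w
    rw [L2.inner_def]
    apply integral_congr_ae
    filter_upwards [hT v, hT w] with x hx hx'
    rw [hx, hx']
    simp
  let b := stdOrthonormalBasis ℂ (LinearMap.range T)
  have hb : ∀ i, ∃ v : V, T v = b i := fun i => (b i).2
  choose e he using hb
  refine ⟨Module.finrank ℂ (LinearMap.range T), LinearMap.finrank_range_le T,
    fun i => e i, fun i => (e i).2, ?_, ?_⟩
  · intro i j
    have h := orthonormal_iff_ite.1 b.orthonormal j i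
    rw [← hinner, he, he, ← Submodule.coe_inner, h]
    simp only [eq_comm]
  · intro v hv
    have h1 : T ⟨v, hv⟩ = T (∑ i, (∫ y in Ico α β, v y * conj ((e i).1 y)) • e i) := by
      have h2 := b.sum_repr' ⟨T ⟨v, hv⟩, LinearMap.mem_range_self _ _⟩
      have h3 : T ⟨v, hv⟩ = _ := (congrArg Subtype.val h2).symm
      rw [map_sum, h3]
      simp only [Submodule.coe_sum, Submodule.coe_smul, map_smul, he]
      refine Finset.sum_congr rfl fun i _ => ?_
      congr 1
      rw [Submodule.coe_inner, ← he, hinner]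
    set w : V := ∑ i, (∫ y in Ico α β, v y * conj ((e i).1 y)) • e i with hw
    have h4 : v =ᵐ[μ] w.1 := by
      filter_upwards [hT ⟨v, hv⟩, hT w] with x hx hx'
      rw [← hx', ← h1, hx]
    have h5 : EqOn v w.1 (Ico α β) :=
      Measure.eqOn_Ico_of_ae_eq _ h4 (hc v hv).continuousOn (hc _ w.2).continuousOn
    intro x hx
    rw [h5 hx, hw]
    simp [Finset.sum_apply, hμ]

/-- In a translation invariant space the reproducing kernel on an interval of length `L`, whose
average over the diagonal is at most `dim V / L`, can be used at a point of the interval where it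
is at most average; every point `x` is moved to such a point by a translation. -/
theorem exists_norm_sq_le_of_translation_invariant (V : Submodule ℂ (ℝ → ℂ))
    [FiniteDimensional ℂ V] (hc : ∀ v ∈ V, Continuous v)
    (ht : ∀ v ∈ V, ∀ h : ℝ, (fun x => v (x + h)) ∈ V) {L : ℝ} (hL : 0 < L) (x : ℝ) :
    ∃ β : ℝ, x ∈ Ico β (β + L) ∧ ∀ v ∈ V,
      ‖v x‖ ^ 2 ≤ Module.finrank ℂ V / L * ∫ y in Ico β (β + L), ‖v y‖ ^ 2 := by
  obtain ⟨m, hm, e, heV, horth, hrep⟩ := exists_orthonormal_functions V hc 0 L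
  have hcont : Continuous fun y => ∑ i, ‖e i y‖ ^ 2 :=
    continuous_finsetSum _ fun i _ => ((hc _ (heV i)).norm.pow 2)
  have hone : ∀ i, ∫ y in Ico 0 L, ‖e i y‖ ^ 2 = 1 := by
    intro i
    have h := horth i i
    simp only [Complex.mul_conj, Complex.normSq_eq_norm_sq, if_true] at h
    rw [integral_complex_ofReal] at h
    exact_mod_cast h
  have hsum : ∫ y in Ico 0 L, ∑ i, ‖e i y‖ ^ 2 = m := by
    rw [integral_finsetSum]
    · simp [hone]
    · intro i _
      exact integrableOn_Ico ((hc _ (heV i)).norm.pow 2) _ _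
  obtain ⟨y, hy, hle⟩ := exists_le_setAverage (μ := volume) (s := Ico 0 L)
    (by simp [hL]) (by simp) (integrableOn_Ico hcont 0 L)
  rw [setAverage_eq, hsum] at hle
  have hle' : ∑ i, ‖e i y‖ ^ 2 ≤ Module.finrank ℂ V / L := by
    refine hle.trans ?_
    simp only [measureReal_def, Real.volume_Ico, sub_zero, smul_eq_mul,
      ENNReal.toReal_ofReal hL.le]
    rw [inv_mul_eq_div]
    gcongr
  refine ⟨x - y, ⟨by linarith [hy.1], by linarith [hy.2]⟩, fun v hv => ?_⟩
  set w : ℝ → ℂ := fun z => v (z + (x - y)) with hw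
  have hwV : w ∈ V := ht v hv _
  have hwc := hc w hwV
  have hwx : w y = v x := by simp [hw]
  set c : Fin m → ℂ := fun i => ∫ z in Ico 0 L, w z * conj (e i z) with hcdef
  have hInt : ∫ z in Ico 0 L, ‖w z‖ ^ 2 = ∫ z in Ico (x - y) (x - y + L), ‖v z‖ ^ 2 := by
    have h := (measurePreserving_add_right volume (x - y)).setIntegral_preimage_emb
      (measurableEmbedding_addRight (x - y)) (fun z => ‖v z‖ ^ 2) (Ico (x - y) (x - y + L))
    rw [← h]
    have : (fun z => z + (x - y)) ⁻¹' Ico (x - y) (x - y + L) = Ico 0 L := by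
      ext z; simp
    rw [this]
  -- Parseval on the interval
  have hpars : ∫ z in Ico 0 L, ‖w z‖ ^ 2 = ∑ i, ‖c i‖ ^ 2 := by
    have h1 : ∫ z in Ico 0 L, w z * conj (w z) = ∑ i, c i * conj (c i) := by
      have h2 : ∫ z in Ico 0 L, w z * conj (w z)
          = ∫ z in Ico 0 L, ∑ i, conj (c i) * (w z * conj (e i z)) := by
        refine setIntegral_congr_fun measurableSet_Ico fun z hz => ?_
        have h3 := hrep w hwV z hz
        calc w z * conj (w z) = w z * conj (∑ i, c i * e i z) := by rw [← h3]
          _ = _ := by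
            rw [map_sum, Finset.mul_sum]
            refine Finset.sum_congr rfl fun i _ => ?_
            rw [map_mul]; ring
      rw [h2, integral_finsetSum]
      · refine Finset.sum_congr rfl fun i _ => ?_
        rw [integral_const_mul, mul_comm]
      · intro i _
        exact (integrableOn_Ico_complex
          (hwc.mul (Complex.continuous_conj.comp (hc _ (heV i)))) 0 L).const_mul _
    simp only [Complex.mul_conj, Complex.normSq_eq_norm_sq] at h1
    rw [integral_complex_ofReal] at h1
    exact_mod_cast h1
  rw [← hwx, hrep w hwV y hy, ← hInt, hpars]
  calc ‖∑ i, c i * e i y‖ ^ 2 ≤ (∑ i, ‖c i‖ * ‖e i y‖) ^ 2 := by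
        gcongr
        exact (norm_sum_le _ _).trans (by simp)
    _ ≤ (∑ i, ‖c i‖ ^ 2) * ∑ i, ‖e i y‖ ^ 2 := Finset.sum_mul_sq_le_sq_mul_sq _ _ _
    _ ≤ (∑ i, ‖c i‖ ^ 2) * (Module.finrank ℂ V / L) := by gcongr
    _ = _ := mul_comm _ _

theorem norm_sq_le_setIntegral_triple (V : Submodule ℂ (ℝ → ℂ))
    [FiniteDimensional ℂ V] (hc : ∀ v ∈ V, Continuous v)
    (ht : ∀ v ∈ V, ∀ h : ℝ, (fun x => v (x + h)) ∈ V) {α L : ℝ} (hL : 0 < L)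
    {v : ℝ → ℂ} (hv : v ∈ V) {x : ℝ} (hx : x ∈ Ico α (α + L)) :
    ‖v x‖ ^ 2 ≤ Module.finrank ℂ V / L * ∫ y in Ico (α - L) (α + 2 * L), ‖v y‖ ^ 2 := by
  obtain ⟨β, hβ, h⟩ := exists_norm_sq_le_of_translation_invariant V hc ht hL x
  refine (h v hv).trans ?_
  refine mul_le_mul_of_nonneg_left (setIntegral_mono_set (integrableOn_Ico
    ((hc v hv).norm.pow 2) _ _) (Filter.Eventually.of_forall fun y => by positivity)
    (Filter.Eventually.of_forall (Ico_subset_Ico ?_ ?_))) (by positivity)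
  · linarith [hβ.2, hx.1]
  · linarith [hβ.1, hx.2]

/-- The representative `G ∈ V`, with respect to `L²` of the tripled interval, of the functional
`v ↦ ∫_Q f conj v`. The bound interpolates between the control of `f` in `L^p(Q)` and the pointwise
bound for members of `V` on `Q`, by splitting `f` at height `lam * N ^ (1 / p)`. -/
theorem exists_local_projection (V : Submodule ℂ (ℝ → ℂ))
    [FiniteDimensional ℂ V] (hc : ∀ v ∈ V, Continuous v)
    (ht : ∀ v ∈ V, ∀ h : ℝ, (fun x => v (x + h)) ∈ V) {N : ℕ} (hN : Module.finrank ℂ V ≤ N)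
    {α L : ℝ} (hL : 0 < L) {p : ℝ} (hp1 : 1 ≤ p) (hp2 : p < 2) {f : ℝ → ℂ}
    (hf : IntegrableOn f (Ico α (α + L))) (hfp : IntegrableOn (fun x => ‖f x‖ ^ p) (Ico α (α + L)))
    {K lam : ℝ} (hK : 1 ≤ K) (hlam : 0 < lam)
    (hle : ∫ x in Ico α (α + L), ‖f x‖ ^ p ≤ K * lam ^ p * L) :
    ∃ G ∈ V, (∀ v ∈ V, ∫ x in Ico (α - L) (α + 2 * L), G x * conj (v x) =
        ∫ x in Ico α (α + L), f x * conj (v x)) ∧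
      ∫ x in Ico (α - L) (α + 2 * L), ‖G x‖ ^ 2 ≤
        4 * K ^ 2 * lam ^ 2 * (N : ℝ) ^ (2 / p - 1) * L := by
  obtain ⟨m, hm, e, heV, horth, hrep⟩ :=
    exists_orthonormal_functions V hc (α - L) (α + 2 * L)
  have hfv : ∀ v ∈ V, IntegrableOn (fun x => f x * conj (v x)) (Ico α (α + L)) := by
    intro v hv
    obtain ⟨C, hC⟩ := (isCompact_Icc (a := α) (b := α + L)).exists_bound_of_continuousOn
      (hc v hv).continuousOn
    refine Integrable.mul_bdd (c := C) hf ?_ ?_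
    · exact (Complex.continuous_conj.comp (hc v hv)).aestronglyMeasurable
    · filter_upwards [ae_restrict_mem measurableSet_Ico] with x hx
      simpa using hC x (Ico_subset_Icc_self hx)
  have hsub : Ico α (α + L) ⊆ Ico (α - L) (α + 2 * L) := by
    apply Ico_subset_Ico <;> linarith
  set G : ℝ → ℂ := ∑ i, (∫ x in Ico α (α + L), f x * conj (e i x)) • e i with hG
  have hGV : G ∈ V := Submodule.sum_mem _ fun i _ => Submodule.smul_mem _ _ (heV i)
  have hGdual : ∀ v ∈ V, ∫ x in Ico (α - L) (α + 2 * L), G x * conj (v x) =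
      ∫ x in Ico α (α + L), f x * conj (v x) := by
    intro v hv
    have h1 : ∫ x in Ico α (α + L), f x * conj (v x) = ∑ i,
        conj (∫ y in Ico (α - L) (α + 2 * L), v y * conj (e i y)) *
          ∫ x in Ico α (α + L), f x * conj (e i x) := by
      rw [setIntegral_congr_fun (g := fun x => ∑ i,
        conj (∫ y in Ico (α - L) (α + 2 * L), v y * conj (e i y)) * (f x * conj (e i x)))
        measurableSet_Ico]
      · rw [integral_finsetSum]
        · simp only [integral_const_mul]
        · intro i _
          exact (hfv _ (heV i)).const_mul _
      · intro x hx
        change f x * conj (v x) = _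
        rw [hrep v hv x (hsub hx), map_sum, Finset.mul_sum]
        refine Finset.sum_congr rfl fun i _ => ?_
        rw [map_mul]; ring
    rw [h1]
    have h2 : ∀ x, G x * conj (v x) = ∑ i, (∫ x in Ico α (α + L), f x * conj (e i x)) *
        (e i x * conj (v x)) := by
      intro x
      simp only [hG, Finset.sum_apply, Pi.smul_apply, smul_eq_mul, Finset.sum_mul, mul_assoc]
    simp only [h2]
    rw [integral_finsetSum]
    · refine Finset.sum_congr rfl fun i _ => ?_
      rw [integral_const_mul, ← integral_conj, mul_comm]
      simp only [map_mul, Complex.conj_conj, mul_comm]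
    · intro i _
      exact (integrableOn_Ico_complex ((hc _ (heV i)).mul
        (Complex.continuous_conj.comp (hc v hv))) _ _).const_mul _
  refine ⟨G, hGV, hGdual, ?_⟩
  set s := ∫ x in Ico (α - L) (α + 2 * L), ‖G x‖ ^ 2 with hs
  have hs0 : 0 ≤ s := integral_nonneg fun x => by positivity
  have hGc := hc G hGV
  have hsle : s ≤ ∫ x in Ico α (α + L), ‖f x‖ * ‖G x‖ := by
    have h1 := hGdual G hGV
    simp only [Complex.mul_conj, Complex.normSq_eq_norm_sq] at h1
    rw [integral_complex_ofReal] at h1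
    have h2 : ‖((s : ℝ) : ℂ)‖ = s := by rw [Complex.norm_real, Real.norm_of_nonneg hs0]
    rw [← h2, hs, h1]
    refine (norm_integral_le_integral_norm _).trans (le_of_eq ?_)
    refine setIntegral_congr_fun measurableSet_Ico fun x _ => ?_
    simp only [norm_mul, RCLike.norm_conj]
  rcases Nat.eq_zero_or_pos N with rfl | hNpos
  · have hV : V = ⊥ := Submodule.finrank_eq_zero.1 (Nat.le_zero.1 hN)
    have : G = 0 := by rw [hV] at hGV; simpa using hGV
    rw [hs, this]
    simp only [Pi.zero_apply, norm_zero]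
    simp only [ne_eq, OfNat.ofNat_ne_zero, not_false_eq_true, zero_pow, integral_zero]
    positivity
  have hN1 : (1 : ℝ) ≤ N := by exact_mod_cast hNpos
  set ν : ℝ := (N : ℝ) ^ (1 / p) with hν
  have hν0 : 0 < ν := by positivity
  set κ : ℝ := lam * ν with hκ
  have hκ0 : 0 < κ := by positivity
  set Gm : ℝ := √(N / L * s) with hGm
  have hGm0 : 0 ≤ Gm := Real.sqrt_nonneg _
  have hpt : ∀ x ∈ Ico α (α + L), ‖G x‖ ≤ Gm := by
    intro x hx
    apply Real.le_sqrt_of_sq_le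
    refine (norm_sq_le_setIntegral_triple V hc ht hL hGV hx).trans ?_
    gcongr
  have hpt2 : ∀ x ∈ Ico α (α + L), ‖f x‖ * ‖G x‖ ≤
      (κ ^ (2 - p) + Gm * κ ^ (1 - p)) * ‖f x‖ ^ p + ‖G x‖ ^ 2 / 4 := by
    intro x hx
    have hfx := norm_nonneg (f x)
    have hGx := norm_nonneg (G x)
    rcases hfx.eq_or_lt with h0 | hfx0
    · rw [← h0, zero_mul]; positivity
    rcases le_total ‖f x‖ κ with h | h
    · have h1 : ‖f x‖ ^ 2 ≤ κ ^ (2 - p) * ‖f x‖ ^ p := by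
        have : ‖f x‖ ^ 2 = ‖f x‖ ^ (2 - p) * ‖f x‖ ^ p := by
          rw [← Real.rpow_add hfx0]; simp
        rw [this]
        gcongr
      have h2 : 0 ≤ Gm * κ ^ (1 - p) * ‖f x‖ ^ p := by positivity
      nlinarith [sq_nonneg (‖f x‖ - ‖G x‖ / 2)]
    · have h1 : ‖f x‖ ≤ κ ^ (1 - p) * ‖f x‖ ^ p := by
        have : ‖f x‖ = ‖f x‖ ^ (1 - p) * ‖f x‖ ^ p := by
          rw [← Real.rpow_add hfx0]; simp
        conv_lhs => rw [this]
        exact mul_le_mul_of_nonneg_right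
          (Real.rpow_le_rpow_of_nonpos hκ0 h (by linarith)) (by positivity)
      have h2 : ‖f x‖ * ‖G x‖ ≤ (κ ^ (1 - p) * ‖f x‖ ^ p) * Gm :=
        mul_le_mul h1 (hpt x hx) hGx (by positivity)
      have h3 : 0 ≤ κ ^ (2 - p) * ‖f x‖ ^ p := by positivity
      nlinarith [sq_nonneg ‖G x‖]
  have hGi : IntegrableOn (fun x => ‖G x‖ ^ 2) (Ico α (α + L)) :=
    integrableOn_Ico (hGc.norm.pow 2) _ _
  have hs2 : s ≤ (κ ^ (2 - p) + Gm * κ ^ (1 - p)) * (K * lam ^ p * L) + s / 4 := by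
    refine hsle.trans ?_
    have hfGi : IntegrableOn (fun x => ‖f x‖ * ‖G x‖) (Ico α (α + L)) := by
      refine (hfv G hGV).norm.congr ?_
      filter_upwards with x
      rw [Complex.norm_mul, RCLike.norm_conj]
    refine (setIntegral_mono_on hfGi ((hfp.const_mul _).add (hGi.div_const 4)) measurableSet_Ico
      hpt2).trans ?_
    rw [integral_add' (hfp.const_mul _) (hGi.div_const 4), integral_const_mul, integral_div]
    have hGs : ∫ x in Ico α (α + L), ‖G x‖ ^ 2 ≤ s :=
      setIntegral_mono_set (integrableOn_Ico (hGc.norm.pow 2) _ _)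
        (Filter.Eventually.of_forall fun y => by positivity) (Filter.Eventually.of_forall hsub)
    gcongr
  set Θ : ℝ := (N : ℝ) ^ (2 / p - 1) with hΘ
  have hΘ0 : 0 < Θ := by positivity
  have hp0 : 0 < p := by linarith
  have hN0 : (0 : ℝ) < N := by linarith
  have e1 : κ ^ (2 - p) * lam ^ p = lam ^ 2 * Θ := by
    rw [hκ, Real.mul_rpow hlam.le hν0.le, hν, ← Real.rpow_mul hN0.le]
    have : lam ^ 2 = lam ^ (2 - p) * lam ^ p := by rw [← Real.rpow_add hlam]; simp
    rw [this, hΘ, show 1 / p * (2 - p) = 2 / p - 1 by field_simp]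
    ring
  have e2 : κ ^ (1 - p) * lam ^ p = lam * ν ^ (1 - p) := by
    rw [hκ, Real.mul_rpow hlam.le hν0.le]
    have : lam ^ (1 - p) * lam ^ p = lam := by rw [← Real.rpow_add hlam]; simp
    calc _ = (lam ^ (1 - p) * lam ^ p) * ν ^ (1 - p) := by ring
      _ = _ := by rw [this]
  have e3 : (Gm * ν ^ (1 - p) * L) ^ 2 = Θ * L * s := by
    rw [mul_pow, mul_pow, hGm, Real.sq_sqrt (by positivity), hν, ← Real.rpow_mul hN0.le,
      ← Real.rpow_natCast, ← Real.rpow_mul hN0.le]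
    have : Θ = N * (N : ℝ) ^ (1 / p * (1 - p) * (2 : ℕ)) := by
      rw [hΘ, ← Real.rpow_one_add' hN0.le]
      · congr 1
        push_cast
        field_simp
        ring
      push_cast
      have : 1 + 1 / p * (1 - p) * 2 = (2 - p) / p := by field_simp; ring
      rw [this]
      exact (div_pos (by linarith) hp0).ne'
    rw [this]
    field_simp
  have e4 : (κ ^ (2 - p) + Gm * κ ^ (1 - p)) * (K * lam ^ p * L) =
      K * (lam ^ 2 * Θ * L) + K * lam * (Gm * ν ^ (1 - p) * L) := by
    calc _ = K * (κ ^ (2 - p) * lam ^ p) * L + K * Gm * (κ ^ (1 - p) * lam ^ p) * L := by ring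
      _ = _ := by rw [e1, e2]; ring
  rw [e4] at hs2
  set Z := Gm * ν ^ (1 - p) * L with hZ
  set A := lam ^ 2 * Θ * L with hA
  have hA0 : 0 < A := by positivity
  have hZ2 : (K * lam * Z) ^ 2 = K ^ 2 * A * s := by
    rw [mul_pow, e3, hA]; ring
  have hKZ : K * lam * Z ≤ K ^ 2 * A + s / 4 := by
    apply le_of_sq_le_sq _ (by positivity)
    rw [hZ2]
    nlinarith [sq_nonneg (K ^ 2 * A - s / 4)]
  have : 4 * K ^ 2 * lam ^ 2 * Θ * L = 4 * K ^ 2 * A := by rw [hA]; ring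
  rw [this]
  nlinarith [mul_nonneg (mul_nonneg (sub_nonneg.2 hK) (by linarith : (0:ℝ) ≤ K)) hA0.le]

noncomputable section

/-! ### Exponential polynomials and band-limited functions -/

/-- The span of the functions `x ^ m e^{2πiξx}` with `m < D` and `ξ ∈ F`. -/
def expPoly (F : Finset ℝ) (D : ℕ) : Submodule ℂ (ℝ → ℂ) :=
  Submodule.span ℂ (range fun (i : F × Fin D) (x : ℝ) =>
    (x : ℂ) ^ (i.2 : ℕ) * Complex.exp (2 * Real.pi * Complex.I * i.1 * x))

instance (F : Finset ℝ) (D : ℕ) : FiniteDimensional ℂ (expPoly F D) :=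
  FiniteDimensional.span_of_finite ℂ (finite_range _)

theorem finrank_expPoly_le (F : Finset ℝ) (D : ℕ) :
    Module.finrank ℂ (expPoly F D) ≤ F.card * D := by
  refine (finrank_range_le_card _).trans ?_
  simp

theorem continuous_of_mem_expPoly {F : Finset ℝ} {D : ℕ} {v : ℝ → ℂ} (hv : v ∈ expPoly F D) :
    Continuous v := by
  induction hv using Submodule.span_induction with
  | mem v hv => obtain ⟨i, rfl⟩ := hv; fun_prop
  | zero => exact continuous_const
  | add v w _ _ hv hw => exact hv.add hw
  | smul c v _ hv => exact hv.const_smul c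

theorem mem_expPoly {F : Finset ℝ} {D : ℕ} {ξ : ℝ} (hξ : ξ ∈ F) {m : ℕ} (hm : m < D) (h : ℝ) :
    (fun x : ℝ => ((x : ℂ) + h) ^ m * Complex.exp (2 * Real.pi * Complex.I * ξ * x)) ∈
      expPoly F D := by
  have : (fun x : ℝ => ((x : ℂ) + h) ^ m * Complex.exp (2 * Real.pi * Complex.I * ξ * x)) =
      ∑ k ∈ Finset.range (m + 1), ((h : ℂ) ^ (m - k) * (m.choose k : ℂ)) •
        fun x : ℝ => (x : ℂ) ^ k * Complex.exp (2 * Real.pi * Complex.I * ξ * x) := by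
    funext x
    rw [add_pow, Finset.sum_mul]
    simp only [Finset.sum_apply, Pi.smul_apply, smul_eq_mul]
    refine Finset.sum_congr rfl fun k _ => by ring
  rw [this]
  refine Submodule.sum_mem _ fun k hk => Submodule.smul_mem _ _ (Submodule.subset_span ?_)
  rw [Finset.mem_range] at hk
  exact ⟨⟨⟨ξ, hξ⟩, ⟨k, by omega⟩⟩, rfl⟩

theorem comp_add_mem_expPoly {F : Finset ℝ} {D : ℕ} {v : ℝ → ℂ} (hv : v ∈ expPoly F D) (h : ℝ) :
    (fun x => v (x + h)) ∈ expPoly F D := by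
  induction hv using Submodule.span_induction with
  | mem v hv =>
    obtain ⟨⟨ξ, m⟩, rfl⟩ := hv
    have h1 := Submodule.smul_mem _ (Complex.exp (2 * Real.pi * Complex.I * ξ * h))
      (mem_expPoly ξ.2 m.2 h)
    convert h1 using 1
    funext x
    simp only [Pi.smul_apply, smul_eq_mul, Complex.ofReal_add]
    rw [mul_add, Complex.exp_add]
    ring
  | zero => exact Submodule.zero_mem _
  | add v w _ _ hv hw => exact Submodule.add_mem _ hv hw
  | smul c v _ hv => exact Submodule.smul_mem _ c hv

theorem norm_fourier_le (φ : ℝ → ℂ) (ζ : ℝ) : ‖𝓕 φ ζ‖ ≤ ∫ x, ‖φ x‖ := by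
  rw [Real.fourier_eq]
  refine (norm_integral_le_integral_norm _).trans (le_of_eq ?_)
  simp

theorem integrable_fourier {φ : ℝ → ℂ} (hi : Integrable φ) {s : Set ℝ} (hs : IsCompact s)
    (hsupp : Function.support (𝓕 φ) ⊆ s) : Integrable (𝓕 φ) := by
  have hcont : Continuous (𝓕 φ) :=
    VectorFourier.fourierIntegral_continuous Real.continuous_fourierChar
      (by exact continuous_inner) hi
  rw [← integrableOn_iff_integrable_of_support_subset hsupp]
  exact hcont.continuousOn.integrableOn_compact hs

/-- Taylor expansion of the exponentials in the Fourier inversion formula: a function whose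
spectrum lies within `W` of `ξ` is, on a bounded interval, within a factorially small error of
`e^{2πiξx}` times a polynomial. -/
theorem exists_expPoly_norm_sub_le {φ : ℝ → ℂ} (hc : Continuous φ) (hi : Integrable φ)
    {lo hi' ξ W : ℝ} (hlo : lo ≤ hi') (hsupp : Function.support (𝓕 φ) ⊆ Icc lo hi')
    (hW : ∀ ζ ∈ Icc lo hi', |ζ - ξ| ≤ W)
    {F : Finset ℝ} {D : ℕ} (hξ : ξ ∈ F) (q : ℝ) :
    ∃ v ∈ expPoly F D, ∀ x X : ℝ, 2 * Real.pi * W * |x - q| ≤ X → X ≤ (D + 1) / 2 →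
      ‖φ x - v x‖ ≤ 2 * (X ^ D / D.factorial) * ((hi' - lo) * ∫ x, ‖φ x‖) := by
  have hint : Integrable (𝓕 φ) := integrable_fourier hi isCompact_Icc hsupp
  have hL1 : ∫ ζ, ‖𝓕 φ ζ‖ ≤ (hi' - lo) * ∫ x, ‖φ x‖ := by
    have h1 : ∫ ζ, ‖𝓕 φ ζ‖ = ∫ ζ in Icc lo hi', ‖𝓕 φ ζ‖ := by
      rw [setIntegral_eq_integral_of_forall_compl_eq_zero]
      intro ζ hζ
      have : ζ ∉ Function.support (𝓕 φ) := fun h => hζ (hsupp h)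
      simpa using this
    rw [h1]
    refine (setIntegral_mono_on (g := fun _ => ∫ x, ‖φ x‖) hint.norm.integrableOn (by simp)
      measurableSet_Icc fun ζ _ => norm_fourier_le φ ζ).trans ?_
    simp [hlo]
  have hinv : ∀ x : ℝ, φ x = ∫ ζ : ℝ, Complex.exp (2 * Real.pi * Complex.I * ζ * x) * 𝓕 φ ζ := by
    intro x
    conv_lhs => rw [← hc.fourierInv_fourier_eq hi hint, Real.fourierInv_eq']
    refine integral_congr_ae (Filter.Eventually.of_forall fun ζ => ?_)
    simp only [smul_eq_mul]
    congr 2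
    simp
    ring
  -- `z ζ x` is the exponent that is expanded
  set z : ℝ → ℝ → ℂ := fun ζ x => 2 * Real.pi * Complex.I * (ζ - ξ) * (x - q) with hz
  set c : ℝ → ℂ := fun ζ => Complex.exp (2 * Real.pi * Complex.I * (ζ - ξ) * q) with hcdef
  have hcn : ∀ ζ, ‖c ζ‖ = 1 := by
    intro ζ
    have : c ζ = Complex.exp ((2 * Real.pi * (ζ - ξ) * q : ℝ) * Complex.I) := by
      rw [hcdef]; simp only; congr 1; push_cast; ring
    rw [this, Complex.norm_exp_ofReal_mul_I]
  have hmom : ∀ m : ℕ, Integrable fun ζ : ℝ =>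
      c ζ * (2 * Real.pi * Complex.I * (ζ - ξ)) ^ m / m.factorial * 𝓕 φ ζ := by
    intro m
    have h1 : Continuous fun ζ : ℝ =>
        c ζ * (2 * Real.pi * Complex.I * (ζ - ξ)) ^ m / m.factorial := by
      fun_prop
    rw [← integrableOn_iff_integrable_of_support_subset (s := Icc lo hi')]
    · exact hint.integrableOn.continuousOn_mul h1.continuousOn isCompact_Icc
    · exact (Function.support_mul_subset_right _ _).trans hsupp
  set v : ℝ → ℂ := ∑ m ∈ Finset.range D,
    (∫ ζ : ℝ, c ζ * (2 * Real.pi * Complex.I * (ζ - ξ)) ^ m / m.factorial * 𝓕 φ ζ) •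
      fun x : ℝ => ((x : ℂ) + (-q : ℝ)) ^ m * Complex.exp (2 * Real.pi * Complex.I * ξ * x) with hv
  refine ⟨v, Submodule.sum_mem _ fun m hm => Submodule.smul_mem _ _
    (mem_expPoly hξ (Finset.mem_range.1 hm) _), ?_⟩
  intro x X hX hXD
  have hvx : v x = ∫ ζ : ℝ, Complex.exp (2 * Real.pi * Complex.I * ξ * x) * c ζ *
      (∑ m ∈ Finset.range D, z ζ x ^ m / m.factorial) * 𝓕 φ ζ := by
    have h1 : ∀ ζ : ℝ, Complex.exp (2 * Real.pi * Complex.I * ξ * x) * c ζ *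
        (∑ m ∈ Finset.range D, z ζ x ^ m / m.factorial) * 𝓕 φ ζ =
        ∑ m ∈ Finset.range D, (((x : ℂ) + (-q : ℝ)) ^ m *
          Complex.exp (2 * Real.pi * Complex.I * ξ * x)) *
          (c ζ * (2 * Real.pi * Complex.I * (ζ - ξ)) ^ m / m.factorial * 𝓕 φ ζ) := by
      intro ζ
      rw [Finset.mul_sum, Finset.sum_mul]
      refine Finset.sum_congr rfl fun m _ => ?_
      have : z ζ x ^ m = (2 * Real.pi * Complex.I * (ζ - ξ)) ^ m * ((x : ℂ) + (-q : ℝ)) ^ m := by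
        rw [← mul_pow]; congr 1; push_cast; ring
      rw [this]
      ring
    simp only [h1]
    rw [integral_finsetSum _ fun m _ => (hmom m).const_mul _]
    simp only [hv, Finset.sum_apply, Pi.smul_apply, smul_eq_mul, integral_const_mul]
    refine Finset.sum_congr rfl fun m _ => mul_comm _ _
  have hφx : φ x = ∫ ζ : ℝ, Complex.exp (2 * Real.pi * Complex.I * ξ * x) * c ζ *
      Complex.exp (z ζ x) * 𝓕 φ ζ := by
    rw [hinv x]
    congr 1
    funext ζ
    rw [hcdef]
    simp only
    rw [← Complex.exp_add, ← Complex.exp_add]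
    congr 2
    simp only [hz]
    ring
  have hi1 : Integrable fun ζ : ℝ => Complex.exp (2 * Real.pi * Complex.I * ξ * x) * c ζ *
      Complex.exp (z ζ x) * 𝓕 φ ζ := by
    have h1 : Continuous fun ζ : ℝ => Complex.exp (2 * Real.pi * Complex.I * ξ * x) * c ζ *
      Complex.exp (z ζ x) := by fun_prop
    rw [← integrableOn_iff_integrable_of_support_subset (s := Icc lo hi')]
    · exact hint.integrableOn.continuousOn_mul h1.continuousOn isCompact_Icc
    · exact (Function.support_mul_subset_right _ _).trans hsupp
  have hi2 : Integrable fun ζ : ℝ => Complex.exp (2 * Real.pi * Complex.I * ξ * x) * c ζ *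
      (∑ m ∈ Finset.range D, z ζ x ^ m / m.factorial) * 𝓕 φ ζ := by
    have h1 : Continuous fun ζ : ℝ => Complex.exp (2 * Real.pi * Complex.I * ξ * x) * c ζ *
      (∑ m ∈ Finset.range D, z ζ x ^ m / m.factorial) := by fun_prop
    rw [← integrableOn_iff_integrable_of_support_subset (s := Icc lo hi')]
    · exact hint.integrableOn.continuousOn_mul h1.continuousOn isCompact_Icc
    · exact (Function.support_mul_subset_right _ _).trans hsupp
  have hX0 : 0 ≤ X := by
    have hW0 : 0 ≤ W := (abs_nonneg _).trans (hW lo ⟨le_rfl, hlo⟩)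
    exact le_trans (by positivity) hX
  rw [hvx, hφx, ← integral_sub hi1 hi2]
  calc _ ≤ ∫ ζ, 2 * (X ^ D / D.factorial) * ‖𝓕 φ ζ‖ := by
        refine norm_integral_le_of_norm_le (hint.norm.const_mul _)
          (Filter.Eventually.of_forall fun ζ => ?_)
        rw [← sub_mul, ← mul_sub, norm_mul, norm_mul, norm_mul, hcn]
        have h0 : ‖Complex.exp (2 * Real.pi * Complex.I * ξ * x)‖ = 1 := by
          rw [show (2 * Real.pi * Complex.I * ξ * x : ℂ) = (2 * Real.pi * ξ * x : ℝ) * Complex.I by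
            push_cast; ring, Complex.norm_exp_ofReal_mul_I]
        rw [h0, one_mul, one_mul]
        by_cases hζ : ζ ∈ Icc lo hi'
        · have h1 : ‖z ζ x‖ ≤ X := by
            have h2 : ‖z ζ x‖ = 2 * Real.pi * |ζ - ξ| * |x - q| := by
              have : z ζ x = (2 * Real.pi * (ζ - ξ) * (x - q) : ℝ) * Complex.I := by
                simp only [hz]; push_cast; ring
              rw [this, norm_mul, Complex.norm_I, mul_one, Complex.norm_real, Real.norm_eq_abs,
                abs_mul, abs_mul, abs_of_pos (by positivity)]
            rw [h2]
            refine le_trans ?_ hX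
            gcongr
            exact hW ζ hζ
          gcongr
          refine (Complex.exp_bound' (n := D) ?_).trans ?_
          · push_cast
            rw [div_le_iff₀ (by positivity)]
            linarith
          · rw [mul_comm]
            gcongr
        · have : 𝓕 φ ζ = 0 := by
            by_contra h
            exact hζ (hsupp h)
          simp [this]
    _ ≤ _ := by
        rw [integral_const_mul]
        gcongr

/-! ### The Cauchy kernel -/

/-- The kernel `(1 + ((x - c) / ℓ) ^ 2)⁻¹`, an `L¹`-bump of height `1` around an interval with
midpoint `c` and length `ℓ`. -/
def cauchyKernel (c ℓ x : ℝ) : ℝ := (1 + ((x - c) / ℓ) ^ 2)⁻¹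

theorem cauchyKernel_pos (c ℓ x : ℝ) : 0 < cauchyKernel c ℓ x := by
  unfold cauchyKernel; positivity

theorem cauchyKernel_le_one (c ℓ x : ℝ) : cauchyKernel c ℓ x ≤ 1 :=
  inv_le_one_of_one_le₀ (by nlinarith [sq_nonneg ((x - c) / ℓ)])

theorem continuous_cauchyKernel (c ℓ : ℝ) : Continuous (cauchyKernel c ℓ) := by
  unfold cauchyKernel
  exact Continuous.inv₀ (by fun_prop) fun x => by positivity

theorem cauchyKernel_comm (c ℓ x : ℝ) : cauchyKernel c ℓ x = cauchyKernel x ℓ c := by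
  unfold cauchyKernel
  congr 2
  rw [div_pow, div_pow]
  congr 1
  ring

theorem integrable_cauchyKernel (c : ℝ) {ℓ : ℝ} (hℓ : 0 < ℓ) : Integrable (cauchyKernel c ℓ) := by
  have := (integrable_inv_one_add_sq.comp_div hℓ.ne').comp_sub_right c
  exact this

theorem integral_cauchyKernel (c : ℝ) {ℓ : ℝ} (hℓ : 0 < ℓ) :
    ∫ x, cauchyKernel c ℓ x = Real.pi * ℓ := by
  have h1 := integral_sub_right_eq_self (μ := volume) (fun x : ℝ => (1 + (x / ℓ) ^ 2)⁻¹) c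
  have h2 := Measure.integral_comp_div (fun x : ℝ => (1 + x ^ 2)⁻¹) ℓ
  unfold cauchyKernel
  rw [h1, h2, integral_univ_inv_one_add_sq, abs_of_pos hℓ, smul_eq_mul, mul_comm]

theorem lintegral_cauchyKernel (c : ℝ) {ℓ : ℝ} (hℓ : 0 < ℓ) :
    ∫⁻ x, ENNReal.ofReal (cauchyKernel c ℓ x) = ENNReal.ofReal (Real.pi * ℓ) := by
  rw [← integral_cauchyKernel c hℓ, ofReal_integral_eq_lintegral_ofReal
    (integrable_cauchyKernel c hℓ)
    (Filter.Eventually.of_forall fun x => (cauchyKernel_pos _ _ _).le)]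

theorem inv_sq_le_cauchyKernel (c x : ℝ) {ℓ : ℝ} (hℓ : 0 < ℓ) :
    ((1 + |x - c| / ℓ) ^ 2)⁻¹ ≤ cauchyKernel c ℓ x := by
  unfold cauchyKernel
  apply inv_anti₀ (by positivity)
  have h1 : ((x - c) / ℓ) ^ 2 = (|x - c| / ℓ) ^ 2 := by rw [div_pow, div_pow, sq_abs]
  rw [h1]
  have : 0 ≤ |x - c| / ℓ := by positivity
  nlinarith

theorem cauchyKernel_le_two_mul {c c' ℓ ℓ' : ℝ} (hℓ : 0 < ℓ) (hle : ℓ ≤ ℓ')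
    (hc : |c - c'| ≤ ℓ' / 2) (x : ℝ) : cauchyKernel c ℓ x ≤ 2 * cauchyKernel c' ℓ' x := by
  have hℓ' : 0 < ℓ' := hℓ.trans_le hle
  unfold cauchyKernel
  rw [← div_eq_mul_inv, ← one_div, div_le_div_iff₀ (by positivity) (by positivity)]
  have h1 : |(x - c') / ℓ'| ≤ |(x - c) / ℓ| + 1 / 2 := by
    rw [abs_div, abs_div, abs_of_pos hℓ, abs_of_pos hℓ']
    have h2 : |x - c'| ≤ |x - c| + ℓ' / 2 := by
      have := abs_add_le (x - c) (c - c')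
      rw [show x - c + (c - c') = x - c' by ring] at this
      linarith
    calc |x - c'| / ℓ' ≤ (|x - c| + ℓ' / 2) / ℓ' := by gcongr
      _ = |x - c| / ℓ' + 1 / 2 := by field_simp
      _ ≤ _ := by gcongr
  rw [← sq_abs ((x - c') / ℓ'), ← sq_abs ((x - c) / ℓ)]
  nlinarith [abs_nonneg ((x - c') / ℓ'), abs_nonneg ((x - c) / ℓ),
    sq_nonneg (|(x - c) / ℓ| - 1 / 2)]

/-! ### Size and approximation of wave packets -/

theorem Ival.dyadic_len_le {I J : Ival} (hJ : J ∈ I.dyadic) : J.len ≤ I.len := by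
  obtain ⟨n, m, -, -, h⟩ := hJ
  rw [h]
  exact div_le_self I.len_pos.le (one_le_pow₀ one_le_two)

theorem Ival.rpow_neg_half (J : Ival) : J.len ^ (-(1 / 2 : ℝ)) = (√J.len)⁻¹ := by
  rw [Real.rpow_neg J.len_pos.le, Real.sqrt_eq_rpow]

theorem norm_exp_neg_two_pi_mul (ξ x : ℝ) :
    ‖Complex.exp (-2 * Real.pi * Complex.I * ξ * x)‖ = 1 := by
  rw [show (-2 * Real.pi * Complex.I * ξ * x : ℂ) = (-2 * Real.pi * ξ * x : ℝ) * Complex.I by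
    push_cast; ring, Complex.norm_exp_ofReal_mul_I]

namespace IsAdapted

theorem norm_le {u : ℝ → ℝ} {a A : ℝ} {J : Ival} {ξ : ℝ} {φ : ℝ → ℂ}
    (h : IsAdapted u a A J ξ φ) (x : ℝ) :
    ‖φ x‖ ≤ A * (√J.len)⁻¹ * Real.exp (-a * evenInv u (|x - J.center| / J.len)) := by
  have h1 := h.2 x 0 zero_le_one
  rw [iteratedDeriv_zero, norm_mul, norm_exp_neg_two_pi_mul, one_mul, Nat.cast_zero, sub_zero,
    J.rpow_neg_half] at h1
  exact h1

theorem norm_deriv_le {u : ℝ → ℝ} {a A : ℝ} {J : Ival} {ξ : ℝ} {φ : ℝ → ℂ}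
    (h : IsAdapted u a A J ξ φ) (x : ℝ) :
    ‖deriv (fun y : ℝ => Complex.exp (-2 * Real.pi * Complex.I * ξ * y) * φ y) x‖ ≤
      A * ((√J.len)⁻¹ * J.len⁻¹) * Real.exp (-a * evenInv u (|x - J.center| / J.len)) := by
  have h1 := h.2 x 1 le_rfl
  rw [iteratedDeriv_one, Nat.cast_one, Real.rpow_sub J.len_pos, J.rpow_neg_half, Real.rpow_one,
    div_eq_mul_inv] at h1
  exact h1

theorem continuous {u : ℝ → ℝ} {a A : ℝ} {J : Ival} {ξ : ℝ} {φ : ℝ → ℂ}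
    (h : IsAdapted u a A J ξ φ) : Continuous φ := h.1.continuous

/-- Over an interval, the oscillation of the demodulated packet is controlled by the derivative
condition. -/
theorem norm_sub_exp_le {u : ℝ → ℝ} {a A : ℝ} (hA : 0 ≤ A) {J : Ival} {ξ : ℝ} {φ : ℝ → ℂ}
    (h : IsAdapted u a A J ξ φ) {α β q x E : ℝ} (hq : q ∈ Ico α β) (hx : x ∈ Ico α β)
    (hE : ∀ y ∈ Ico α β, Real.exp (-a * evenInv u (|y - J.center| / J.len)) ≤ E) :
    ‖φ x - (Complex.exp (-2 * Real.pi * Complex.I * ξ * q) * φ q) *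
      Complex.exp (2 * Real.pi * Complex.I * ξ * x)‖ ≤
      A * ((√J.len)⁻¹ * J.len⁻¹) * E * |x - q| := by
  set ψ : ℝ → ℂ := fun y : ℝ => Complex.exp (-2 * Real.pi * Complex.I * ξ * y) * φ y with hψ
  have hd : Differentiable ℝ ψ := by
    have h1 : Differentiable ℝ φ := h.1.differentiable (by simp)
    have h2 : Differentiable ℝ fun y : ℝ => Complex.exp (-2 * Real.pi * Complex.I * ξ * y) := by
      have : Differentiable ℝ fun y : ℝ => (y : ℂ) := Complex.ofRealCLM.differentiable
      exact (this.const_mul _).cexp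
    exact h2.mul h1
  have h3 := (convex_Ico α β).norm_image_sub_le_of_norm_deriv_le (f := ψ)
    (C := A * ((√J.len)⁻¹ * J.len⁻¹) * E) (fun y _ => hd y) (fun y hy =>
      (h.norm_deriv_le y).trans (by
        have := J.len_pos
        gcongr
        exact hE y hy)) hq hx
  have h4 : Complex.exp (2 * Real.pi * Complex.I * ξ * x) *
      Complex.exp (-2 * Real.pi * Complex.I * ξ * x) = 1 := by
    rw [← Complex.exp_add, ← Complex.exp_zero]; congr 1; ring
  have h5 : φ x - (Complex.exp (-2 * Real.pi * Complex.I * ξ * q) * φ q) *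
      Complex.exp (2 * Real.pi * Complex.I * ξ * x) =
      Complex.exp (2 * Real.pi * Complex.I * ξ * x) * (ψ x - ψ q) := by
    simp only [hψ]
    linear_combination (-φ x) * h4
  have h6 : ‖Complex.exp (2 * Real.pi * Complex.I * ξ * x)‖ = 1 := by
    rw [show (2 * Real.pi * Complex.I * ξ * x : ℂ) = (2 * Real.pi * ξ * x : ℝ) * Complex.I by
      push_cast; ring, Complex.norm_exp_ofReal_mul_I]
  rw [h5, norm_mul, h6, one_mul]
  simpa [Real.norm_eq_abs] using h3

theorem norm_le_cauchyKernel {u : ℝ → ℝ} {a A C : ℝ} (hA : 0 ≤ A) {J : Ival} {ξ : ℝ} {φ : ℝ → ℂ}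
    (h : IsAdapted u a A J ξ φ)
    (hC : ∀ s, 0 ≤ s → Real.exp (-a * evenInv u s) * (1 + s) ^ 2 ≤ C) (x : ℝ) :
    ‖φ x‖ ≤ A * C * (√J.len)⁻¹ * cauchyKernel J.center J.len x := by
  have hJ := J.len_pos
  refine (h.norm_le x).trans ?_
  have h0 : 0 ≤ |x - J.center| / J.len := by positivity
  have h1 := hC _ h0
  have hC0 : 0 ≤ C := le_trans (by positivity) h1
  have h2 : Real.exp (-a * evenInv u (|x - J.center| / J.len)) ≤
      C * cauchyKernel J.center J.len x := by
    refine le_trans ?_ (mul_le_mul_of_nonneg_left (inv_sq_le_cauchyKernel J.center x hJ) hC0)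
    rwa [← div_eq_mul_inv, le_div_iff₀ (by positivity)]
  calc _ ≤ A * (√J.len)⁻¹ * (C * cauchyKernel J.center J.len x) := by gcongr
    _ = _ := by ring

theorem integrable {u : ℝ → ℝ} {a A C : ℝ} (hA : 0 ≤ A) {J : Ival} {ξ : ℝ} {φ : ℝ → ℂ}
    (h : IsAdapted u a A J ξ φ)
    (hC : ∀ s, 0 ≤ s → Real.exp (-a * evenInv u s) * (1 + s) ^ 2 ≤ C) : Integrable φ :=
  Integrable.mono' ((integrable_cauchyKernel J.center J.len_pos).const_mul _)
    h.continuous.aestronglyMeasurable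
    (Filter.Eventually.of_forall (h.norm_le_cauchyKernel hA hC))

theorem integral_norm_le {u : ℝ → ℝ} {a A C : ℝ} (hA : 0 ≤ A) {J : Ival} {ξ : ℝ} {φ : ℝ → ℂ}
    (h : IsAdapted u a A J ξ φ)
    (hC : ∀ s, 0 ≤ s → Real.exp (-a * evenInv u s) * (1 + s) ^ 2 ≤ C) :
    ∫ x, ‖φ x‖ ≤ A * C * (√J.len)⁻¹ * (Real.pi * J.len) := by
  rw [← integral_cauchyKernel J.center J.len_pos, ← integral_const_mul]
  exact integral_mono (h.integrable hA hC).norm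
    ((integrable_cauchyKernel J.center J.len_pos).const_mul _) (h.norm_le_cauchyKernel hA hC)

/-- Approximation of a packet by exponential polynomials at its frequency, on the interval of
radius `ρ` around `q`. -/
theorem exists_expPoly_norm_sub_le {u : ℝ → ℝ} {a A C R ε : ℝ} (hA : 0 ≤ A) (hε0 : 0 < ε)
    (hε : ε ≤ 1) {J : Ival} {ξ η : ℝ} {φ : ℝ → ℂ} (h : IsAdapted u a A J ξ φ)
    (hC : ∀ s, 0 ≤ s → Real.exp (-a * evenInv u s) * (1 + s) ^ 2 ≤ C)
    (hsupp : tsupport (𝓕 φ) ⊆ Icc (η - ε / J.len / 2) (η + ε / J.len / 2))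
    (hη : |η - ξ| ≤ R / J.len) {F : Finset ℝ} {D : ℕ} (hξ : ξ ∈ F) (q : ℝ) {ρ : ℝ}
    (hρD : 2 * Real.pi * (R + 1) * (ρ / J.len) ≤ (D + 1) / 2) :
    ∃ v ∈ expPoly F D, ∀ x : ℝ, |x - q| ≤ ρ → ‖φ x - v x‖ ≤
      2 * Real.pi * A * C * (√J.len)⁻¹ *
        ((2 * Real.pi * (R + 1) * (ρ / J.len)) ^ D / D.factorial) := by
  have hJ := J.len_pos
  have hR : 0 ≤ R := by
    have := (abs_nonneg _).trans hη
    rw [le_div_iff₀ hJ, zero_mul] at this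
    exact this
  have hC0 : 0 ≤ C := le_trans (by positivity) (hC 0 le_rfl)
  have hεJ : 0 < ε / J.len := by positivity
  obtain ⟨v, hv, hvx⟩ := MFCZ.exists_expPoly_norm_sub_le (W := (R + 1) / J.len) h.continuous
    (h.integrable hA hC) (lo := η - ε / J.len / 2) (hi' := η + ε / J.len / 2) (by linarith)
    ((subset_tsupport _).trans hsupp) (ξ := ξ) (D := D) (by
      intro ζ hζ
      have h1 : |ζ - η| ≤ ε / J.len / 2 := by
        rw [abs_le]; constructor <;> linarith [hζ.1, hζ.2]
      have h2 : |ζ - ξ| ≤ |ζ - η| + |η - ξ| := by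
        have := abs_add_le (ζ - η) (η - ξ)
        rwa [show ζ - η + (η - ξ) = ζ - ξ by ring] at this
      have h3 : ε / J.len ≤ 1 / J.len := by gcongr
      rw [add_div]
      linarith) hξ q
  refine ⟨v, hv, fun x hx => ?_⟩
  have hρ : 0 ≤ ρ := (abs_nonneg _).trans hx
  refine (hvx x _ ?_ hρD).trans ?_
  · calc 2 * Real.pi * ((R + 1) / J.len) * |x - q| ≤ 2 * Real.pi * ((R + 1) / J.len) * ρ := by
          gcongr
      _ = _ := by ring
  · set Y := (2 * Real.pi * (R + 1) * (ρ / J.len)) ^ D / (D.factorial : ℝ) with hY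
    have hY0 : 0 ≤ Y := by positivity
    calc 2 * Y * ((η + ε / J.len / 2 - (η - ε / J.len / 2)) * ∫ x, ‖φ x‖)
        = 2 * Y * (ε / J.len * ∫ x, ‖φ x‖) := by ring
      _ ≤ 2 * Y * (1 / J.len * (A * C * (√J.len)⁻¹ * (Real.pi * J.len))) := by
          gcongr
          exact h.integral_norm_le hA hC
      _ = _ := by field_simp

end IsAdapted

/-- Beyond distance `u t` the exponential factor has both the exponential gain of the level `t` and
rapid spatial decay. -/
theorem IsOsgood.exp_evenInv_le {u : ℝ → ℝ} (hu : IsOsgood u) {a C t s : ℝ} {n : ℕ} (ha : 0 < a)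
    (hC : ∀ s, 0 ≤ s → Real.exp (-(a / 2) * evenInv u s) * (1 + s) ^ n ≤ C) (ht : 0 ≤ t)
    (hs : u t ≤ s) :
    Real.exp (-a * evenInv u s) ≤ C * Real.exp (-(a / 2 * t)) * ((1 + s) ^ n)⁻¹ := by
  have hs0 : 0 ≤ s := (hu.pos t ht).le.trans hs
  have h1 := hu.le_evenInv ht hs
  have h2 : Real.exp (-a * evenInv u s) =
      Real.exp (-(a / 2) * evenInv u s) * Real.exp (-(a / 2) * evenInv u s) := by
    rw [← Real.exp_add]; congr 1; ring
  have h3 : Real.exp (-(a / 2) * evenInv u s) ≤ C * ((1 + s) ^ n)⁻¹ := by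
    rw [← div_eq_mul_inv, le_div_iff₀ (by positivity)]
    exact hC s hs0
  have h4 : Real.exp (-(a / 2) * evenInv u s) ≤ Real.exp (-(a / 2 * t)) := by
    apply Real.exp_le_exp.2
    nlinarith
  rw [h2]
  calc _ ≤ C * ((1 + s) ^ n)⁻¹ * Real.exp (-(a / 2 * t)) := by
        gcongr
        exact le_trans (Real.exp_pos _).le h3
    _ = _ := by ring

/-! ### The exceptional set of the maximal function -/

theorem Ival.measurableSet_toSet (I : Ival) : MeasurableSet I.toSet := measurableSet_Ico

theorem Ival.volume_toSet (I : Ival) : volume I.toSet = ENNReal.ofReal I.len := by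
  simp [Ival.toSet]

theorem lintegral_enorm_rpow_eq {p : ℝ} (hp : 0 ≤ p) {f : ℝ → ℂ}
    (hf : Integrable fun x => ‖f x‖ ^ p) (s : Set ℝ) :
    ∫⁻ x in s, ‖f x‖ₑ ^ p = ENNReal.ofReal (∫ x in s, ‖f x‖ ^ p) := by
  rw [ofReal_integral_eq_lintegral_ofReal hf.integrableOn
    (Filter.Eventually.of_forall fun x => by positivity)]
  refine lintegral_congr fun x => ?_
  rw [← ofReal_norm, ENNReal.ofReal_rpow_of_nonneg (norm_nonneg _) hp]

theorem mem_excSet_iff {p lam : ℝ} (hp : 0 < p) (hlam : 0 < lam) {f : ℝ → ℂ}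
    (hf : Integrable fun x => ‖f x‖ ^ p) {x : ℝ} :
    x ∈ excSet p f lam ↔ ∃ I : Ival, x ∈ I.toSet ∧ lam ^ p * I.len < ∫ y in I.toSet, ‖f y‖ ^ p := by
  simp only [excSet, maximal, mem_ofPred_eq, lt_iSup_iff, exists_prop]
  refine exists_congr fun I => and_congr_right fun _ => ?_
  have hI := I.len_pos
  rw [one_div, ENNReal.lt_rpow_inv_iff hp, ENNReal.lt_div_iff_mul_lt (by simp [hI]) (by simp),
    ENNReal.ofReal_rpow_of_pos hlam, ← ENNReal.ofReal_mul (by positivity),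
    lintegral_enorm_rpow_eq hp.le hf, ENNReal.ofReal_lt_ofReal_iff_of_nonneg (by positivity)]

theorem setIntegral_le_of_not_mem_excSet {p lam : ℝ} (hp : 0 < p) (hlam : 0 < lam) {f : ℝ → ℂ}
    (hf : Integrable fun x => ‖f x‖ ^ p) {x : ℝ} (hx : x ∉ excSet p f lam) {I : Ival}
    (hxI : x ∈ I.toSet) : ∫ y in I.toSet, ‖f y‖ ^ p ≤ lam ^ p * I.len := by
  by_contra! h
  exact hx ((mem_excSet_iff hp hlam hf).2 ⟨I, hxI, h⟩)

/-- The half-open intervals in the definition of the maximal function can be extended slightly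
to the left, so they cause no failure of openness. -/
theorem isOpen_excSet {p lam : ℝ} (hp : 0 < p) (hlam : 0 < lam) {f : ℝ → ℂ}
    (hf : Integrable fun x => ‖f x‖ ^ p) : IsOpen (excSet p f lam) := by
  rw [isOpen_iff_mem_nhds]
  intro x hx
  obtain ⟨I, hxI, hI⟩ := (mem_excSet_iff hp hlam hf).1 hx
  have hp' : 0 < lam ^ p := by positivity
  set s : ℝ := ((∫ y in I.toSet, ‖f y‖ ^ p) / lam ^ p - I.len) / 2 with hs
  have hs0 : 0 < s := by
    have : I.len < (∫ y in I.toSet, ‖f y‖ ^ p) / lam ^ p := by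
      rw [lt_div_iff₀ hp']; linarith
    rw [hs]; linarith
  refine Filter.mem_of_superset (Ioo_mem_nhds (a := I.left - s) (b := I.left + I.len)
    (by linarith [hxI.1]) hxI.2) fun y hy => ?_
  refine (mem_excSet_iff hp hlam hf).2 ⟨⟨I.left - s, I.len + s, by linarith [I.len_pos]⟩,
    ⟨hy.1.le, by have := hy.2; simp only; linarith⟩, ?_⟩
  have h1 : lam ^ p * (I.len + s) < ∫ y in I.toSet, ‖f y‖ ^ p := by
    have : I.len + s < (∫ y in I.toSet, ‖f y‖ ^ p) / lam ^ p := by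
      rw [hs] at hs0 ⊢; linarith
    rw [lt_div_iff₀ hp'] at this; linarith
  refine h1.trans_le (setIntegral_mono_set hf.integrableOn
    (Filter.Eventually.of_forall fun y => by positivity) (Filter.Eventually.of_forall ?_))
  exact Ico_subset_Ico (by simp only; linarith) (by simp only; linarith)

/-- The weak type inequality for the maximal function. -/
theorem volume_excSet_le {p lam : ℝ} (hp : 0 < p) (hlam : 0 < lam) {f : ℝ → ℂ}
    (hf : Integrable fun x => ‖f x‖ ^ p) :
    volume (excSet p f lam) ≤ ENNReal.ofReal (5 * (lam ^ p)⁻¹ * ∫ x, ‖f x‖ ^ p) := by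
  have hp' : 0 < lam ^ p := by positivity
  set t : Set Ival := {I | lam ^ p * I.len < ∫ y in I.toSet, ‖f y‖ ^ p} with ht
  have hlen : ∀ I ∈ t, I.len / 2 ≤ (∫ x, ‖f x‖ ^ p) / lam ^ p / 2 := by
    intro I hI
    have h1 : ∫ y in I.toSet, ‖f y‖ ^ p ≤ ∫ x, ‖f x‖ ^ p :=
      setIntegral_le_integral hf (Filter.Eventually.of_forall fun x => by positivity)
    gcongr
    rw [le_div_iff₀ hp']
    have : lam ^ p * I.len < ∫ y in I.toSet, ‖f y‖ ^ p := hI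
    linarith
  obtain ⟨w, hwt, hdisj, hcov⟩ := Vitali.exists_disjoint_subfamily_covering_enlargement_closedBall
    t Ival.center (fun I => I.len / 2) _ hlen 5 (by norm_num)
  have hball : ∀ I : Ival, I.toSet ⊆ Metric.closedBall I.center (I.len / 2) := by
    intro I x hx
    rw [Real.closedBall_eq_Icc, Ival.center]
    exact ⟨by linarith [hx.1], by linarith [hx.2]⟩
  have hwc : w.Countable := hdisj.countable_of_nonempty_interior fun I _ => by
    rw [Real.closedBall_eq_Icc, interior_Icc, nonempty_Ioo]
    linarith [I.len_pos]
  have hdisj' : w.PairwiseDisjoint Ival.toSet := hdisj.mono fun I => hball I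
  have hsub : excSet p f lam ⊆ ⋃ I ∈ w, Metric.closedBall I.center (5 * (I.len / 2)) := by
    intro x hx
    obtain ⟨I, hxI, hI⟩ := (mem_excSet_iff hp hlam hf).1 hx
    obtain ⟨J, hJ, hIJ⟩ := hcov I hI
    exact mem_biUnion hJ (hIJ (hball I hxI))
  have := hwc.to_subtype
  calc volume (excSet p f lam)
      ≤ volume (⋃ I ∈ w, Metric.closedBall I.center (5 * (I.len / 2))) := measure_mono hsub
    _ ≤ ∑' I : w, volume (Metric.closedBall I.1.center (5 * (I.1.len / 2))) :=
        measure_biUnion_le volume hwc _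
    _ ≤ ∑' I : w, ENNReal.ofReal (5 * (lam ^ p)⁻¹) * ∫⁻ x in I.1.toSet, ‖f x‖ₑ ^ p := by
        refine ENNReal.tsum_le_tsum fun I => ?_
        rw [Real.volume_closedBall, lintegral_enorm_rpow_eq hp.le hf,
          ← ENNReal.ofReal_mul (by positivity)]
        apply ENNReal.ofReal_le_ofReal
        have : lam ^ p * I.1.len < ∫ y in I.1.toSet, ‖f y‖ ^ p := hwt I.2
        calc 2 * (5 * (I.1.len / 2)) = 5 * (lam ^ p)⁻¹ * (lam ^ p * I.1.len) := by field_simp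
          _ ≤ _ := by gcongr
    _ = ENNReal.ofReal (5 * (lam ^ p)⁻¹) * ∫⁻ x in ⋃ I ∈ w, I.toSet, ‖f x‖ₑ ^ p := by
        rw [ENNReal.tsum_mul_left, lintegral_biUnion hwc
          (fun I _ => I.measurableSet_toSet) hdisj']
    _ ≤ ENNReal.ofReal (5 * (lam ^ p)⁻¹) * ∫⁻ x in univ, ‖f x‖ₑ ^ p := by
        gcongr
        exact subset_univ _
    _ = _ := by
        rw [lintegral_enorm_rpow_eq hp.le hf, ← ENNReal.ofReal_mul (by positivity),
          Measure.restrict_univ]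

/-- Lebesgue differentiation. -/
theorem ae_norm_le_of_not_mem_excSet {p lam : ℝ} (hp : 0 < p) (hlam : 0 < lam) {f : ℝ → ℂ}
    (hf : Integrable fun x => ‖f x‖ ^ p) : ∀ᵐ x, x ∉ excSet p f lam → ‖f x‖ ≤ lam := by
  filter_upwards [IsUnifLocDoublingMeasure.ae_tendsto_average (μ := volume)
    hf.locallyIntegrable 1] with x hx hxE
  have hlim : Filter.Tendsto (fun n : ℕ => 1 / ((n : ℝ) + 1)) Filter.atTop
      (nhdsWithin 0 (Ioi 0)) := by
    refine tendsto_nhdsWithin_iff.2 ⟨tendsto_one_div_add_atTop_nhds_zero_nat,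
      Filter.Eventually.of_forall fun n => ?_⟩
    simp only [mem_Ioi]; positivity
  have h1 := hx (fun _ => x) _ hlim (Filter.Eventually.of_forall fun n =>
    Metric.mem_closedBall_self (by positivity))
  have h2 : ‖f x‖ ^ p ≤ lam ^ p := by
    refine le_of_tendsto h1 (Filter.Eventually.of_forall fun n => ?_)
    set δ : ℝ := 1 / ((n : ℝ) + 1) with hδ
    have hδ0 : 0 < δ := by positivity
    have h3 := setIntegral_le_of_not_mem_excSet hp hlam hf hxE
      (I := ⟨x - δ, 2 * δ, by positivity⟩) ⟨by simp only; linarith, by simp only; linarith⟩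
    rw [setAverage_eq, Real.closedBall_eq_Icc, measureReal_def, Real.volume_Icc,
      integral_Icc_eq_integral_Ico, smul_eq_mul, ENNReal.toReal_ofReal (by linarith),
      inv_mul_le_iff₀ (by linarith)]
    simp only [Ival.toSet] at h3
    rw [show x - δ + 2 * δ = x + δ by ring] at h3
    linarith
  exact (Real.rpow_le_rpow_iff (norm_nonneg _) hlam.le hp).1 h2

/-! ### Whitney intervals -/

/-- The interval `[m 2^j, (m + 1) 2^j)` of the standard dyadic grid, for `i = (j, m)`. -/
def gridIval (i : ℤ × ℤ) : Ival := ⟨i.2 * 2 ^ i.1, 2 ^ i.1, by positivity⟩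

theorem gridIval_len (i : ℤ × ℤ) : (gridIval i).len = 2 ^ i.1 := rfl

theorem mem_gridIval_iff {i : ℤ × ℤ} {x : ℝ} :
    x ∈ (gridIval i).toSet ↔ ⌊x / 2 ^ i.1⌋ = i.2 := by
  have h : (0 : ℝ) < 2 ^ i.1 := by positivity
  rw [Int.floor_eq_iff, le_div_iff₀ h, div_lt_iff₀ h, Ival.toSet, mem_Ico, gridIval, add_mul,
    one_mul]

theorem gridIval_subset {i i' : ℤ × ℤ} (hi : i.1 ≤ i'.1) {x : ℝ} (hx : x ∈ (gridIval i).toSet)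
    (hx' : x ∈ (gridIval i').toSet) : (gridIval i).toSet ⊆ (gridIval i').toSet := by
  obtain ⟨j, m⟩ := i
  obtain ⟨j', m'⟩ := i'
  obtain ⟨d, hd⟩ := Int.eq_ofNat_of_zero_le (sub_nonneg.2 hi)
  simp only at hd hi
  have hp : (0 : ℝ) < 2 ^ j := by positivity
  have e : (2 : ℝ) ^ j' = 2 ^ j * 2 ^ d := by
    rw [show j' = j + d by omega, zpow_add₀ two_ne_zero, zpow_natCast]
  rw [mem_gridIval_iff, Int.floor_eq_iff, le_div_iff₀ (by positivity),
    div_lt_iff₀ (by positivity)] at hx hx'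
  simp only [e] at hx hx'
  have h1 : m' * 2 ^ d ≤ m := by
    have : (m' * 2 ^ d : ℝ) < m + 1 := by
      refine lt_of_mul_lt_mul_right ?_ hp.le
      nlinarith [hx.2, hx'.1]
    have : m' * 2 ^ d < m + 1 := by exact_mod_cast this
    omega
  have h2 : m + 1 ≤ (m' + 1) * 2 ^ d := by
    have : (m : ℝ) < (m' + 1) * 2 ^ d := by
      refine lt_of_mul_lt_mul_right ?_ hp.le
      nlinarith [hx.1, hx'.2]
    have : m < (m' + 1) * 2 ^ d := by exact_mod_cast this
    omega
  have h1' : (m' * 2 ^ d : ℝ) ≤ m := by exact_mod_cast h1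
  have h2' : (m + 1 : ℝ) ≤ (m' + 1) * 2 ^ d := by exact_mod_cast h2
  apply Ico_subset_Ico
  · simp only [gridIval, e]
    nlinarith
  · simp only [gridIval, e]
    nlinarith

theorem dilate_subset_dilate {I J : Ival} (h : I.toSet ⊆ J.toSet) {r : ℝ} (hr : 1 ≤ r) :
    Ival.dilate r I ⊆ Ival.dilate r J := by
  have hI := I.len_pos
  rw [Ival.toSet, Ival.toSet, Ico_subset_Ico_iff (by linarith)] at h
  obtain ⟨h1, h2⟩ := h
  have h3 : I.len ≤ J.len := by linarith
  apply Ico_subset_Ico <;> simp only [Ival.center] <;> nlinarith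

/-- The parent of a grid interval. -/
def gridParent (i : ℤ × ℤ) : ℤ × ℤ := (i.1 + 1, i.2 / 2)

theorem gridIval_subset_parent (i : ℤ × ℤ) :
    (gridIval i).toSet ⊆ (gridIval (gridParent i)).toSet := by
  have hp : (0 : ℝ) < 2 ^ i.1 := by positivity
  have e : (2 : ℝ) ^ (i.1 + 1) = 2 ^ i.1 * 2 := by rw [zpow_add₀ two_ne_zero, zpow_one]
  have h1 : 2 * (i.2 / 2) ≤ i.2 := by omega
  have h2 : i.2 + 1 ≤ 2 * (i.2 / 2) + 2 := by omega
  have h1' : (2 * ((i.2 / 2 : ℤ) : ℝ)) ≤ i.2 := by exact_mod_cast h1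
  have h2' : (i.2 + 1 : ℝ) ≤ 2 * ((i.2 / 2 : ℤ) : ℝ) + 2 := by exact_mod_cast h2
  apply Ico_subset_Ico
  · simp only [gridIval, gridParent, e]
    nlinarith
  · simp only [gridIval, gridParent, e]
    nlinarith

/-- Whitney intervals of `E`: the maximal grid intervals whose dilate by `1024` lies in `E`. The
factor is taken large so that the distance to the complement of `E` is nearly constant on the
tripled interval. -/
def IsWhitney (E : Set ℝ) (i : ℤ × ℤ) : Prop :=
  Ival.dilate 1024 (gridIval i) ⊆ E ∧ ¬ Ival.dilate 1024 (gridIval (gridParent i)) ⊆ E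

/-- The tripled interval `3I`. -/
def Ival.triple (I : Ival) : Set ℝ := Ico (I.left - I.len) (I.left + 2 * I.len)

theorem Ival.toSet_subset_triple (I : Ival) : I.toSet ⊆ I.triple := by
  have := I.len_pos
  apply Ico_subset_Ico <;> linarith

theorem Ival.abs_sub_center_le_of_mem_triple {I : Ival} {x : ℝ} (hx : x ∈ I.triple) :
    |x - I.center| ≤ 3 / 2 * I.len := by
  rw [Ival.center, abs_le]
  constructor <;> linarith [hx.1, hx.2]

theorem Ival.toSet_subset_dilate (I : Ival) {r : ℝ} (hr : 1 ≤ r) : I.toSet ⊆ Ival.dilate r I := by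
  have := I.len_pos
  apply Ico_subset_Ico <;> rw [Ival.center] <;> nlinarith

theorem exists_isWhitney_mem {E : Set ℝ} (hE : IsOpen E) (hfin : volume E ≠ ⊤) {x : ℝ}
    (hx : x ∈ E) : ∃ i, IsWhitney E i ∧ x ∈ (gridIval i).toSet := by
  set Q : ℤ → ℤ × ℤ := fun j => (j, ⌊x / 2 ^ j⌋) with hQ
  have hxQ : ∀ j, x ∈ (gridIval (Q j)).toSet := fun j => mem_gridIval_iff.2 rfl
  obtain ⟨r, hr, hball⟩ := Metric.isOpen_iff.1 hE x hx
  have hinh : ∃ j, Ival.dilate 1024 (gridIval (Q j)) ⊆ E := by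
    obtain ⟨n, hn⟩ := exists_pow_lt_of_lt_one (show 0 < r / 1024 by positivity)
      (show (1 / 2 : ℝ) < 1 by norm_num)
    refine ⟨-n, Subset.trans (fun y hy => ?_) hball⟩
    have h1 : (gridIval (Q (-n))).len < r / 1024 := by
      rw [gridIval_len]
      simpa [zpow_neg, hQ] using hn
    have h2 := hxQ (-n)
    have h3 := (gridIval (Q (-n))).len_pos
    set I := gridIval (Q (-n))
    rw [Metric.mem_ball, Real.dist_eq, abs_lt]
    simp only [Ival.dilate, Ival.center, mem_Ico] at hy
    constructor <;> linarith [h2.1, h2.2, hy.1, hy.2]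
  have hbdd : ∃ b : ℤ, ∀ j, Ival.dilate 1024 (gridIval (Q j)) ⊆ E → j ≤ b := by
    obtain ⟨n, hn⟩ := pow_unbounded_of_one_lt (volume E).toReal (show (1 : ℝ) < 2 by norm_num)
    refine ⟨n, fun j hj => ?_⟩
    by_contra! hlt
    have h1 : volume (gridIval (Q j)).toSet ≤ volume E :=
      measure_mono (((gridIval (Q j)).toSet_subset_dilate (by norm_num)).trans hj)
    rw [Ival.volume_toSet, ENNReal.ofReal_le_iff_le_toReal hfin, gridIval_len] at h1
    have h2 : (2 : ℝ) ^ (n : ℤ) ≤ 2 ^ j := zpow_le_zpow_right₀ one_le_two hlt.le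
    rw [zpow_natCast] at h2
    have h3 : (2 : ℝ) ^ j ≤ (volume E).toReal := h1
    linarith
  obtain ⟨j, hj, hmax⟩ := Int.exists_greatest_of_bdd hbdd hinh
  refine ⟨Q j, ⟨hj, fun h => ?_⟩, hxQ j⟩
  have h1 : gridParent (Q j) = Q (j + 1) := by
    have h2 := gridIval_subset_parent (Q j) (hxQ j)
    rw [mem_gridIval_iff] at h2
    ext
    · rfl
    · exact h2.symm
  rw [h1] at h
  have := hmax _ h
  omega

theorem IsWhitney.disjoint {E : Set ℝ} {i i' : ℤ × ℤ} (hi : IsWhitney E i) (hi' : IsWhitney E i')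
    (hne : i ≠ i') : Disjoint (gridIval i).toSet (gridIval i').toSet := by
  wlog hle : i.1 ≤ i'.1 generalizing i i'
  · exact (this hi' hi hne.symm (by omega)).symm
  rw [Set.disjoint_left]
  intro x hx hx'
  rcases hle.eq_or_lt with h | h
  · apply hne
    rw [mem_gridIval_iff] at hx hx'
    rw [← h] at hx'
    exact Prod.ext h (hx.symm.trans hx')
  · exact hi.2 ((dilate_subset_dilate (gridIval_subset (i := gridParent i) h
      (gridIval_subset_parent i hx) hx') (by norm_num)).trans hi'.1)

theorem IsWhitney.le_abs_sub {E : Set ℝ} {i : ℤ × ℤ} (hi : IsWhitney E i) {x z : ℝ}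
    (hx : x ∈ (gridIval i).triple) (hz : z ∉ E) : 500 * (gridIval i).len ≤ |x - z| := by
  have h1 : z ∉ Ival.dilate 1024 (gridIval i) := fun h => hz (hi.1 h)
  have hl := (gridIval i).len_pos
  have hx' := Ival.abs_sub_center_le_of_mem_triple hx
  rw [abs_le] at hx'
  simp only [Ival.dilate, mem_Ico, not_and_or, not_le, not_lt] at h1
  rw [le_abs]
  rcases h1 with h1 | h1
  · left; linarith
  · right; linarith

theorem IsWhitney.exists_not_mem {E : Set ℝ} {i : ℤ × ℤ} (hi : IsWhitney E i) :
    ∃ z, z ∉ E ∧ z ∈ Ival.dilate 1024 (gridIval (gridParent i)) := by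
  obtain ⟨z, hz, hzE⟩ := not_subset.1 hi.2
  exact ⟨z, hzE, hz⟩

theorem gridParent_len (i : ℤ × ℤ) : (gridIval (gridParent i)).len = 2 * (gridIval i).len := by
  rw [gridIval_len, gridIval_len, gridParent, zpow_add₀ two_ne_zero, zpow_one, mul_comm]

theorem abs_sub_le_of_mem_dilate_parent {i : ℤ × ℤ} {x z : ℝ}
    (hz : z ∈ Ival.dilate 1024 (gridIval (gridParent i))) (hx : x ∈ (gridIval i).triple) :
    |x - z| ≤ 1100 * (gridIval i).len := by
  have hl := (gridIval i).len_pos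
  have h1 := gridIval_subset_parent i
  rw [Ival.toSet, Ival.toSet, Ico_subset_Ico_iff (by linarith), gridParent_len] at h1
  rw [Ival.dilate, Ival.center, gridParent_len, mem_Ico] at hz
  rw [abs_le]
  constructor <;> linarith [hz.1, hz.2, h1.1, h1.2, hx.1, hx.2]

/-- The tripled Whitney intervals overlap at most `9`-fold: those at `x` have one of three
consecutive lengths, and three positions for each. -/
theorem exists_finset_isWhitney (E : Set ℝ) (x : ℝ) :
    ∃ s : Finset (ℤ × ℤ), s.card ≤ 9 ∧
      ∀ i, IsWhitney E i → x ∈ (gridIval i).triple → i ∈ s := by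
  by_cases hne : ∃ i, IsWhitney E i ∧ x ∈ (gridIval i).triple
  swap
  · exact ⟨∅, by simp, fun i hi hx => absurd ⟨i, hi, hx⟩ hne⟩
  obtain ⟨i₀, hi₀, hx₀⟩ := hne
  have key : ∀ i i' : ℤ × ℤ, IsWhitney E i → IsWhitney E i' → x ∈ (gridIval i).triple →
      x ∈ (gridIval i').triple → i.1 ≤ i'.1 + 1 := by
    intro i i' hi hi' hx hx'
    obtain ⟨z, hz, hz'⟩ := hi'.exists_not_mem
    have h1 := (hi.le_abs_sub hx hz).trans (abs_sub_le_of_mem_dilate_parent hz' hx')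
    by_contra! hlt
    have h2 : (2 : ℝ) ^ (i'.1 + 2) ≤ 2 ^ i.1 := zpow_le_zpow_right₀ one_le_two (by omega)
    rw [zpow_add₀ two_ne_zero] at h2
    rw [gridIval_len, gridIval_len] at h1
    have h3 : (0 : ℝ) < 2 ^ i'.1 := by positivity
    norm_num at h2
    linarith
  refine ⟨(Finset.Icc (i₀.1 - 1) (i₀.1 + 1) ×ˢ Finset.Icc (-1 : ℤ) 1).image
    fun y => (y.1, ⌊x / 2 ^ y.1⌋ + y.2), ?_, ?_⟩
  · refine Finset.card_image_le.trans ?_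
    rw [Finset.card_product, Int.card_Icc, Int.card_Icc]
    have : (i₀.1 + 1 + 1 - (i₀.1 - 1)).toNat = 3 := by omega
    rw [this]
    decide
  · intro i hi hx
    rw [Finset.mem_image]
    refine ⟨(i.1, i.2 - ⌊x / 2 ^ i.1⌋), ?_, by simp⟩
    have h1 := key i i₀ hi hi₀ hx hx₀
    have h2 := key i₀ i hi₀ hi hx₀ hx
    have hp : (0 : ℝ) < 2 ^ i.1 := by positivity
    have h3 : i.2 - 1 ≤ ⌊x / 2 ^ i.1⌋ := by
      rw [Int.le_floor, le_div_iff₀ hp]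
      have := hx.1
      simp only [gridIval] at this
      push_cast
      linarith
    have h4 : ⌊x / 2 ^ i.1⌋ < i.2 + 2 := by
      rw [Int.floor_lt, div_lt_iff₀ hp]
      have := hx.2
      simp only [gridIval] at this
      push_cast
      linarith
    simp only [Finset.mem_product, Finset.mem_Icc]
    omega

/-- A fixed dilate of a Whitney interval meets the complement of the exceptional set, so averages
over the Whitney interval are controlled. -/
theorem IsWhitney.setIntegral_le {p lam : ℝ} (hp : 0 < p) (hlam : 0 < lam) {f : ℝ → ℂ}
    (hf : Integrable fun x => ‖f x‖ ^ p) {i : ℤ × ℤ} (hi : IsWhitney (excSet p f lam) i) :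
    ∫ y in (gridIval i).toSet, ‖f y‖ ^ p ≤ 2048 * lam ^ p * (gridIval i).len := by
  obtain ⟨z, hz, hz'⟩ := hi.exists_not_mem
  set P := gridIval (gridParent i) with hP
  have hPl := P.len_pos
  have hset : (⟨P.center - 1024 * P.len / 2, 1024 * P.len, by positivity⟩ : Ival).toSet =
      Ival.dilate 1024 P := by
    simp only [Ival.toSet, Ival.dilate]
    congr 1
    ring
  have h1 := setIntegral_le_of_not_mem_excSet hp hlam hf hz
    (I := ⟨P.center - 1024 * P.len / 2, 1024 * P.len, by positivity⟩) (by rw [hset]; exact hz')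
  rw [hset] at h1
  simp only [hP, gridParent_len] at h1
  refine (setIntegral_mono_set hf.integrableOn (Filter.Eventually.of_forall fun y => by positivity)
    (Filter.Eventually.of_forall ?_)).trans (h1.trans (le_of_eq (by ring)))
  exact (gridIval_subset_parent i).trans (P.toSet_subset_dilate (by norm_num))

/-! ### The weights of the dyadic intervals -/

/-- The `m`-th of the `2 ^ n` dyadic subintervals of `I` of generation `n`. -/
def Ival.child (I : Ival) (n m : ℕ) : Ival :=
  ⟨I.left + m * (I.len / 2 ^ n), I.len / 2 ^ n, div_pos I.len_pos (by positivity)⟩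

theorem Ival.exists_child_eq {I J : Ival} (hJ : J ∈ I.dyadic) :
    ∃ i : ℕ × ℕ, i.2 < 2 ^ i.1 ∧ I.child i.1 i.2 = J := by
  obtain ⟨n, m, hm, h1, h2⟩ := hJ
  exact ⟨(n, m), hm, Ival.ext h1.symm h2.symm⟩

theorem Ival.countable_dyadic (I : Ival) : I.dyadic.Countable := by
  refine (countable_range fun i : ℕ × ℕ => I.child i.1 i.2).mono fun J hJ => ?_
  obtain ⟨i, -, rfl⟩ := Ival.exists_child_eq hJ
  exact ⟨i, rfl⟩

theorem Ival.disjoint_child (I : Ival) (n : ℕ) {m m' : ℕ} (h : m ≠ m') :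
    Disjoint (I.child n m).toSet (I.child n m').toSet := by
  wlog hlt : m < m' generalizing m m'
  · exact (this h.symm (by omega)).symm
  have hl : 0 < I.len / 2 ^ n := (I.child n m).len_pos
  have h1 : (m + 1 : ℝ) ≤ m' := by exact_mod_cast hlt
  rw [Set.disjoint_left]
  intro x hx hx'
  have h2 := hx.2
  have h3 := hx'.1
  simp only [Ival.child] at h2 h3
  nlinarith

/-- The sum is compared with the integral of the kernel centered at `x`, over the disjoint intervals
of the generation. -/
theorem sum_cauchyKernel_child_le (I : Ival) (n : ℕ) (x : ℝ) :
    ∑ m ∈ Finset.range (2 ^ n), cauchyKernel (I.child n m).center (I.child n m).len x ≤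
      2 * Real.pi := by
  set ℓ : ℝ := I.len / 2 ^ n with hℓ
  have hl : 0 < ℓ := (I.child n 0).len_pos
  have hlen : ∀ m, (I.child n m).len = ℓ := fun m => rfl
  have hint := integrable_cauchyKernel x hl
  have h1 : ∀ m, ℓ * cauchyKernel (I.child n m).center ℓ x ≤
      ∫ y in (I.child n m).toSet, 2 * cauchyKernel x ℓ y := by
    intro m
    have h2 : ∫ y in (I.child n m).toSet, cauchyKernel (I.child n m).center ℓ x =
        ℓ * cauchyKernel (I.child n m).center ℓ x := by
      rw [setIntegral_const, measureReal_def, Ival.volume_toSet, hlen, ENNReal.toReal_ofReal hl.le,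
        smul_eq_mul]
    rw [← h2]
    refine setIntegral_mono_on ?_ (hint.const_mul 2).integrableOn (Ival.measurableSet_toSet _) ?_
    · refine integrableOn_const ?_
      rw [Ival.volume_toSet]; simp
    · intro y hy
      rw [cauchyKernel_comm x ℓ y]
      refine cauchyKernel_le_two_mul hl le_rfl ?_ x
      rw [abs_le, Ival.center, hlen]
      have h3 := hy.2
      rw [hlen] at h3
      constructor <;> linarith [hy.1]
  have h4 : ∑ m ∈ Finset.range (2 ^ n), ℓ * cauchyKernel (I.child n m).center ℓ x ≤
      2 * (Real.pi * ℓ) := by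
    refine (Finset.sum_le_sum fun m _ => h1 m).trans ?_
    rw [← integral_biUnion_finset _ (fun m _ => Ival.measurableSet_toSet _)
      (fun m _ m' _ h => I.disjoint_child n h) (fun m _ => (hint.const_mul 2).integrableOn),
      ← integral_cauchyKernel x hl, ← integral_const_mul]
    exact setIntegral_le_integral (hint.const_mul 2)
      (Filter.Eventually.of_forall fun y => by have := cauchyKernel_pos x ℓ y; positivity)
  rw [← Finset.mul_sum] at h4
  simp only [hlen]
  nlinarith

/-- A bump in the variable `log y`. It is `t ↦ t / (1 + t)` at `2y` minus the same at `y`, so its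
sums over dyadic `y` telescope. -/
def scaleGain (y : ℝ) : ℝ := y / ((1 + y) * (1 + 2 * y))

theorem scaleGain_nonneg {y : ℝ} (hy : 0 ≤ y) : 0 ≤ scaleGain y := by
  unfold scaleGain; positivity

theorem scaleGain_le_one {y : ℝ} (hy : 0 ≤ y) : scaleGain y ≤ 1 := by
  unfold scaleGain
  rw [div_le_one (by positivity)]
  nlinarith

theorem scaleGain_eq {y : ℝ} (hy : 0 ≤ y) :
    scaleGain y = 2 * y / (1 + 2 * y) - y / (1 + y) := by
  unfold scaleGain
  field_simp
  ring

theorem le_mul_scaleGain {y r : ℝ} (hy : 0 ≤ y) (hr : 1 ≤ r) (hyr : y ≤ r) :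
    y ≤ 6 * r ^ 2 * scaleGain y := by
  unfold scaleGain
  rw [mul_div_assoc', le_div_iff₀ (by positivity)]
  have : (1 + y) * (1 + 2 * y) ≤ 6 * r ^ 2 := by nlinarith
  nlinarith

theorem sum_scaleGain_le {y : ℝ} (hy : 0 ≤ y) (N : ℕ) :
    ∑ n ∈ Finset.range N, scaleGain (y * 2 ^ n) ≤ 1 := by
  have h : ∀ n ∈ Finset.range N, scaleGain (y * 2 ^ n) =
      y * 2 ^ (n + 1) / (1 + y * 2 ^ (n + 1)) - y * 2 ^ n / (1 + y * 2 ^ n) := by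
    intro n _
    rw [scaleGain_eq (by positivity)]
    ring_nf
  rw [Finset.sum_congr rfl h,
    Finset.sum_range_sub fun n => y * 2 ^ n / (1 + y * 2 ^ n)]
  have h1 : y * 2 ^ N / (1 + y * 2 ^ N) ≤ 1 := by
    rw [div_le_one (by positivity)]; linarith
  have h2 : 0 ≤ y * 2 ^ 0 / (1 + y * 2 ^ 0) := by positivity
  linarith

/-- The density against which the part of the bad function at `x` is weighted when paired with a
packet on `J ∈ 𝒟(I)`, for `len = |I|`. The first summand stems from cancellation at the Whitney
scale of `x`, the second from points far away from `I`. -/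
def packetWeight (E : Set ℝ) (len : ℝ) (J : Ival) (x : ℝ) : ℝ :=
  cauchyKernel J.center J.len x ^ 2 * (scaleGain (Metric.infDist x Eᶜ / J.len) + J.len / len)

theorem packetWeight_nonneg (E : Set ℝ) {len : ℝ} (hl : 0 < len) (J : Ival) (x : ℝ) :
    0 ≤ packetWeight E len J x := by
  have := J.len_pos
  have h1 : 0 ≤ scaleGain (Metric.infDist x Eᶜ / J.len) :=
    scaleGain_nonneg (div_nonneg Metric.infDist_nonneg this.le)
  unfold packetWeight
  positivity

theorem continuous_packetWeight (E : Set ℝ) (len : ℝ) (J : Ival) :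
    Continuous (packetWeight E len J) := by
  have hJ := J.len_pos
  unfold packetWeight scaleGain
  refine ((continuous_cauchyKernel _ _).pow 2).mul (Continuous.add (Continuous.div ?_ ?_ ?_)
    continuous_const)
  · exact (Metric.continuous_infDist_pt _).div_const _
  · have := (Metric.continuous_infDist_pt (α := ℝ) Eᶜ).div_const J.len
    fun_prop
  · intro x
    have : 0 ≤ Metric.infDist x Eᶜ / J.len := div_nonneg Metric.infDist_nonneg hJ.le
    positivity

theorem packetWeight_le (E : Set ℝ) {len : ℝ} {J : Ival} (hl : J.len ≤ len) (x : ℝ) :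
    packetWeight E len J x ≤ 2 * cauchyKernel J.center J.len x := by
  have hJ := J.len_pos
  have h1 := scaleGain_le_one (y := Metric.infDist x Eᶜ / J.len)
    (div_nonneg Metric.infDist_nonneg hJ.le)
  have h2 : J.len / len ≤ 1 := div_le_one_of_le₀ hl (hJ.le.trans hl)
  have h3 := cauchyKernel_pos J.center J.len x
  have h4 := cauchyKernel_le_one J.center J.len x
  have h5 : 0 ≤ scaleGain (Metric.infDist x Eᶜ / J.len) :=
    scaleGain_nonneg (div_nonneg Metric.infDist_nonneg hJ.le)
  unfold packetWeight
  have h6 : cauchyKernel J.center J.len x ^ 2 ≤ cauchyKernel J.center J.len x := by nlinarith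
  calc _ ≤ cauchyKernel J.center J.len x ^ 2 * (1 + 1) := by gcongr
    _ ≤ cauchyKernel J.center J.len x * (1 + 1) := by gcongr
    _ = _ := by ring

theorem lintegral_packetWeight_le (E : Set ℝ) {len : ℝ} {J : Ival} (hl : J.len ≤ len) :
    ∫⁻ x, ENNReal.ofReal (packetWeight E len J x) ≤ ENNReal.ofReal (2 * Real.pi * J.len) := by
  rw [show 2 * Real.pi * J.len = 2 * (Real.pi * J.len) by ring,
    ENNReal.ofReal_mul zero_le_two, ← lintegral_cauchyKernel J.center J.len_pos,
    ← lintegral_const_mul _ (continuous_cauchyKernel _ _).measurable.ennreal_ofReal]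
  refine lintegral_mono fun x => ?_
  rw [← ENNReal.ofReal_mul zero_le_two]
  exact ENNReal.ofReal_le_ofReal (packetWeight_le E hl x)

/-- Carleson packing: for fixed `x`, the kernels of one generation sum to a constant, the scale
factors sum to a constant over the generations, and a kernel adapted to `J₀` remains. -/
theorem tsum_lintegral_packetWeight_le (E : Set ℝ) (I J₀ : Ival) (𝒥 : Set Ival)
    (h𝒥 : ∀ J ∈ 𝒥, J ∈ I.dyadic ∧ J.toSet ⊆ J₀.toSet) :
    ∑' J : 𝒥, ∫⁻ x, ENNReal.ofReal (packetWeight E I.len J x) ≤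
      ENNReal.ofReal (12 * Real.pi ^ 2 * J₀.len) := by
  have hIl := I.len_pos
  have : Countable 𝒥 := (I.countable_dyadic.mono fun J hJ => (h𝒥 J hJ).1).to_subtype
  rw [← lintegral_tsum fun J : 𝒥 =>
    (continuous_packetWeight E I.len J.1).measurable.ennreal_ofReal.aemeasurable]
  have key : ∀ x, ∑' J : 𝒥, ENNReal.ofReal (packetWeight E I.len J x) ≤
      ENNReal.ofReal (12 * Real.pi) * ENNReal.ofReal (cauchyKernel J₀.center J₀.len x) := by
    intro x
    set y : ℝ := Metric.infDist x Eᶜ / I.len with hy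
    have hy0 : 0 ≤ y := div_nonneg Metric.infDist_nonneg hIl.le
    set g : ℕ → ℝ := fun n => scaleGain (y * 2 ^ n) + (1 / 2) ^ n with hg
    have hg0 : ∀ n, 0 ≤ g n := fun n =>
      add_nonneg (scaleGain_nonneg (by positivity)) (by positivity)
    set G : ℕ × ℕ → ℝ≥0∞ := fun i => if i.2 < 2 ^ i.1 then
      ENNReal.ofReal (cauchyKernel (I.child i.1 i.2).center (I.child i.1 i.2).len x * g i.1) else 0
      with hG
    have hidx : ∀ J : 𝒥, ∃ i : ℕ × ℕ, i.2 < 2 ^ i.1 ∧ I.child i.1 i.2 = J := fun J =>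
      Ival.exists_child_eq (h𝒥 J J.2).1
    choose e he1 he2 using hidx
    have hinj : Function.Injective e := fun J J' h => by
      apply Subtype.ext
      rw [← he2 J, ← he2 J', h]
    have hpt : ∀ J : 𝒥, ENNReal.ofReal (packetWeight E I.len J x) ≤
        ENNReal.ofReal (2 * cauchyKernel J₀.center J₀.len x) * G (e J) := by
      intro J
      have hk0 := cauchyKernel_pos J₀.center J₀.len x
      have hJl := J.1.len_pos
      simp only [hG, he1, if_true]
      rw [← ENNReal.ofReal_mul (by positivity), he2]
      apply ENNReal.ofReal_le_ofReal
      have hlen : J.1.len = I.len / 2 ^ (e J).1 := by rw [← he2 J]; rfl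
      have hg' : scaleGain (Metric.infDist x Eᶜ / J.1.len) + J.1.len / I.len = g (e J).1 := by
        rw [hg, hlen]
        simp only
        congr 1
        · congr 1
          rw [hy]; field_simp
        · rw [one_div, inv_pow]; field_simp
      rw [packetWeight, hg']
      have hsub := (h𝒥 J J.2).2
      rw [Ival.toSet, Ival.toSet, Ico_subset_Ico_iff (by linarith)] at hsub
      have hk := cauchyKernel_le_two_mul (c := J.1.center) (c' := J₀.center) hJl
        (ℓ' := J₀.len) (by linarith [hsub.1, hsub.2]) (by
          rw [abs_le, Ival.center, Ival.center]
          constructor <;> linarith [hsub.1, hsub.2]) x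
      have hk1 := cauchyKernel_pos J.1.center J.1.len x
      have := hg0 (e J).1
      calc _ = cauchyKernel J.1.center J.1.len x *
            (cauchyKernel J.1.center J.1.len x * g (e J).1) := by ring
        _ ≤ _ := by gcongr
    have hGsum : ∑' i, G i ≤ ENNReal.ofReal (6 * Real.pi) := by
      rw [ENNReal.tsum_prod (f := fun n m => G (n, m))]
      have h1 : ∀ n, ∑' m, G (n, m) ≤ ENNReal.ofReal (2 * Real.pi * g n) := by
        intro n
        rw [tsum_eq_sum (s := Finset.range (2 ^ n))]
        · calc ∑ m ∈ Finset.range (2 ^ n), G (n, m)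
              = ∑ m ∈ Finset.range (2 ^ n), ENNReal.ofReal
                (cauchyKernel (I.child n m).center (I.child n m).len x * g n) := by
                refine Finset.sum_congr rfl fun m hm => ?_
                simp only [hG, Finset.mem_range.1 hm, if_true]
            _ = ENNReal.ofReal (∑ m ∈ Finset.range (2 ^ n),
                cauchyKernel (I.child n m).center (I.child n m).len x * g n) := by
                rw [ENNReal.ofReal_sum_of_nonneg]
                intro m _
                exact mul_nonneg (cauchyKernel_pos _ _ _).le (hg0 n)
            _ ≤ _ := by
                apply ENNReal.ofReal_le_ofReal
                rw [← Finset.sum_mul]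
                have := hg0 n
                gcongr
                exact sum_cauchyKernel_child_le I n x
        · intro m hm
          rw [Finset.mem_range] at hm
          simp only [hG, hm, if_false]
      refine (ENNReal.tsum_le_tsum h1).trans (ENNReal.tsum_le_of_sum_range_le fun N => ?_)
      rw [← ENNReal.ofReal_sum_of_nonneg fun n _ => by
        have := hg0 n; positivity]
      apply ENNReal.ofReal_le_ofReal
      rw [← Finset.mul_sum]
      have h2 : ∑ n ∈ Finset.range N, g n ≤ 3 := by
        simp only [hg]
        rw [Finset.sum_add_distrib]
        have h3 := sum_scaleGain_le hy0 N
        have h4 : ∑ n ∈ Finset.range N, ((1 : ℝ) / 2) ^ n ≤ 2 := sum_geometric_two_le N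
        linarith
      nlinarith [Real.pi_pos]
    calc ∑' J : 𝒥, ENNReal.ofReal (packetWeight E I.len J x)
        ≤ ∑' J : 𝒥, ENNReal.ofReal (2 * cauchyKernel J₀.center J₀.len x) * G (e J) :=
          ENNReal.tsum_le_tsum hpt
      _ = ENNReal.ofReal (2 * cauchyKernel J₀.center J₀.len x) * ∑' J : 𝒥, G (e J) :=
          ENNReal.tsum_mul_left
      _ ≤ ENNReal.ofReal (2 * cauchyKernel J₀.center J₀.len x) * ENNReal.ofReal (6 * Real.pi) := by
          gcongr
          exact (ENNReal.tsum_comp_le_tsum_of_injective hinj G).trans hGsum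
      _ = _ := by
          have := cauchyKernel_pos J₀.center J₀.len x
          rw [← ENNReal.ofReal_mul (by positivity), ← ENNReal.ofReal_mul (by positivity)]
          congr 1
          ring
  refine (lintegral_mono key).trans ?_
  rw [lintegral_const_mul _ (continuous_cauchyKernel _ _).measurable.ennreal_ofReal,
    lintegral_cauchyKernel _ J₀.len_pos, ← ENNReal.ofReal_mul (by positivity)]
  apply ENNReal.ofReal_le_ofReal
  exact le_of_eq (by ring)

/-! ### Pairing packets with cancellative functions -/

theorem Ival.toSet_subset_of_mem_dyadic {I J : Ival} (hJ : J ∈ I.dyadic) : J.toSet ⊆ I.toSet := by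
  obtain ⟨n, m, hm, h1, h2⟩ := hJ
  have hl : 0 < I.len / 2 ^ n := h2 ▸ J.len_pos
  have hm' : (m + 1 : ℝ) ≤ 2 ^ n := by exact_mod_cast hm
  have h3 : I.len = 2 ^ n * (I.len / 2 ^ n) := by field_simp
  apply Ico_subset_Ico
  · rw [h1]
    have : 0 ≤ m * (I.len / 2 ^ n) := by positivity
    linarith
  · rw [h1, h2]
    nlinarith

theorem Ival.abs_center_sub_center_le {I J : Ival} (hJ : J ∈ I.dyadic) :
    |J.center - I.center| ≤ I.len / 2 := by
  have h := Ival.toSet_subset_of_mem_dyadic hJ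
  have hJl := J.len_pos
  rw [Ival.toSet, Ival.toSet, Ico_subset_Ico_iff (by linarith)] at h
  rw [abs_le, Ival.center, Ival.center]
  constructor <;> linarith [h.1, h.2]

theorem Ival.le_abs_sub_center_of_not_mem_dilate {I J : Ival} (hJ : J ∈ I.dyadic) {M x : ℝ}
    (hM : 10 ≤ M) (hx : x ∉ Ival.dilate (3 * M) I) : 1.4 * M * I.len ≤ |x - J.center| := by
  have hI := I.len_pos
  have h1 := Ival.abs_center_sub_center_le hJ
  rw [abs_le] at h1
  have h2 : 10 * I.len ≤ M * I.len := by gcongr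
  simp only [Ival.dilate, mem_Ico, not_and_or, not_le, not_lt] at hx
  rw [le_abs]
  rcases hx with hx | hx
  · right; nlinarith
  · left; nlinarith

/-- Of the smallness of `X ^ D / D!`, one factor `X / D` is kept for the summation over scales. -/
theorem pow_div_factorial_le {X : ℝ} {D : ℕ} (hD : 1 ≤ D) (hX0 : 0 ≤ X) (hX : X ≤ D / 25) :
    X ^ D / D.factorial ≤ 25 * X / D * Real.exp (-(2 * D)) := by
  have hD0 : (0 : ℝ) < D := by exact_mod_cast hD
  set s : ℝ := 25 * X / D with hs
  have hs0 : 0 ≤ s := by positivity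
  have hs1 : s ≤ 1 := by
    rw [hs, div_le_one hD0]; linarith
  have hXs : X = s * (D / 25) := by rw [hs]; field_simp
  clear_value s
  have h1 : s ^ D ≤ s := pow_le_of_le_one hs0 hs1 (by omega)
  have h2 : (D : ℝ) ^ D / D.factorial ≤ Real.exp D := Real.pow_div_factorial_le_exp _ hD0.le D
  have h3 : Real.exp (3 * D) ≤ 25 ^ D := by
    rw [mul_comm, Real.exp_nat_mul]
    gcongr
    have := Real.exp_one_lt_d9
    rw [show (3 : ℝ) = 1 + 1 + 1 by norm_num, Real.exp_add, Real.exp_add]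
    have h0 := Real.exp_pos 1
    calc Real.exp 1 * Real.exp 1 * Real.exp 1 ≤ 2.72 * 2.72 * 2.72 := by gcongr <;> linarith
      _ ≤ 25 := by norm_num
  have h4 : Real.exp D = Real.exp (3 * D) * Real.exp (-(2 * D)) := by
    rw [← Real.exp_add]; congr 1; ring
  calc X ^ D / D.factorial = s ^ D * ((D : ℝ) ^ D / D.factorial / 25 ^ D) := by
        rw [hXs, mul_pow, div_pow]; field_simp
    _ ≤ s * (Real.exp D / 25 ^ D) := by gcongr
    _ ≤ s * (25 ^ D * Real.exp (-(2 * D)) / 25 ^ D) := by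
        rw [h4]; gcongr
    _ = s * Real.exp (-(2 * D)) := by field_simp

/-- A function orthogonal to `v` sees only the difference of `φ` and `v`. -/
theorem norm_pair_le_of_norm_sub_le {β φ v : ℝ → ℂ} (hβ : Integrable β) {s : Set ℝ}
    (hs : Function.support β ⊆ s) (hφ : Integrable fun x => β x * conj (φ x))
    (hvi : Integrable fun x => β x * conj (v x)) (hv : ∫ x, β x * conj (v x) = 0) {τ : ℝ}
    (hτ : ∀ x ∈ s, ‖φ x - v x‖ ≤ τ) : ‖pair β φ‖ ≤ τ * ∫ x, ‖β x‖ := by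
  have h1 : pair β φ = ∫ x, β x * conj (φ x - v x) := by
    rw [pair, ← sub_zero (∫ x, β x * conj (φ x)), ← hv, ← integral_sub hφ hvi]
    congr 1
    funext x
    rw [map_sub, mul_sub]
  rw [h1, ← integral_const_mul]
  refine norm_integral_le_of_norm_le (hβ.norm.const_mul _)
    (Filter.Eventually.of_forall fun x => ?_)
  rw [norm_mul, RCLike.norm_conj]
  by_cases hx : β x = 0
  · simp [hx]
  · rw [mul_comm]
    gcongr
    exact hτ x (hs hx)

theorem integrable_mul_conj_of_support_subset {β φ : ℝ → ℂ} (hβ : Integrable β) {α γ : ℝ}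
    (hs : Function.support β ⊆ Ico α γ) (hφ : Continuous φ) :
    Integrable fun x => β x * conj (φ x) := by
  have h1 : Function.support (fun x => β x * conj (φ x)) ⊆ Icc α γ :=
    (Function.support_mul_subset_left _ _).trans (hs.trans Ico_subset_Icc_self)
  rw [← integrableOn_iff_integrable_of_support_subset h1]
  exact hβ.integrableOn.mul_continuousOn (Complex.continuous_conj.comp hφ).continuousOn
    isCompact_Icc

/-- Outside a large dilate of `I`, a packet on `J ∈ 𝒟(I)` is exponentially small. Only the second
summand of the weight is needed, because `|I|` is less than the distance from `J`. -/
theorem IsAdapted.norm_le_packetWeight {u : ℝ → ℝ} (hu : IsOsgood u) {a A C6 k : ℝ} (ha : 0 < a)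
    (hA : 0 ≤ A) (hC6 : ∀ s, 0 ≤ s → Real.exp (-(a / 2) * evenInv u s) * (1 + s) ^ 6 ≤ C6)
    (hk : 0 ≤ k) (hM : 1000 ≤ u (1000 / a * k)) (E : Set ℝ) {I J : Ival} (hJ : J ∈ I.dyadic)
    {ξ : ℝ} {φ : ℝ → ℂ} (h : IsAdapted u a A J ξ φ) {x : ℝ}
    (hx : x ∉ Ival.dilate (3 * u (1000 / a * k)) I) :
    ‖φ x‖ ≤ A * C6 * Real.exp (-(500 * k)) * (√J.len)⁻¹ * packetWeight E I.len J x := by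
  set M := u (1000 / a * k)
  have hJl := J.len_pos
  have hIl := I.len_pos
  have hJI := Ival.dyadic_len_le hJ
  have h1 := Ival.le_abs_sub_center_of_not_mem_dilate hJ (by linarith : (10 : ℝ) ≤ M) hx
  set s := |x - J.center| / J.len with hs
  have hs0 : 0 ≤ s := by positivity
  have h2 : M ≤ s := by
    rw [hs, le_div_iff₀ hJl]
    nlinarith
  have h3 := hu.exp_evenInv_le ha hC6 (by positivity) h2
  rw [show a / 2 * (1000 / a * k) = 500 * k by field_simp; ring] at h3
  have hC60 : 0 ≤ C6 := le_trans (by positivity) (hC6 0 le_rfl)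
  have h4 : ((1 + s) ^ 6)⁻¹ ≤ packetWeight E I.len J x := by
    have h5 : 1 ≤ (1 + s) ^ 2 * (J.len / I.len) := by
      have h6 : 1 ≤ (1 + s) * (J.len / I.len) := by
        rw [mul_div_assoc', le_div_iff₀ hIl, one_mul, add_mul, hs, div_mul_cancel₀ _ hJl.ne']
        nlinarith
      have : 0 ≤ J.len / I.len := by positivity
      nlinarith
    have h7 := inv_sq_le_cauchyKernel J.center x hJl
    have h8 : 0 ≤ scaleGain (Metric.infDist x Eᶜ / J.len) :=
      scaleGain_nonneg (div_nonneg Metric.infDist_nonneg hJl.le)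
    calc ((1 + s) ^ 6)⁻¹ ≤ ((1 + s) ^ 6)⁻¹ * ((1 + s) ^ 2 * (J.len / I.len)) :=
          le_mul_of_one_le_right (by positivity) h5
      _ = (((1 + s) ^ 2)⁻¹) ^ 2 * (0 + J.len / I.len) := by field_simp; ring
      _ ≤ packetWeight E I.len J x := by
          unfold packetWeight
          gcongr
  calc ‖φ x‖ ≤ A * (√J.len)⁻¹ * Real.exp (-a * evenInv u s) := h.norm_le x
    _ ≤ A * (√J.len)⁻¹ * (C6 * Real.exp (-(500 * k)) * packetWeight E I.len J x) := by
        gcongr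
        exact h3.trans (by gcongr)
    _ = _ := by ring

set_option maxHeartbeats 1000000 in
/-- The pairing of a packet with a function on the tripled Whitney interval `Q` that is orthogonal
to exponential polynomials at the frequencies of all tops near `Q`. If the packet is concentrated
far from `Q`, its decay is used together with one order of cancellation or the remoteness of the
top. Otherwise `|Q|` is small against `|J|` times the degree, and the polynomial approximation of
the band-limited packet gives the smallness. -/
theorem norm_pair_le_of_isWhitney {u : ℝ → ℝ} (hu : IsOsgood u) {a A R C2 C6 k ε : ℝ} (ha : 0 < a)
    (ha1 : a ≤ 1) (hA : 0 ≤ A) (hR : 0 ≤ R)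
    (hC2 : ∀ s, 0 ≤ s → Real.exp (-a * evenInv u s) * (1 + s) ^ 2 ≤ C2)
    (hC6 : ∀ s, 0 ≤ s → Real.exp (-(a / 2) * evenInv u s) * (1 + s) ^ 6 ≤ C6)
    (hε0 : 0 < ε) (hε : ε ≤ 1)
    (hk : 0 ≤ k) (hM : 1000 ≤ u (1000 / a * k)) {E : Set ℝ} {I J : Ival} (hJ : J ∈ I.dyadic)
    (hJE : ¬ J.toSet ⊆ E) {ξ η : ℝ} {φ : ℝ → ℂ} (h : IsAdapted u a A J ξ φ)
    (hsupp : tsupport (𝓕 φ) ⊆ Icc (η - ε / J.len / 2) (η + ε / J.len / 2))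
    (hη : |η - ξ| ≤ R / J.len) {i : ℤ × ℤ} (hi : IsWhitney E i) {F : Finset ℝ} {D : ℕ}
    (hF : (gridIval i).toSet ⊆ Ival.dilate (3 * u (1000 / a * k)) I → ξ ∈ F)
    (hD : (R + 1) * u (1000 / a * k) ≤ D)
    {β : ℝ → ℂ} (hβ : Integrable β) (hβs : Function.support β ⊆ (gridIval i).triple)
    (hβ0 : ∀ v ∈ expPoly F D, ∫ x, β x * conj (v x) = 0) {x : ℝ}
    (hx : x ∈ (gridIval i).toSet) :
    ‖pair β φ‖ ≤ A * (2000000 * C2 + 12 * C6) * Real.exp (-(500 * k)) * (√J.len)⁻¹ *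
      packetWeight E I.len J x * ∫ x, ‖β x‖ := by
  set M := u (1000 / a * k) with hMdef
  set Q := gridIval i with hQ
  have hJl := J.len_pos
  have hIl := I.len_pos
  have hQl := Q.len_pos
  have hJI := Ival.dyadic_len_le hJ
  have hC20 : 0 ≤ C2 := le_trans (by positivity) (hC2 0 le_rfl)
  have hC60 : 0 ≤ C6 := le_trans (by positivity) (hC6 0 le_rfl)
  obtain ⟨z, hzJ, hzE⟩ := not_subset.1 hJE
  have hx3 : x ∈ Q.triple := Q.toSet_subset_triple hx
  set r : ℝ → ℝ := fun w => 1 + |w - J.center| / J.len with hr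
  have hr1 : ∀ w, 1 ≤ r w := fun w => by
    simp only [hr]
    linarith [show 0 ≤ |w - J.center| / J.len by positivity]
  have hrl : ∀ w, J.len * r w = J.len + |w - J.center| := fun w => by
    simp only [hr]; field_simp
  have hzw : ∀ w, |w - z| ≤ J.len * r w := by
    intro w
    rw [hrl]
    have h1 : |J.center - z| ≤ J.len := by
      rw [abs_le, Ival.center]; constructor <;> linarith [hzJ.1, hzJ.2]
    have h2 := abs_add_le (w - J.center) (J.center - z)
    rw [show w - J.center + (J.center - z) = w - z by ring] at h2
    linarith
  set δ := Metric.infDist x Eᶜ with hδ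
  have hδ0 : 0 ≤ δ := Metric.infDist_nonneg
  have hQδ : 500 * Q.len ≤ δ := by
    rw [hδ, Metric.le_infDist ⟨z, hzE⟩]
    intro y hy
    rw [Real.dist_eq]
    exact hi.le_abs_sub hx3 hy
  have hδr : δ ≤ J.len * r x :=
    (Metric.infDist_le_dist_of_mem (show z ∈ Eᶜ from hzE)).trans
      (by rw [Real.dist_eq]; exact hzw x)
  -- the tripled interval is short compared with its distance from the packet
  have hosc : ∀ w w', w ∈ Q.triple → w' ∈ Q.triple → 0.994 * r w' ≤ r w := by
    intro w w' hw hw'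
    have h1 : |w' - w| ≤ 3 * Q.len := by
      rw [abs_le]; constructor <;> linarith [hw.1, hw.2, hw'.1, hw'.2]
    have h2 := (hi.le_abs_sub hw' hzE).trans (hzw w')
    have h3 := abs_add_le (w' - w) (w - J.center)
    rw [show w' - w + (w - J.center) = w' - J.center by ring] at h3
    have h4 : 500 * Q.len ≤ J.len * r w' := h2
    have h5 : J.len * (0.994 * r w') ≤ J.len * r w := by
      have e1 := hrl w
      have e2 := hrl w'
      nlinarith
    exact le_of_mul_le_mul_left h5 hJl
  set y := δ / J.len with hy
  have hy0 : 0 ≤ y := by positivity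
  have hyr : y ≤ r x := by
    rw [hy, div_le_iff₀ hJl]; linarith
  have hgain := le_mul_scaleGain hy0 (hr1 x) hyr
  have hgain0 := scaleGain_nonneg hy0
  have hr0 : 0 < r x := by linarith [hr1 x]
  have hK : (((r x) ^ 2)⁻¹) ^ 2 ≤ cauchyKernel J.center J.len x ^ 2 := by
    have := inv_sq_le_cauchyKernel J.center x hJl
    gcongr
  have hgain1 : ((r x) ^ 6)⁻¹ * y ≤ 6 * packetWeight E I.len J x := by
    calc ((r x) ^ 6)⁻¹ * y ≤ ((r x) ^ 6)⁻¹ * (6 * (r x) ^ 2 * scaleGain y) := by gcongr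
      _ = 6 * ((((r x) ^ 2)⁻¹) ^ 2 * (scaleGain y + 0)) := by field_simp; ring
      _ ≤ 6 * packetWeight E I.len J x := by
          unfold packetWeight
          gcongr
          positivity
  have hW0 := packetWeight_nonneg E hIl J x
  have hint : ∀ v : ℝ → ℂ, Continuous v → Integrable fun x => β x * conj (v x) := fun v hv =>
    integrable_mul_conj_of_support_subset hβ hβs hv
  have hexp0 : 0 < Real.exp (-(500 * k)) := Real.exp_pos _
  have hsq : 0 < (√J.len)⁻¹ := by positivity
  have hβ1 : 0 ≤ ∫ x, ‖β x‖ := integral_nonneg fun x => norm_nonneg _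
  have hDr : (1 : ℝ) ≤ D := by nlinarith
  have hD1 : 1 ≤ D := by exact_mod_cast hDr
  have hfar : ∀ w, w ∉ Ival.dilate (3 * M) I → 1.4 * M * I.len ≤ |w - J.center| := fun w hw =>
    Ival.le_abs_sub_center_of_not_mem_dilate hJ (by linarith) hw
  -- it suffices to approximate `φ` on the tripled interval
  suffices hmain : ∃ v ∈ expPoly F D, ∀ w ∈ Q.triple, ‖φ w - v w‖ ≤
      A * (2000000 * C2 + 12 * C6) * Real.exp (-(500 * k)) * (√J.len)⁻¹ *
        packetWeight E I.len J x by
    obtain ⟨v, hv, hvw⟩ := hmain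
    exact norm_pair_le_of_norm_sub_le hβ hβs (hint φ h.continuous)
      (hint v (continuous_of_mem_expPoly hv)) (hβ0 v hv) hvw
  rcases le_or_gt (1.2 * M) (r x) with hcase | hcase
  · -- the packet is concentrated far from `Q`
    have hE : ∀ w ∈ Q.triple, Real.exp (-a * evenInv u (|w - J.center| / J.len)) ≤
        2 * C6 * Real.exp (-(500 * k)) * ((r x) ^ 6)⁻¹ := by
      intro w hw
      have h1 := hosc w x hw hx3
      have h2 : M ≤ |w - J.center| / J.len := by
        have : |w - J.center| / J.len = r w - 1 := by simp only [hr]; ring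
        rw [this]
        linarith
      have h3 := hu.exp_evenInv_le ha hC6 (by positivity) h2
      rw [show a / 2 * (1000 / a * k) = 500 * k by field_simp; ring] at h3
      refine h3.trans ?_
      have h4 : ((1 + |w - J.center| / J.len) ^ 6)⁻¹ ≤ 2 * ((r x) ^ 6)⁻¹ := by
        change ((r w) ^ 6)⁻¹ ≤ 2 * ((r x) ^ 6)⁻¹
        calc ((r w) ^ 6)⁻¹ ≤ ((0.994 * r x) ^ 6)⁻¹ := by gcongr
          _ = (0.994 ^ 6)⁻¹ * ((r x) ^ 6)⁻¹ := by rw [mul_pow, mul_inv]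
          _ ≤ 2 * ((r x) ^ 6)⁻¹ := by gcongr; norm_num
      calc _ ≤ C6 * Real.exp (-(500 * k)) * (2 * ((r x) ^ 6)⁻¹) := by gcongr
        _ = _ := by ring
    by_cases hQI : Q.toSet ⊆ Ival.dilate (3 * M) I
    · refine ⟨(Complex.exp (-2 * Real.pi * Complex.I * ξ * x) * φ x) •
        fun w : ℝ => ((w : ℂ) + (0 : ℝ)) ^ 0 * Complex.exp (2 * Real.pi * Complex.I * ξ * w),
        Submodule.smul_mem _ _ (mem_expPoly (hF hQI) hD1 0), fun w hw => ?_⟩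
      have h1 := h.norm_sub_exp_le hA hx3 hw hE
      simp only [Pi.smul_apply, pow_zero, one_mul, smul_eq_mul]
      refine h1.trans ?_
      have h2 : |w - x| ≤ δ := by
        have : |w - x| ≤ 3 * Q.len := by
          rw [abs_le]; constructor <;> linarith [hw.1, hw.2, hx3.1, hx3.2]
        linarith
      calc _ ≤ A * ((√J.len)⁻¹ * J.len⁻¹) *
            (2 * C6 * Real.exp (-(500 * k)) * ((r x) ^ 6)⁻¹) * δ := by gcongr
        _ = A * (√J.len)⁻¹ * (2 * C6) * Real.exp (-(500 * k)) * (((r x) ^ 6)⁻¹ * y) := by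
            rw [hy]; ring
        _ ≤ A * (√J.len)⁻¹ * (2 * C6) * Real.exp (-(500 * k)) *
            (6 * packetWeight E I.len J x) := by gcongr
        _ = A * (12 * C6) * Real.exp (-(500 * k)) * (√J.len)⁻¹ * packetWeight E I.len J x := by
            ring
        _ ≤ _ := by gcongr; linarith
    · refine ⟨0, Submodule.zero_mem _, fun w hw => ?_⟩
      obtain ⟨w₀, hw₀, hw₀I⟩ := not_subset.1 hQI
      have h1 := hfar w₀ hw₀I
      have h2 := hosc x w₀ hx3 (Q.toSet_subset_triple hw₀)
      have h3 : 1 ≤ r x * (J.len / I.len) := by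
        rw [mul_div_assoc', le_div_iff₀ hIl, one_mul]
        have e1 := hrl w₀
        have h4 : J.len * (0.994 * r w₀) ≤ J.len * r x := by gcongr
        have h5 : 1000 * I.len ≤ M * I.len := by gcongr
        linarith
      have h4 : ((r x) ^ 6)⁻¹ ≤ packetWeight E I.len J x := by
        have h5 : 1 ≤ (r x) ^ 2 * (J.len / I.len) := by
          have h6 : r x * (J.len / I.len) ≤ (r x) ^ 2 * (J.len / I.len) := by
            gcongr
            exact le_self_pow₀ (hr1 x) two_ne_zero
          linarith
        calc ((r x) ^ 6)⁻¹ ≤ ((r x) ^ 6)⁻¹ * ((r x) ^ 2 * (J.len / I.len)) :=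
              le_mul_of_one_le_right (by positivity) h5
          _ = (((r x) ^ 2)⁻¹) ^ 2 * (0 + J.len / I.len) := by field_simp; ring
          _ ≤ packetWeight E I.len J x := by
              unfold packetWeight
              gcongr
      simp only [Pi.zero_apply, sub_zero]
      calc ‖φ w‖ ≤ A * (√J.len)⁻¹ * Real.exp (-a * evenInv u (|w - J.center| / J.len)) :=
            h.norm_le w
        _ ≤ A * (√J.len)⁻¹ * (2 * C6 * Real.exp (-(500 * k)) * ((r x) ^ 6)⁻¹) := by
            gcongr
            exact hE w hw
        _ ≤ A * (√J.len)⁻¹ * (2 * C6 * Real.exp (-(500 * k)) * packetWeight E I.len J x) := by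
            gcongr
        _ = A * (2 * C6) * Real.exp (-(500 * k)) * (√J.len)⁻¹ * packetWeight E I.len J x := by
            ring
        _ ≤ _ := by gcongr; linarith
  · -- the packet overlaps a large dilate of `Q`
    have hQI : Q.toSet ⊆ Ival.dilate (3 * M) I := by
      intro w hw
      by_contra hwI
      have h1 := hfar w hwI
      have h2 := hosc x w hx3 (Q.toSet_subset_triple hw)
      have h3 : 1.4 * M ≤ r w := by
        have e1 := hrl w
        have h4 : J.len * M ≤ I.len * M := by gcongr
        have : J.len * (1.4 * M) ≤ J.len * r w := by linarith
        exact le_of_mul_le_mul_left this hJl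
      linarith
    have hpi := Real.pi_lt_d2
    have hpi0 := Real.pi_pos
    set X := 2 * Real.pi * (R + 1) * (3 / 2 * Q.len / J.len) with hX
    have hX0 : 0 ≤ X := by positivity
    have hXy : X ≤ (R + 1) * y / 50 := by
      have h1 : 500 * (Q.len / J.len) ≤ y := by
        rw [hy, mul_div_assoc']; gcongr
      have h2 : X = 3 * Real.pi * (R + 1) * (Q.len / J.len) := by rw [hX]; ring
      rw [h2]
      have h3 : 3 * Real.pi ≤ 10 := by linarith
      calc _ ≤ 10 * (R + 1) * (Q.len / J.len) := by gcongr
        _ = (R + 1) * (500 * (Q.len / J.len)) / 50 := by ring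
        _ ≤ _ := by gcongr
    have hXD : X ≤ D / 25 := by
      have : (R + 1) * y ≤ (R + 1) * (2 * M) := by gcongr; linarith
      linarith
    obtain ⟨v, hv, hvw⟩ := h.exists_expPoly_norm_sub_le hA hε0 hε hC2 hsupp hη (D := D) (hF hQI)
      Q.center (ρ := 3 / 2 * Q.len) (by rw [← hX]; linarith)
    refine ⟨v, hv, fun w hw => (hvw w (Ival.abs_sub_center_le_of_mem_triple hw)).trans ?_⟩
    rw [← hX]
    have hbd : X ^ D / D.factorial ≤ 6 * 64 * 720 * Real.exp (-(500 * k)) *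
        packetWeight E I.len J x := by
      have h1 := pow_div_factorial_le hD1 hX0 hXD
      have h2 : 25 * X / D ≤ y := by
        rw [div_le_iff₀ (by linarith)]
        have h3 : R + 1 ≤ D := by nlinarith
        have h4 : y * (R + 1) ≤ y * D := by gcongr
        nlinarith
      have h3 : y ≤ 6 * (r x) ^ 6 * packetWeight E I.len J x := by
        have h4 : (r x) ^ 6 * (((r x) ^ 6)⁻¹ * y) = y := by field_simp
        rw [← h4]
        calc _ ≤ (r x) ^ 6 * (6 * packetWeight E I.len J x) := by gcongr
          _ = _ := by ring
      have h5 : (r x) ^ 6 ≤ 64 * 720 * Real.exp D := by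
        have h6 : r x ≤ 2 * D := by nlinarith
        have h7 := Real.pow_div_factorial_le_exp (D : ℝ) (by positivity) 6
        have h8 : (D : ℝ) ^ 6 ≤ 720 * Real.exp D := by
          rw [div_le_iff₀ (by positivity)] at h7
          have : ((6 : ℕ).factorial : ℝ) = 720 := by norm_num [Nat.factorial]
          rw [this] at h7
          linarith
        calc (r x) ^ 6 ≤ (2 * D) ^ 6 := by gcongr
          _ = 64 * (D : ℝ) ^ 6 := by ring
          _ ≤ _ := by linarith
      have h9 : Real.exp (-(D : ℝ)) ≤ Real.exp (-(500 * k)) := by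
        apply Real.exp_le_exp.2
        have h10 := hu.le_self (t := 1000 / a * k) (by positivity)
        have h11 : 500 * k ≤ 1000 / a * k := by
          gcongr
          rw [le_div_iff₀ ha]; linarith
        have h12 : M ≤ D := by nlinarith
        have h13 : 1000 / a * k ≤ M := h10
        linarith
      have h14 : Real.exp D * Real.exp (-(2 * D)) = Real.exp (-(D : ℝ)) := by
        rw [← Real.exp_add]; congr 1; ring
      calc X ^ D / D.factorial ≤ y * Real.exp (-(2 * D)) := h1.trans (by gcongr)
        _ ≤ (6 * (64 * 720 * Real.exp D) * packetWeight E I.len J x) * Real.exp (-(2 * D)) := by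
            gcongr
            exact h3.trans (by gcongr)
        _ = 6 * 64 * 720 * (Real.exp D * Real.exp (-(2 * D))) * packetWeight E I.len J x := by ring
        _ ≤ _ := by rw [h14]; gcongr
    calc 2 * Real.pi * A * C2 * (√J.len)⁻¹ * (X ^ D / D.factorial)
        ≤ 2 * 3.15 * A * C2 * (√J.len)⁻¹ * (6 * 64 * 720 * Real.exp (-(500 * k)) *
          packetWeight E I.len J x) := by gcongr
      _ = A * (2 * 3.15 * 6 * 64 * 720 * C2) * Real.exp (-(500 * k)) * (√J.len)⁻¹ *
          packetWeight E I.len J x := by ring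
      _ ≤ _ := by
          gcongr
          linarith

/-! ### Counting functions -/

theorem measurableSet_dilate (r : ℝ) (I : Ival) : MeasurableSet (Ival.dilate r I) :=
  measurableSet_Ico

theorem volume_dilate (r : ℝ) (I : Ival) :
    volume (Ival.dilate r I) = ENNReal.ofReal (r * I.len) := by
  simp only [Ival.dilate, Real.volume_Ico]
  congr 1
  ring

theorem ae_counting_le {T : Set (Ival × ℝ)} {r : ℝ} {B : ℝ≥0∞}
    (h : eLpNorm (counting T r) ⊤ volume ≤ B) : ∀ᵐ x, counting T r x ≤ B := by
  rw [eLpNorm_exponent_top] at h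
  filter_upwards [enorm_ae_le_eLpNormEssSup (counting T r) volume] with x hx
  exact hx.trans h

theorem finite_of_counting_ne_top {T : Set (Ival × ℝ)} {r x : ℝ} (hx : counting T r x ≠ ⊤) :
    {d ∈ T | x ∈ Ival.dilate r d.1}.Finite := by
  have h := ENNReal.finite_const_le_of_tsum_ne_top hx one_ne_zero
  refine (h.image Subtype.val).subset fun d hd => ⟨⟨d, hd.1⟩, ?_, rfl⟩
  have : (Ival.dilate r d.1).indicator (1 : ℝ → ℝ≥0∞) x = 1 := indicator_of_mem hd.2 _
  exact this.ge

theorem card_le_counting {T : Set (Ival × ℝ)} {r x : ℝ} (s : Finset (Ival × ℝ))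
    (hs : ∀ d ∈ s, d ∈ T ∧ x ∈ Ival.dilate r d.1) : (s.card : ℝ≥0∞) ≤ counting T r x := by
  classical
  set s' : Finset T := s.attach.image fun d => ⟨d.1, (hs d.1 d.2).1⟩ with hs'
  have hcard : s'.card = s.card := by
    rw [hs', Finset.card_image_of_injective, Finset.card_attach]
    intro d d' h
    exact Subtype.ext (congrArg (fun e : T => e.1) h)
  have h1 : ∑ d ∈ s', (Ival.dilate r d.1.1).indicator (1 : ℝ → ℝ≥0∞) x = s.card := by
    rw [Finset.sum_congr rfl (g := fun _ => (1 : ℝ≥0∞)), Finset.sum_const, hcard]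
    · simp
    · intro d hd
      obtain ⟨e, -, rfl⟩ := Finset.mem_image.1 hd
      exact indicator_of_mem (hs e.1 e.2).2 _
  rw [← h1]
  exact ENNReal.sum_le_tsum s'

/-- Every dilated interval contains points of a countable dense set on which the counting function
is finite. -/
theorem countable_of_counting {T : Set (Ival × ℝ)} {r : ℝ} (hr : 0 < r)
    (h : ∀ᵐ x, counting T r x ≠ ⊤) : T.Countable := by
  have hd : Dense {x | counting T r x ≠ ⊤} := Measure.dense_of_ae h
  obtain ⟨t, hts, htc, htd⟩ := hd.exists_countable_dense_subset
  refine (htc.biUnion (t := fun x _ => {d ∈ T | x ∈ Ival.dilate r d.1})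
    fun x hx => (finite_of_counting_ne_top (hts hx)).countable).mono fun d hdT => ?_
  have hl : 0 < r * d.1.len := mul_pos hr d.1.len_pos
  obtain ⟨x, hx, hxt⟩ := htd.inter_open_nonempty
    (Ioo (d.1.center - r * d.1.len / 2) (d.1.center + r * d.1.len / 2)) isOpen_Ioo
    (nonempty_Ioo.2 (by linarith))
  exact mem_biUnion hxt ⟨hdT, Ioo_subset_Ico_self hx⟩

theorem measurable_counting {T : Set (Ival × ℝ)} (hT : T.Countable) (r : ℝ) :
    Measurable (counting T r) := by
  have := hT.to_subtype
  exact Measurable.tsum fun d => measurable_one.indicator (measurableSet_dilate r d.1.1)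

theorem lintegral_counting {T : Set (Ival × ℝ)} (hT : T.Countable) {r : ℝ} (hr : 0 ≤ r) :
    ∫⁻ x, counting T r x = ENNReal.ofReal r * ∫⁻ x, counting T 1 x := by
  have := hT.to_subtype
  have h : ∀ s : ℝ, ∫⁻ x, counting T s x = ∑' d : T, ENNReal.ofReal (s * d.1.1.len) := by
    intro s
    unfold counting
    rw [lintegral_tsum fun d : T =>
      (measurable_one.indicator (measurableSet_dilate s d.1.1)).aemeasurable]
    refine tsum_congr fun d => ?_
    rw [lintegral_indicator_one (measurableSet_dilate s d.1.1), volume_dilate]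
  rw [h, h, ← ENNReal.tsum_mul_left]
  refine tsum_congr fun d => ?_
  rw [← ENNReal.ofReal_mul hr, one_mul]

/-- The top data near a grid interval `Q`, those with `Q` inside the dilate of the top. -/
def nearTops (T : Set (Ival × ℝ)) (r : ℝ) (i : ℤ × ℤ) : Set (Ival × ℝ) :=
  {d ∈ T | (gridIval i).toSet ⊆ Ival.dilate r d.1}

theorem finite_nearTops {T : Set (Ival × ℝ)} {r B : ℝ}
    (h : ∀ᵐ x, counting T r x ≤ ENNReal.ofReal B) (i : ℤ × ℤ) : (nearTops T r i).Finite ∧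
      ((nearTops T r i).ncard : ℝ) ≤ max B 0 := by
  have hpos : volume (gridIval i).toSet ≠ 0 := by
    rw [Ival.volume_toSet]; simpa using (gridIval i).len_pos
  obtain ⟨x, hxQ, hx⟩ : ∃ x ∈ (gridIval i).toSet, counting T r x ≤ ENNReal.ofReal B := by
    by_contra! hcon
    apply hpos
    refine measure_mono_null (fun x hx => ?_) h
    exact not_le.2 (hcon x hx)
  have hfin : (nearTops T r i).Finite :=
    (finite_of_counting_ne_top (hx.trans_lt ENNReal.ofReal_lt_top).ne).subset
      fun d hd => ⟨hd.1, hd.2 hxQ⟩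
  refine ⟨hfin, ?_⟩
  have h1 := (card_le_counting (T := T) (r := r) (x := x) hfin.toFinset fun d hd => by
    rw [Finite.mem_toFinset] at hd
    exact ⟨hd.1, hd.2 hxQ⟩).trans hx
  rw [← ncard_eq_toFinset_card _ hfin] at h1
  have h2 := ENNReal.toReal_mono ENNReal.ofReal_ne_top h1
  rwa [ENNReal.toReal_natCast, ENNReal.toReal_ofReal'] at h2

theorem ncard_nearTops_le {T : Set (Ival × ℝ)} {r : ℝ} {i : ℤ × ℤ}
    (hfin : (nearTops T r i).Finite) {x : ℝ} (hx : x ∈ (gridIval i).toSet) :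
    ((nearTops T r i).ncard : ℝ≥0∞) ≤ counting T r x := by
  rw [ncard_eq_toFinset_card _ hfin]
  refine card_le_counting _ fun d hd => ?_
  rw [Finite.mem_toFinset] at hd
  exact ⟨hd.1, hd.2 hx⟩

/-! ### Pairing with a sum of localized functions -/

theorem integrable_sub_mul_conj_of_hasSum {ι : Type*} [Countable ι] {b b₀ φ : ℝ → ℂ}
    {β : ι → ℝ → ℂ} (hb : ∀ x, HasSum (fun i => β i x) (b x - b₀ x))
    (hβ : ∀ i, Integrable (β i)) (hβs : Summable fun i => ∫ x, ‖β i x‖)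
    (hφ : Continuous φ) {Cφ : ℝ} (hφb : ∀ x, ‖φ x‖ ≤ Cφ) :
    Integrable (fun x => (b x - b₀ x) * conj (φ x)) ∧
      ∫ x, (b x - b₀ x) * conj (φ x) = ∑' i, pair (β i) φ := by
  have hconj : Continuous fun x => conj (φ x) := Complex.continuous_conj.comp hφ
  have hβφ : ∀ i, Integrable fun x => β i x * conj (φ x) := fun i =>
    (hβ i).mul_bdd (c := Cφ) hconj.aestronglyMeasurable
      (Filter.Eventually.of_forall fun x => by simpa using hφb x)
  have hCφ : 0 ≤ Cφ := (norm_nonneg _).trans (hφb 0)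
  have hle : ∀ i, ∫ x, ‖β i x * conj (φ x)‖ ≤ Cφ * ∫ x, ‖β i x‖ := by
    intro i
    rw [← integral_const_mul]
    refine integral_mono (hβφ i).norm ((hβ i).norm.const_mul _) fun x => ?_
    simp only [norm_mul, RCLike.norm_conj]
    rw [mul_comm]
    gcongr
    exact hφb x
  have hsum : Summable fun i => ∫ x, ‖β i x * conj (φ x)‖ :=
    Summable.of_nonneg_of_le (fun i => integral_nonneg fun x => norm_nonneg _) hle
      (hβs.mul_left Cφ)
  have hseries : ∀ x, HasSum (fun i => β i x * conj (φ x)) ((b x - b₀ x) * conj (φ x)) :=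
    fun x => (hb x).mul_right _
  have hbm : AEStronglyMeasurable (fun x => (b x - b₀ x) * conj (φ x)) volume := by
    refine aestronglyMeasurable_of_tendsto_ae (u := (Filter.atTop : Filter (Finset ι)))
      (f := fun s x => ∑ i ∈ s, β i x * conj (φ x)) (fun s => ?_)
      (Filter.Eventually.of_forall fun x => hseries x)
    exact Finset.aestronglyMeasurable_fun_sum _ fun i _ => (hβφ i).aestronglyMeasurable
  have hdi : Integrable fun x => (b x - b₀ x) * conj (φ x) := by
    refine ⟨hbm, ?_⟩
    calc ∫⁻ x, ‖(b x - b₀ x) * conj (φ x)‖ₑ ≤ ∫⁻ x, ∑' i, ‖β i x * conj (φ x)‖ₑ := by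
          refine lintegral_mono fun x => ?_
          rw [← (hseries x).tsum_eq]
          exact enorm_tsum_le_tsum_enorm
      _ = ∑' i, ∫⁻ x, ‖β i x * conj (φ x)‖ₑ :=
          lintegral_tsum fun i => (hβφ i).aestronglyMeasurable.enorm
      _ = ∑' i, ENNReal.ofReal (∫ x, ‖β i x * conj (φ x)‖) := by
          refine tsum_congr fun i => ?_
          rw [ofReal_integral_norm_eq_lintegral_enorm (hβφ i)]
      _ < ⊤ := hsum.tsum_ofReal_lt_top
  refine ⟨hdi, ?_⟩
  have h1 := hasSum_integral_of_summable_integral_norm hβφ hsum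
  exact (integral_congr_ae (Filter.Eventually.of_forall fun x => (hseries x).tsum_eq.symm)).trans
    h1.tsum_eq.symm

/-- Termwise bounds for the pairings with the pieces `β i`, localized to disjoint sets `Q i`, add up
to an integral of the weight. -/
theorem enorm_pair_le {ι : Type*} [Countable ι] {b b₀ φ : ℝ → ℂ} {β : ι → ℝ → ℂ}
    (hb : ∀ x, HasSum (fun i => β i x) (b x - b₀ x))
    (hb₀i : Integrable fun x => b₀ x * conj (φ x))
    (hβ : ∀ i, Integrable (β i)) (hβs : Summable fun i => ∫ x, ‖β i x‖)
    (hφ : Continuous φ) {Cφ : ℝ} (hφb : ∀ x, ‖φ x‖ ≤ Cφ) {Q : ι → Set ℝ}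
    (hQm : ∀ i, MeasurableSet (Q i)) (hQd : Pairwise (Function.onFun Disjoint Q))
    {L : ι → ℝ} (hL : ∀ i, 0 < L i) (hQL : ∀ i, volume (Q i) = ENNReal.ofReal (L i))
    {H : ℝ → ℝ} (hH : Measurable H)
    {κ : ℝ} (hκ : 0 ≤ κ) (hpair : ∀ i, ∀ x ∈ Q i, ‖pair (β i) φ‖ ≤ κ * L i * H x)
    (hb₀Q : ∀ x ∈ ⋃ i, Q i, b₀ x = 0) (hb₀H : ∀ᵐ x, ‖b₀ x‖ * ‖φ x‖ ≤ κ * H x) :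
    ‖pair b φ‖ₑ ≤ ENNReal.ofReal κ * ∫⁻ x, ENNReal.ofReal (H x) := by
  obtain ⟨hdi, hint⟩ := integrable_sub_mul_conj_of_hasSum hb hβ hβs hφ hφb
  have hQU : MeasurableSet (⋃ i, Q i) := MeasurableSet.iUnion hQm
  have hb₀e : ∫⁻ x, ‖b₀ x * conj (φ x)‖ₑ ≤
      ENNReal.ofReal κ * ∫⁻ x in (⋃ i, Q i)ᶜ, ENNReal.ofReal (H x) := by
    rw [← lintegral_const_mul _ hH.ennreal_ofReal, ← lintegral_indicator hQU.compl]
    refine lintegral_mono_ae ?_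
    filter_upwards [hb₀H] with x hx
    by_cases hxQ : x ∈ ⋃ i, Q i
    · simp [hb₀Q x hxQ]
    · rw [indicator_of_mem (show x ∈ (⋃ i, Q i)ᶜ from hxQ), ← ENNReal.ofReal_mul hκ,
        ← ofReal_norm, norm_mul, RCLike.norm_conj]
      exact ENNReal.ofReal_le_ofReal hx
  have hsplit : pair b φ = pair b₀ φ + ∑' i, pair (β i) φ := by
    have htot : (fun x => b x * conj (φ x)) =
        fun x => b₀ x * conj (φ x) + (b x - b₀ x) * conj (φ x) := by
      funext x; ring
    rw [pair, htot, integral_add hb₀i hdi, hint, pair]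
  have hpiece : ∀ i, ‖pair (β i) φ‖ₑ ≤ ENNReal.ofReal κ * ∫⁻ x in Q i, ENNReal.ofReal (H x) := by
    intro i
    have h1 : ENNReal.ofReal (L i) * ‖pair (β i) φ‖ₑ ≤
        ENNReal.ofReal (L i) * (ENNReal.ofReal κ * ∫⁻ x in Q i, ENNReal.ofReal (H x)) := by
      rw [← lintegral_const_mul _ hH.ennreal_ofReal,
        ← lintegral_const_mul _ (hH.ennreal_ofReal.const_mul _), ← hQL i, mul_comm,
        ← setLIntegral_const]
      refine setLIntegral_mono' (hQm i) fun x hx => ?_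
      rw [hQL i, ← ENNReal.ofReal_mul hκ, ← ENNReal.ofReal_mul (hL i).le, ← ofReal_norm]
      exact ENNReal.ofReal_le_ofReal ((hpair i x hx).trans (le_of_eq (by ring)))
    rwa [ENNReal.mul_le_mul_iff_right (by simpa using hL i) ENNReal.ofReal_ne_top] at h1
  calc ‖pair b φ‖ₑ ≤ ‖pair b₀ φ‖ₑ + ‖∑' i, pair (β i) φ‖ₑ := by
        rw [hsplit]; exact enorm_add_le _ _
    _ ≤ ENNReal.ofReal κ * (∫⁻ x in (⋃ i, Q i)ᶜ, ENNReal.ofReal (H x)) +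
        ∑' i, ENNReal.ofReal κ * ∫⁻ x in Q i, ENNReal.ofReal (H x) := by
        gcongr
        · exact (enorm_integral_le_lintegral_enorm _).trans hb₀e
        · exact enorm_tsum_le_tsum_enorm.trans (ENNReal.tsum_le_tsum hpiece)
    _ = ENNReal.ofReal κ * ∫⁻ x, ENNReal.ofReal (H x) := by
        rw [ENNReal.tsum_mul_left, ← lintegral_iUnion hQm hQd, ← mul_add, add_comm,
          lintegral_add_compl _ hQU]

/-! ### The decomposition on one Whitney interval -/

theorem integrableOn_of_rpow {f : ℝ → ℂ} (hfm : AEStronglyMeasurable f volume) {p : ℝ} (hp : 1 ≤ p)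
    (hf : Integrable fun x => ‖f x‖ ^ p) {lam : ℝ} (hlam : 0 < lam) (α γ : ℝ) :
    IntegrableOn f (Ico α γ) ∧ ∫ x in Ico α γ, ‖f x‖ ≤
      ∫ x in Ico α γ, (lam + lam ^ (1 - p) * ‖f x‖ ^ p) := by
  have hpt : ∀ x, ‖f x‖ ≤ lam + lam ^ (1 - p) * ‖f x‖ ^ p := by
    intro x
    rcases le_or_gt ‖f x‖ lam with h | h
    · have : 0 ≤ lam ^ (1 - p) * ‖f x‖ ^ p := by positivity
      linarith
    · have hx : 0 < ‖f x‖ := hlam.trans h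
      have h1 : ‖f x‖ = ‖f x‖ ^ (1 - p) * ‖f x‖ ^ p := by
        rw [← Real.rpow_add hx]; simp
      have h2 : ‖f x‖ ^ (1 - p) ≤ lam ^ (1 - p) :=
        Real.rpow_le_rpow_of_nonpos hlam h.le (by linarith)
      have h3 : ‖f x‖ ^ (1 - p) * ‖f x‖ ^ p ≤ lam ^ (1 - p) * ‖f x‖ ^ p := by gcongr
      linarith
  have hi : IntegrableOn (fun x => lam + lam ^ (1 - p) * ‖f x‖ ^ p) (Ico α γ) :=
    (integrableOn_const (by simp)).add (hf.integrableOn.const_mul _)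
  have h1 : IntegrableOn f (Ico α γ) :=
    Integrable.mono' hi hfm.restrict (Filter.Eventually.of_forall hpt)
  exact ⟨h1, integral_mono h1.norm hi hpt⟩

/-- On a Whitney interval, `f` is split into the local projection `G`, with its `L²` bound, and a
remainder orthogonal to all exponential polynomials at the prescribed frequencies. -/
theorem exists_local_decomposition {f : ℝ → ℂ} (hfm : AEStronglyMeasurable f volume) {p lam : ℝ}
    (hp1 : 1 ≤ p) (hp2 : p < 2) (hf : Integrable fun x => ‖f x‖ ^ p) (hlam : 0 < lam)
    {i : ℤ × ℤ} (hi : IsWhitney (excSet p f lam) i) (F : Finset ℝ) (D N : ℕ)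
    (hN : F.card * D ≤ N) :
    ∃ G : ℝ → ℂ, Continuous G ∧
      Integrable (fun x => (gridIval i).toSet.indicator f x - (gridIval i).triple.indicator G x) ∧
      (∀ v ∈ expPoly F D, ∫ x, ((gridIval i).toSet.indicator f x -
        (gridIval i).triple.indicator G x) * conj (v x) = 0) ∧
      ∫ x, ‖(gridIval i).toSet.indicator f x - (gridIval i).triple.indicator G x‖ ≤
        (2052 + 2 ^ 24 * N) * lam * (gridIval i).len ∧
      ∫⁻ x in (gridIval i).triple, ‖G x‖ₑ ^ 2 ≤
        ENNReal.ofReal (2 ^ 24 * lam ^ 2 * (N : ℝ) ^ (2 / p - 1) * (gridIval i).len) := by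
  set Q := gridIval i with hQ
  have hp0 : 0 < p := by linarith
  have hL := Q.len_pos
  obtain ⟨hfi, hfle⟩ := integrableOn_of_rpow hfm hp1 hf hlam Q.left (Q.left + Q.len)
  have hfp : ∫ x in Q.toSet, ‖f x‖ ^ p ≤ 2048 * lam ^ p * Q.len := hi.setIntegral_le hp0 hlam hf
  obtain ⟨G, hGV, hGdual, hGle⟩ := exists_local_projection (expPoly F D)
    (fun v hv => continuous_of_mem_expPoly hv) (fun v hv h => comp_add_mem_expPoly hv h)
    ((finrank_expPoly_le F D).trans hN) hL hp1 hp2 hfi hf.integrableOn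
    (K := 2048) (by norm_num) hlam hfp
  have hGc := continuous_of_mem_expPoly hGV
  have hQm := Q.measurableSet_toSet
  have h3m : MeasurableSet Q.triple := measurableSet_Ico
  have hGi : IntegrableOn G Q.triple := integrableOn_Ico_complex hGc _ _
  have hfI : Integrable (Q.toSet.indicator f) := (integrable_indicator_iff hQm).2 hfi
  have hGI : Integrable (Q.triple.indicator G) := (integrable_indicator_iff h3m).2 hGi
  have hG2i : IntegrableOn (fun x => ‖G x‖ ^ 2) Q.triple := integrableOn_Ico (hGc.norm.pow 2) _ _
  have hG2 : ∫ x in Q.triple, ‖G x‖ ^ 2 ≤ 2 ^ 24 * lam ^ 2 * (N : ℝ) ^ (2 / p - 1) * Q.len := by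
    refine hGle.trans (le_of_eq ?_)
    norm_num
  refine ⟨G, hGc, hfI.sub hGI, fun v hv => ?_, ?_, ?_⟩
  · have hvc := continuous_of_mem_expPoly hv
    have e1 := integrable_mul_conj_of_support_subset hfI
      (show Function.support _ ⊆ Ico Q.left (Q.left + Q.len) from support_indicator_subset) hvc
    have e2 := integrable_mul_conj_of_support_subset hGI
      (show Function.support _ ⊆ Ico (Q.left - Q.len) (Q.left + 2 * Q.len)
        from support_indicator_subset) hvc
    simp only [sub_mul]
    rw [integral_sub e1 e2, sub_eq_zero]
    have h1 : ∀ (s : Set ℝ) (w : ℝ → ℂ), (fun x => s.indicator w x * conj (v x)) =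
        s.indicator fun x => w x * conj (v x) := by
      intro s w
      funext x
      by_cases hx : x ∈ s <;> simp [hx]
    rw [h1, h1, integral_indicator hQm, integral_indicator h3m]
    exact (hGdual v hv).symm
  · have h1 : ∫ x, ‖Q.toSet.indicator f x - Q.triple.indicator G x‖ ≤
        (∫ x in Q.toSet, ‖f x‖) + ∫ x in Q.triple, ‖G x‖ := by
      rw [← integral_indicator hQm, ← integral_indicator h3m, ← integral_add]
      · refine integral_mono (hfI.sub hGI).norm ?_ fun x => ?_
        · exact ((integrable_indicator_iff hQm).2 hfi.norm).add
            ((integrable_indicator_iff h3m).2 hGi.norm)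
        · refine (norm_sub_le _ _).trans ?_
          rw [norm_indicator_eq_indicator_norm, norm_indicator_eq_indicator_norm]
      · exact (integrable_indicator_iff hQm).2 hfi.norm
      · exact (integrable_indicator_iff h3m).2 hGi.norm
    have h2 : ∫ x in Q.toSet, ‖f x‖ ≤ 2049 * lam * Q.len := by
      refine hfle.trans ?_
      rw [integral_add (integrable_const lam) (hf.integrableOn.const_mul _),
        integral_const_mul, setIntegral_const, measureReal_def]
      have e1 : volume (Ico Q.left (Q.left + Q.len)) = ENNReal.ofReal Q.len := Q.volume_toSet
      have e2 : lam ^ (1 - p) * lam ^ p = lam := by rw [← Real.rpow_add hlam]; simp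
      rw [e1, ENNReal.toReal_ofReal hL.le, smul_eq_mul]
      have e3 : lam ^ (1 - p) * ∫ x in Ico Q.left (Q.left + Q.len), ‖f x‖ ^ p ≤
          lam ^ (1 - p) * (2048 * lam ^ p * Q.len) := by
        gcongr
        exact hfp
      calc _ ≤ Q.len * lam + lam ^ (1 - p) * (2048 * lam ^ p * Q.len) := by gcongr
        _ = Q.len * lam + 2048 * (lam ^ (1 - p) * lam ^ p) * Q.len := by ring
        _ = _ := by rw [e2]; ring
    have h3 : ∫ x in Q.triple, ‖G x‖ ≤ 3 * lam * Q.len + 2 ^ 24 * N * lam * Q.len := by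
      have hci : Integrable (fun _ => lam) (volume.restrict Q.triple) :=
        integrable_const (μ := volume.restrict (Ico _ _)) lam
      have e1 : ∫ x in Q.triple, ‖G x‖ ≤ ∫ x in Q.triple, (lam + ‖G x‖ ^ 2 / lam) := by
        refine integral_mono hGi.norm ?_ fun x => ?_
        · exact hci.add (hG2i.div_const _)
        · have : ‖G x‖ * lam ≤ lam * lam + ‖G x‖ ^ 2 := by
            nlinarith [sq_nonneg (‖G x‖ - lam), sq_nonneg (‖G x‖ + lam)]
          have e2 : lam + ‖G x‖ ^ 2 / lam = (lam * lam + ‖G x‖ ^ 2) / lam := by field_simp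
          simp only
          rw [e2, le_div_iff₀ hlam]
          exact this
      refine e1.trans ?_
      rw [integral_add hci (hG2i.div_const _),
        integral_div, setIntegral_const, measureReal_def, Ival.triple, Real.volume_Ico,
        show Q.left + 2 * Q.len - (Q.left - Q.len) = 3 * Q.len by ring,
        ENNReal.toReal_ofReal (by positivity), smul_eq_mul]
      have e3 : (N : ℝ) ^ (2 / p - 1) ≤ N := by
        rcases Nat.eq_zero_or_pos N with h0 | h0
        · have : 2 / p - 1 ≠ 0 := by
            have : 1 < 2 / p := by rw [lt_div_iff₀ hp0]; linarith
            linarith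
          rw [h0, Nat.cast_zero, Real.zero_rpow this]
        · refine Real.rpow_le_self_of_one_le (by exact_mod_cast h0) ?_
          have : 2 / p ≤ 2 := by rw [div_le_iff₀ hp0]; linarith
          linarith
      have e4 : (∫ x in Q.triple, ‖G x‖ ^ 2) / lam ≤ 2 ^ 24 * N * lam * Q.len := by
        rw [div_le_iff₀ hlam]
        calc _ ≤ 2 ^ 24 * lam ^ 2 * (N : ℝ) ^ (2 / p - 1) * Q.len := hG2
          _ ≤ 2 ^ 24 * lam ^ 2 * N * Q.len := by gcongr
          _ = _ := by ring
      rw [Ival.triple] at e4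
      linarith
    linarith
  · have h1 : ∫⁻ x in Q.triple, ‖G x‖ₑ ^ 2 = ENNReal.ofReal (∫ x in Q.triple, ‖G x‖ ^ 2) := by
      rw [ofReal_integral_eq_lintegral_ofReal hG2i
        (Filter.Eventually.of_forall fun x => by positivity)]
      refine lintegral_congr fun x => ?_
      rw [← ofReal_norm, ENNReal.ofReal_pow (norm_nonneg _)]
    rw [h1]
    exact ENNReal.ofReal_le_ofReal hG2

/-! ### The size of the good function -/

theorem exists_finset_whitney_subtype (E : Set ℝ) (G : {i // IsWhitney E i} → ℝ → ℂ) (x : ℝ) :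
    ∃ s : Finset {i // IsWhitney E i}, s.card ≤ 9 ∧
      ∀ i ∉ s, (gridIval i.1).triple.indicator (G i) x = 0 := by
  classical
  obtain ⟨s, hs, h⟩ := exists_finset_isWhitney E x
  refine ⟨s.subtype _, ?_, fun i hi => ?_⟩
  · rw [Finset.card_subtype]
    exact (Finset.card_filter_le _ _).trans hs
  · refine indicator_of_notMem (fun hx => hi ?_) _
    rw [Finset.mem_subtype]
    exact h i.1 i.2 hx

theorem summable_triple_indicator (E : Set ℝ) (G : {i // IsWhitney E i} → ℝ → ℂ) (x : ℝ) :
    Summable fun i => (gridIval i.1).triple.indicator (G i) x := by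
  obtain ⟨s, -, h⟩ := exists_finset_whitney_subtype E G x
  exact (hasSum_sum_of_ne_finset_zero h).summable

theorem enorm_tsum_triple_sq_le (E : Set ℝ) (G : {i // IsWhitney E i} → ℝ → ℂ) (x : ℝ) :
    ‖∑' i, (gridIval i.1).triple.indicator (G i) x‖ₑ ^ 2 ≤
      9 * ∑' i, (gridIval i.1).triple.indicator (fun y => ‖G i y‖ₑ ^ 2) x := by
  obtain ⟨s, hs, h⟩ := exists_finset_whitney_subtype E G x
  rw [tsum_eq_sum h]
  set w : {i // IsWhitney E i} → ℂ := fun i => (gridIval i.1).triple.indicator (G i) x with hw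
  have h1 : ‖∑ i ∈ s, w i‖ ^ 2 ≤ 9 * ∑ i ∈ s, ‖w i‖ ^ 2 := by
    calc ‖∑ i ∈ s, w i‖ ^ 2 ≤ (∑ i ∈ s, ‖w i‖) ^ 2 := by
          gcongr; exact norm_sum_le _ _
      _ ≤ s.card * ∑ i ∈ s, ‖w i‖ ^ 2 := sq_sum_le_card_mul_sum_sq
      _ ≤ 9 * ∑ i ∈ s, ‖w i‖ ^ 2 := by
          gcongr; exact_mod_cast hs
  calc ‖∑ i ∈ s, w i‖ₑ ^ 2 = ENNReal.ofReal (‖∑ i ∈ s, w i‖ ^ 2) := by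
        rw [← ofReal_norm, ENNReal.ofReal_pow (norm_nonneg _)]
    _ ≤ ENNReal.ofReal (9 * ∑ i ∈ s, ‖w i‖ ^ 2) := ENNReal.ofReal_le_ofReal h1
    _ = 9 * ∑ i ∈ s, ‖w i‖ₑ ^ 2 := by
        rw [ENNReal.ofReal_mul (by norm_num), ENNReal.ofReal_sum_of_nonneg
          fun i _ => by positivity]
        congr 1
        · norm_num
        · refine Finset.sum_congr rfl fun i _ => ?_
          rw [← ofReal_norm, ENNReal.ofReal_pow (norm_nonneg _)]
    _ ≤ _ := by
        gcongr
        have h2 : ∀ i, ‖w i‖ₑ ^ 2 =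
            (gridIval i.1).triple.indicator (fun y => ‖G i y‖ₑ ^ 2) x := by
          intro i
          by_cases hx : x ∈ (gridIval i.1).triple <;> simp [hw, hx]
        simp only [h2]
        exact ENNReal.sum_le_tsum s

theorem IsWhitney.triple_subset {E : Set ℝ} {i : ℤ × ℤ} (hi : IsWhitney E i) :
    (gridIval i).triple ⊆ E := by
  intro x hx
  by_contra h
  have h1 := hi.le_abs_sub hx h
  have := (gridIval i).len_pos
  simp at h1
  linarith

theorem rpow_one_sub_mul_mul_rpow {A B : ℝ≥0∞} (hA0 : A ≠ 0) (hA : A ≠ ⊤) {θ : ℝ} (hθ : 0 ≤ θ) :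
    A ^ (1 - θ) * (A * B) ^ θ = A * B ^ θ := by
  rw [ENNReal.mul_rpow_of_nonneg _ _ hθ, ← mul_assoc, ← ENNReal.rpow_add _ _ hA0 hA]
  simp

/-- The `L²` norm of the good function. Its square is dominated pointwise, after replacing each
local projection by a constant on its Whitney interval, by a geometric mean of a density with
integral comparable to `lam ^ (2 - p) * ∫ ‖f‖ ^ p` and of a multiple of the counting function. -/
theorem lintegral_good_le {f : ℝ → ℂ} (hfm : AEStronglyMeasurable f volume) {p lam : ℝ}
    (hp1 : 1 ≤ p) (hp2 : p < 2) (hf : Integrable fun x => ‖f x‖ ^ p) (hlam : 0 < lam)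
    {E : Set ℝ} (hE : E = excSet p f lam) {n : ℝ → ℝ≥0∞} (hn : Measurable n)
    {S : Set ℝ} (hS : ∀ x ∈ S, 1 ≤ n x)
    {G : {i // IsWhitney E i} → ℝ → ℂ} (hGc : ∀ i, Continuous (G i))
    {N : {i // IsWhitney E i} → ℕ} {D : ℕ} (hD : 1 ≤ D)
    (hN : ∀ i, ∀ x ∈ (gridIval i.1).toSet, (N i : ℝ≥0∞) ≤ D * n x)
    (hG : ∀ i, ∫⁻ x in (gridIval i.1).triple, ‖G i x‖ₑ ^ 2 ≤
      ENNReal.ofReal (2 ^ 24 * lam ^ 2 * (N i : ℝ) ^ (2 / p - 1) * (gridIval i.1).len)) :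
    ∫⁻ x, ‖(S \ E).indicator f x +
        ∑' i, (gridIval i.1).triple.indicator (G i) x‖ₑ ^ 2 ≤
      9 * 2 ^ 24 * ((ENNReal.ofReal (6 * lam ^ (2 - p)) * ∫⁻ x, ‖f x‖ₑ ^ p) ^ (1 - (2 / p - 1)) *
        (ENNReal.ofReal (lam ^ 2 * D) * ∫⁻ x, n x) ^ (2 / p - 1)) := by
  set θ : ℝ := 2 / p - 1 with hθdef
  have hp0 : 0 < p := by linarith
  have hθ : 0 ≤ θ := by
    have : 1 < 2 / p := by rw [lt_div_iff₀ hp0]; linarith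
    linarith
  have hθ1 : θ ≤ 1 := by
    have : 2 / p ≤ 2 := by rw [div_le_iff₀ hp0]; linarith
    linarith
  have hEm : MeasurableSet E := by
    rw [hE]
    exact (isOpen_excSet hp0 hlam hf).measurableSet
  have hfe : AEMeasurable (fun x => ‖f x‖ₑ ^ p) volume := hfm.enorm.pow_const _
  set h₁ : ℝ → ℝ≥0∞ := fun x => E.indicator (fun _ => ENNReal.ofReal (lam ^ 2)) x +
    Eᶜ.indicator (fun x => ENNReal.ofReal (lam ^ (2 - p)) * ‖f x‖ₑ ^ p) x with hh₁
  set h₂ : ℝ → ℝ≥0∞ := fun x => ENNReal.ofReal (lam ^ 2 * D) * n x with hh₂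
  have hm₁ : AEMeasurable h₁ volume :=
    ((measurable_const.indicator hEm).aemeasurable).add ((hfe.const_mul _).indicator hEm.compl)
  have hm₂ : AEMeasurable h₂ volume := (hn.const_mul _).aemeasurable
  have hl2 : ENNReal.ofReal (lam ^ 2) ≠ 0 := by
    simp only [ne_eq, ENNReal.ofReal_eq_zero, not_le]; positivity
  have hD1 : ENNReal.ofReal (lam ^ 2 * D) = ENNReal.ofReal (lam ^ 2) * D := by
    rw [ENNReal.ofReal_mul (by positivity), ENNReal.ofReal_natCast]
  set Φ : ℝ → ℝ≥0∞ := fun x => h₁ x ^ (1 - θ) * h₂ x ^ θ with hΦ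
  -- on a Whitney interval
  have hloc : ∀ i : {i // IsWhitney E i}, ∫⁻ x in (gridIval i.1).triple, ‖G i x‖ₑ ^ 2 ≤
      2 ^ 24 * ∫⁻ x in (gridIval i.1).toSet, Φ x := by
    intro i
    have hQm := (gridIval i.1).measurableSet_toSet
    refine (hG i).trans ?_
    rw [ENNReal.ofReal_mul (by positivity), ← Ival.volume_toSet, ← setLIntegral_const,
      ← lintegral_const_mul' _ _ (by simp)]
    refine setLIntegral_mono' hQm fun x hx => ?_
    have hxE : x ∈ E := i.2.triple_subset ((gridIval i.1).toSet_subset_triple hx)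
    have e1 : h₁ x = ENNReal.ofReal (lam ^ 2) := by simp [hh₁, hxE]
    have e2 : ENNReal.ofReal (lam ^ 2) * (N i : ℝ≥0∞) ≤ h₂ x := by
      simp only [hh₂]
      rw [hD1, mul_assoc]
      gcongr
      exact hN i x hx
    calc ENNReal.ofReal (2 ^ 24 * lam ^ 2 * (N i : ℝ) ^ θ)
        = 2 ^ 24 * (ENNReal.ofReal (lam ^ 2) * (N i : ℝ≥0∞) ^ θ) := by
          rw [mul_assoc, ENNReal.ofReal_mul (by positivity), ENNReal.ofReal_mul (by positivity),
            ← ENNReal.ofReal_rpow_of_nonneg (by positivity) hθ, ENNReal.ofReal_natCast]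
          congr 1
          norm_num
      _ = 2 ^ 24 * (ENNReal.ofReal (lam ^ 2) ^ (1 - θ) *
            (ENNReal.ofReal (lam ^ 2) * (N i : ℝ≥0∞)) ^ θ) := by
          rw [rpow_one_sub_mul_mul_rpow hl2 ENNReal.ofReal_ne_top hθ]
      _ ≤ 2 ^ 24 * Φ x := by
          simp only [hΦ]
          rw [e1]
          gcongr
  have hin : ∫⁻ x in E, ‖(S \ E).indicator f x +
      ∑' i, (gridIval i.1).triple.indicator (G i) x‖ₑ ^ 2 ≤ 9 * 2 ^ 24 * ∫⁻ x in E, Φ x := by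
    calc _ ≤ ∫⁻ x in E, 9 * ∑' i : {i // IsWhitney E i},
          (gridIval i.1).triple.indicator (fun y => ‖G i y‖ₑ ^ 2) x := by
          refine setLIntegral_mono' hEm fun x hx => ?_
          have : x ∉ S \ E := fun h => h.2 hx
          rw [indicator_of_notMem this, zero_add]
          exact enorm_tsum_triple_sq_le E G x
      _ ≤ ∫⁻ x, 9 * ∑' i : {i // IsWhitney E i},
          (gridIval i.1).triple.indicator (fun y => ‖G i y‖ₑ ^ 2) x := setLIntegral_le_lintegral _ _
      _ = 9 * ∑' i : {i // IsWhitney E i}, ∫⁻ x in (gridIval i.1).triple, ‖G i x‖ₑ ^ 2 := by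
          have hmeas : ∀ i : {i // IsWhitney E i}, Measurable
              ((gridIval i.1).triple.indicator (fun y => ‖G i y‖ₑ ^ 2)) := fun i =>
            ((hGc i).enorm.measurable.pow_const 2).indicator
              (show MeasurableSet (gridIval i.1).triple from measurableSet_Ico)
          rw [lintegral_const_mul' _ _ (by simp), lintegral_tsum fun i => (hmeas i).aemeasurable]
          congr 1
          refine tsum_congr fun i => ?_
          rw [lintegral_indicator (show MeasurableSet (gridIval i.1).triple from measurableSet_Ico)]
      _ ≤ 9 * ∑' i : {i // IsWhitney E i}, 2 ^ 24 * ∫⁻ x in (gridIval i.1).toSet, Φ x := by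
          gcongr with i
          exact hloc i
      _ = 9 * 2 ^ 24 * ∫⁻ x in ⋃ i : {i // IsWhitney E i}, (gridIval i.1).toSet, Φ x := by
          rw [ENNReal.tsum_mul_left, lintegral_iUnion, mul_assoc]
          · exact fun i => (gridIval i.1).measurableSet_toSet
          · exact fun i j hij => i.2.disjoint j.2 fun h => hij (Subtype.ext h)
      _ ≤ _ := by
          gcongr
          exact iUnion_subset fun i =>
            ((gridIval i.1).toSet_subset_triple).trans i.2.triple_subset
  have hout : ∫⁻ x in Eᶜ, ‖(S \ E).indicator f x +
      ∑' i, (gridIval i.1).triple.indicator (G i) x‖ₑ ^ 2 ≤ ∫⁻ x in Eᶜ, Φ x := by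
    refine lintegral_mono_ae ((ae_restrict_iff' hEm.compl).2 ?_)
    filter_upwards [ae_norm_le_of_not_mem_excSet hp0 hlam hf] with x hx hxE
    rw [← hE] at hx
    have hz : ∑' i : {i // IsWhitney E i}, (gridIval i.1).triple.indicator (G i) x = 0 := by
      have : ∀ i : {i // IsWhitney E i}, (gridIval i.1).triple.indicator (G i) x = 0 := fun i =>
        indicator_of_notMem (fun h => hxE (i.2.triple_subset h)) _
      simp [this]
    rw [hz, add_zero]
    by_cases hxS : x ∈ S
    · rw [indicator_of_mem (show x ∈ S \ E from ⟨hxS, hxE⟩)]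
      have hfx := hx hxE
      have e1 : ‖f x‖ₑ ^ 2 ≤ h₁ x := by
        have : h₁ x = ENNReal.ofReal (lam ^ (2 - p)) * ‖f x‖ₑ ^ p := by
          have hxE' : x ∉ E := hxE
          simp [hh₁, hxE']
        rw [this, ← ofReal_norm, ENNReal.ofReal_rpow_of_nonneg (norm_nonneg _) hp0.le,
          ← ENNReal.ofReal_mul (by positivity), ← ENNReal.ofReal_pow (norm_nonneg _)]
        apply ENNReal.ofReal_le_ofReal
        rcases (norm_nonneg (f x)).eq_or_lt with h0 | h0
        · rw [← h0]
          simp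
          positivity
        · have h1 : ‖f x‖ ^ 2 = ‖f x‖ ^ (2 - p) * ‖f x‖ ^ p := by
            rw [← Real.rpow_add h0]; simp
          rw [h1]
          gcongr
      have e2 : ‖f x‖ₑ ^ 2 ≤ h₂ x := by
        simp only [hh₂]
        rw [hD1, ← ofReal_norm, ← ENNReal.ofReal_pow (norm_nonneg _)]
        calc ENNReal.ofReal (‖f x‖ ^ 2) ≤ ENNReal.ofReal (lam ^ 2) * 1 * 1 := by
              rw [mul_one, mul_one]
              apply ENNReal.ofReal_le_ofReal
              gcongr
          _ ≤ _ := by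
              gcongr
              · exact_mod_cast hD
              · exact hS x hxS
      calc ‖f x‖ₑ ^ 2 = (‖f x‖ₑ ^ 2) ^ (1 - θ) * (‖f x‖ₑ ^ 2) ^ θ := by
            rw [← ENNReal.rpow_add_of_nonneg _ _ (by linarith) hθ]; simp
        _ ≤ Φ x := by
            simp only [hΦ]
            gcongr
    · rw [indicator_of_notMem fun h => hxS h.1]
      simp
  have hint₁ : ∫⁻ x, h₁ x ≤ ENNReal.ofReal (6 * lam ^ (2 - p)) * ∫⁻ x, ‖f x‖ₑ ^ p := by
    simp only [hh₁]
    rw [lintegral_add_left (measurable_const.indicator hEm), lintegral_indicator hEm,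
      lintegral_indicator hEm.compl, setLIntegral_const]
    have e1 : volume E ≤ ENNReal.ofReal (5 * (lam ^ p)⁻¹) * ∫⁻ x, ‖f x‖ₑ ^ p := by
      rw [hE]
      refine (volume_excSet_le hp0 hlam hf).trans (le_of_eq ?_)
      have := lintegral_enorm_rpow_eq hp0.le hf univ
      rw [Measure.restrict_univ] at this
      rw [this, ENNReal.ofReal_mul (by positivity)]
    have e2 : lam ^ 2 * (5 * (lam ^ p)⁻¹) = 5 * lam ^ (2 - p) := by
      rw [Real.rpow_sub hlam, Real.rpow_two]
      field_simp
    calc _ ≤ ENNReal.ofReal (lam ^ 2) * (ENNReal.ofReal (5 * (lam ^ p)⁻¹) * ∫⁻ x, ‖f x‖ₑ ^ p) +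
          ∫⁻ x, ENNReal.ofReal (lam ^ (2 - p)) * ‖f x‖ₑ ^ p := by
          gcongr
          exact Measure.restrict_le_self
      _ = ENNReal.ofReal (5 * lam ^ (2 - p)) * (∫⁻ x, ‖f x‖ₑ ^ p) +
          ENNReal.ofReal (lam ^ (2 - p)) * ∫⁻ x, ‖f x‖ₑ ^ p := by
          rw [← mul_assoc, ← ENNReal.ofReal_mul (by positivity), e2,
            lintegral_const_mul' _ _ ENNReal.ofReal_ne_top]
      _ = _ := by
          rw [← add_mul, ← ENNReal.ofReal_add (by positivity) (by positivity)]
          congr 2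
          ring
  have hint₂ : ∫⁻ x, h₂ x = ENNReal.ofReal (lam ^ 2 * D) * ∫⁻ x, n x :=
    lintegral_const_mul' _ _ ENNReal.ofReal_ne_top
  calc _ = (∫⁻ x in E, ‖(S \ E).indicator f x +
          ∑' i, (gridIval i.1).triple.indicator (G i) x‖ₑ ^ 2) +
        ∫⁻ x in Eᶜ, ‖(S \ E).indicator f x +
          ∑' i, (gridIval i.1).triple.indicator (G i) x‖ₑ ^ 2 :=
        (lintegral_add_compl _ hEm).symm
    _ ≤ 9 * 2 ^ 24 * (∫⁻ x in E, Φ x) + 9 * 2 ^ 24 * ∫⁻ x in Eᶜ, Φ x := by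
        refine add_le_add hin (hout.trans ?_)
        refine le_mul_of_one_le_left zero_le ?_
        norm_num
    _ = 9 * 2 ^ 24 * ∫⁻ x, Φ x := by rw [← mul_add, lintegral_add_compl _ hEm]
    _ ≤ 9 * 2 ^ 24 * ((∫⁻ x, h₁ x) ^ (1 - θ) * (∫⁻ x, h₂ x) ^ θ) := by
        gcongr
        exact ENNReal.lintegral_mul_norm_pow_le hm₁ hm₂ (by linarith) hθ (by ring)
    _ ≤ _ := by
        rw [← hint₂]
        gcongr

/-- Passage from the square integral to the norm. The degree `D ≲ M` and the dilation factor `3 M`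
of the counting function produce `M ^ 2`. -/
theorem eLpNorm_two_le_of_lintegral_le {f g : ℝ → ℂ} {p lam R M : ℝ} (hp1 : 1 ≤ p) (hp2 : p < 2)
    (hlam : 0 < lam) (hR : 0 ≤ R) (hM : 1000 ≤ M) {D : ℕ} (hD : (D : ℝ) ≤ (R + 2) * M)
    {s : ℝ≥0∞}
    (h : ∫⁻ x, ‖g x‖ₑ ^ 2 ≤ 9 * 2 ^ 24 *
      ((ENNReal.ofReal (6 * lam ^ (2 - p)) * ∫⁻ x, ‖f x‖ₑ ^ p) ^ (1 - (2 / p - 1)) *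
        (ENNReal.ofReal (lam ^ 2 * D) * (ENNReal.ofReal (3 * M) * s)) ^ (2 / p - 1))) :
    eLpNorm g 2 volume ≤ ENNReal.ofReal (221184 * (R + 2) * lam ^ (2 - p)) *
      eLpNorm f (ENNReal.ofReal p) volume ^ (p - 1) *
        (ENNReal.ofReal (M ^ 2 * Real.log M) * s) ^ (1 / p - 1 / 2) := by
  have hp0 : 0 < p := by linarith
  have hpe : eLpNorm f (ENNReal.ofReal p) volume = (∫⁻ x, ‖f x‖ₑ ^ p) ^ (1 / p) := by
    rw [eLpNorm_eq_lintegral_rpow_enorm_toReal (by simpa using hp0) ENNReal.ofReal_ne_top,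
      ENNReal.toReal_ofReal hp0.le]
  have h2e : eLpNorm g 2 volume = (∫⁻ x, ‖g x‖ₑ ^ 2) ^ (1 / 2 : ℝ) := by
    rw [eLpNorm_eq_lintegral_rpow_enorm_toReal two_ne_zero ENNReal.ofNat_ne_top]
    simp
  set F := ∫⁻ x, ‖f x‖ₑ ^ p with hF
  set t : ℝ := 1 / p - 1 / 2 with ht
  set σ : ℝ := 1 - 1 / p with hσ
  have ht0 : 0 ≤ t := by
    have : 1 / 2 ≤ 1 / p := one_div_le_one_div_of_le hp0 hp2.le
    linarith
  have ht1 : t ≤ 1 := by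
    have : 1 / p ≤ 1 := by rw [div_le_one hp0]; exact hp1
    linarith
  have hσ0 : 0 ≤ σ := by
    have : 1 / p ≤ 1 := by rw [div_le_one hp0]; exact hp1
    linarith
  have hσ1 : σ ≤ 1 := by
    have : 0 < 1 / p := by positivity
    linarith
  have hlog : 1 ≤ Real.log M := by
    rw [Real.le_log_iff_exp_le (by linarith)]
    have := Real.exp_one_lt_d9
    linarith
  have e1 : (1 - (2 / p - 1)) * (1 / 2) = σ := by rw [hσ]; ring
  have e2 : (2 / p - 1) * (1 / 2) = t := by rw [ht]; ring
  have hdens : ENNReal.ofReal (lam ^ 2 * D) * (ENNReal.ofReal (3 * M) * s) ≤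
      ENNReal.ofReal (3 * (R + 2) * lam ^ 2) * (ENNReal.ofReal (M ^ 2 * Real.log M) * s) := by
    rw [← mul_assoc, ← mul_assoc, ← ENNReal.ofReal_mul (by positivity),
      ← ENNReal.ofReal_mul (by positivity)]
    refine mul_le_mul' (ENNReal.ofReal_le_ofReal ?_) le_rfl
    calc lam ^ 2 * D * (3 * M) ≤ lam ^ 2 * ((R + 2) * M) * (3 * M) := by gcongr
      _ = 3 * (R + 2) * lam ^ 2 * (M ^ 2 * 1) := by ring
      _ ≤ 3 * (R + 2) * lam ^ 2 * (M ^ 2 * Real.log M) := by gcongr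
      _ = _ := by ring
  have hconst : (12288 : ℝ) * ((6 * lam ^ (2 - p)) ^ σ * (3 * (R + 2) * lam ^ 2) ^ t) ≤
      221184 * (R + 2) * lam ^ (2 - p) := by
    have c1 : (6 : ℝ) ^ σ ≤ 6 := Real.rpow_le_self_of_one_le (by norm_num) hσ1
    have c2 : (3 * (R + 2)) ^ t ≤ 3 * (R + 2) := Real.rpow_le_self_of_one_le (by linarith) ht1
    have c3 : (lam ^ (2 - p)) ^ σ * (lam ^ 2) ^ t = lam ^ (2 - p) := by
      rw [← Real.rpow_natCast lam 2, ← Real.rpow_mul hlam.le, ← Real.rpow_mul hlam.le,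
        ← Real.rpow_add hlam]
      congr 1
      rw [hσ, ht]
      push_cast
      field_simp
      ring
    rw [Real.mul_rpow (by norm_num) (by positivity), Real.mul_rpow (by positivity) (by positivity)]
    calc _ = 12288 * (6 ^ σ * (3 * (R + 2)) ^ t) * ((lam ^ (2 - p)) ^ σ * (lam ^ 2) ^ t) := by ring
      _ ≤ 12288 * (6 * (3 * (R + 2))) * lam ^ (2 - p) := by rw [c3]; gcongr
      _ = _ := by ring
  have h9 : ((9 : ℝ≥0∞) * 2 ^ 24) ^ (1 / 2 : ℝ) = ENNReal.ofReal 12288 := by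
    have : (9 : ℝ≥0∞) * 2 ^ 24 = ENNReal.ofReal 12288 ^ (2 : ℝ) := by
      rw [ENNReal.ofReal_rpow_of_nonneg (by norm_num) (by norm_num)]
      norm_num
    rw [this, ← ENNReal.rpow_mul]
    norm_num
  have hFσ : F ^ σ = ((F ^ (1 / p)) ^ (p - 1)) := by
    rw [← ENNReal.rpow_mul]
    congr 1
    rw [hσ]
    field_simp
  rw [h2e, hpe]
  calc (∫⁻ x, ‖g x‖ₑ ^ 2) ^ (1 / 2 : ℝ)
      ≤ (9 * 2 ^ 24 * ((ENNReal.ofReal (6 * lam ^ (2 - p)) * F) ^ (1 - (2 / p - 1)) *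
        (ENNReal.ofReal (lam ^ 2 * D) * (ENNReal.ofReal (3 * M) * s)) ^ (2 / p - 1)))
          ^ (1 / 2 : ℝ) := by gcongr
    _ = ENNReal.ofReal 12288 * ((ENNReal.ofReal (6 * lam ^ (2 - p)) * F) ^ σ *
        (ENNReal.ofReal (lam ^ 2 * D) * (ENNReal.ofReal (3 * M) * s)) ^ t) := by
        rw [ENNReal.mul_rpow_of_nonneg _ _ (by norm_num),
          ENNReal.mul_rpow_of_nonneg (_ ^ _) _ (by norm_num), ← ENNReal.rpow_mul,
          ← ENNReal.rpow_mul, e1, e2, h9]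
    _ ≤ ENNReal.ofReal 12288 * ((ENNReal.ofReal (6 * lam ^ (2 - p)) * F) ^ σ *
        (ENNReal.ofReal (3 * (R + 2) * lam ^ 2) *
          (ENNReal.ofReal (M ^ 2 * Real.log M) * s)) ^ t) := by gcongr
    _ = ENNReal.ofReal (12288 * ((6 * lam ^ (2 - p)) ^ σ * (3 * (R + 2) * lam ^ 2) ^ t)) *
        (F ^ (1 / p)) ^ (p - 1) * (ENNReal.ofReal (M ^ 2 * Real.log M) * s) ^ t := by
        rw [ENNReal.mul_rpow_of_nonneg _ _ hσ0, ENNReal.mul_rpow_of_nonneg _ _ ht0, hFσ,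
          ENNReal.ofReal_rpow_of_nonneg (by positivity) hσ0,
          ENNReal.ofReal_rpow_of_nonneg (by positivity) ht0,
          ENNReal.ofReal_mul (p := 12288) (by norm_num),
          ENNReal.ofReal_mul (p := (6 * lam ^ (2 - p)) ^ σ) (by positivity)]
        ring
    _ ≤ _ := by gcongr

/-! ### The decomposition -/

theorem iUnion_gridIval_subset (E : Set ℝ) :
    ⋃ i : {i // IsWhitney E i}, (gridIval i.1).toSet ⊆ E :=
  iUnion_subset fun i => (gridIval i.1).toSet_subset_triple.trans i.2.triple_subset

theorem pairwise_disjoint_gridIval (E : Set ℝ) : Pairwise (Function.onFun Disjoint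
    fun i : {i // IsWhitney E i} => (gridIval i.1).toSet) :=
  fun i j hij => i.2.disjoint j.2 fun h => hij (Subtype.ext h)

theorem summable_gridIval_len {E : Set ℝ} (hE : volume E ≠ ⊤) :
    Summable fun i : {i // IsWhitney E i} => (gridIval i.1).len := by
  have h : ∑' i : {i // IsWhitney E i}, volume (gridIval i.1).toSet ≠ ⊤ := by
    rw [← measure_iUnion (pairwise_disjoint_gridIval E) fun i => (gridIval i.1).measurableSet_toSet]
    exact ((measure_mono (iUnion_gridIval_subset E)).trans_lt hE.lt_top).ne
  refine (ENNReal.summable_toReal h).congr fun i => ?_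
  rw [Ival.volume_toSet, ENNReal.toReal_ofReal (gridIval i.1).len_pos.le]

theorem hasSum_indicator_gridIval {E : Set ℝ} (hE : IsOpen E) (hfin : volume E ≠ ⊤) (f : ℝ → ℂ)
    (x : ℝ) : HasSum (fun i : {i // IsWhitney E i} => (gridIval i.1).toSet.indicator f x)
      (E.indicator f x) := by
  by_cases hx : x ∈ E
  · obtain ⟨i, hi, hxi⟩ := exists_isWhitney_mem hE hfin hx
    have h := hasSum_single (f := fun j : {i // IsWhitney E i} =>
      (gridIval j.1).toSet.indicator f x) ⟨i, hi⟩ fun j hj => indicator_of_notMem (fun hxj =>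
        (disjoint_left.1 (pairwise_disjoint_gridIval E hj)) hxj hxi) _
    rw [indicator_of_mem hx]
    simpa [hxi] using h
  · have h : ∀ i : {i // IsWhitney E i}, (gridIval i.1).toSet.indicator f x = 0 := fun i =>
      indicator_of_notMem
        (fun hxi => hx (i.2.triple_subset ((gridIval i.1).toSet_subset_triple hxi))) _
    simp only [h, indicator_of_notMem hx]
    exact hasSum_zero

/-- The multi-frequency decomposition `f = g + b`. Outside the exceptional set `E`, the function is
kept in `g` where some dilated top lives, and goes to the bounded part `b₀` of `b` elsewhere. On
each Whitney interval, `g` is the local projection onto exponential polynomials of degree less than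
`D` at the frequencies of the near tops, and the remainder `β i` is the corresponding part of
`b`. -/
theorem exists_decomposition {f : ℝ → ℂ} (hfm : AEStronglyMeasurable f volume) {p lam : ℝ}
    (hp1 : 1 ≤ p) (hp2 : p < 2) (hf : Integrable fun x => ‖f x‖ ^ p) (hlam : 0 < lam)
    {E : Set ℝ} (hE : E = excSet p f lam) {T : Set (Ival × ℝ)} {r B : ℝ} (hr : 0 < r) (hB : 0 ≤ B)
    (hcount : ∀ᵐ x, counting T r x ≤ ENNReal.ofReal B) {D : ℕ} (hD : 1 ≤ D) :
    ∃ (g b b₀ : ℝ → ℂ) (β : {i // IsWhitney E i} → ℝ → ℂ) (F : {i // IsWhitney E i} → Finset ℝ),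
      AEStronglyMeasurable g volume ∧ AEStronglyMeasurable b volume ∧ (∀ x, f x = g x + b x) ∧
      ∫⁻ x, ‖g x‖ₑ ^ 2 ≤ 9 * 2 ^ 24 *
        ((ENNReal.ofReal (6 * lam ^ (2 - p)) * ∫⁻ x, ‖f x‖ₑ ^ p) ^ (1 - (2 / p - 1)) *
        (ENNReal.ofReal (lam ^ 2 * D) *
          (ENNReal.ofReal r * ∫⁻ x, counting T 1 x)) ^ (2 / p - 1)) ∧
      AEStronglyMeasurable b₀ volume ∧ (∀ᵐ x, ‖b₀ x‖ ≤ lam) ∧ (∀ x ∈ E, b₀ x = 0) ∧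
      (∀ d ∈ T, ∀ x ∈ Ival.dilate r d.1, b₀ x = 0) ∧
      (∀ x, HasSum (fun i => β i x) (b x - b₀ x)) ∧
      (∀ i, Integrable (β i)) ∧ (∀ i, Function.support (β i) ⊆ (gridIval i.1).triple) ∧
      (∀ i, ∀ v ∈ expPoly (F i) D, ∫ x, β i x * conj (v x) = 0) ∧
      (∀ i, ∀ d ∈ T, (gridIval i.1).toSet ⊆ Ival.dilate r d.1 → d.2 ∈ F i) ∧
      ∀ i, ∫ x, ‖β i x‖ ≤ (2052 + 2 ^ 24 * (B * D)) * lam * (gridIval i.1).len := by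
  classical
  have hp0 : 0 < p := by linarith
  have hEo : IsOpen E := by rw [hE]; exact isOpen_excSet hp0 hlam hf
  have hEfin : volume E ≠ ⊤ := by
    rw [hE]
    exact ((volume_excSet_le hp0 hlam hf).trans_lt ENNReal.ofReal_lt_top).ne
  have hTc : T.Countable := countable_of_counting hr
    (hcount.mono fun x hx => (hx.trans_lt ENNReal.ofReal_lt_top).ne)
  have hn := measurable_counting hTc r
  have hfin := fun i => (finite_nearTops hcount i).1
  set F : {i // IsWhitney E i} → Finset ℝ := fun i => (hfin i.1).toFinset.image Prod.snd with hF
  set N : {i // IsWhitney E i} → ℕ := fun i => (nearTops T r i.1).ncard * D with hNdef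
  have hFN : ∀ i, (F i).card * D ≤ N i := by
    intro i
    refine Nat.mul_le_mul_right _ (Finset.card_image_le.trans (le_of_eq ?_))
    rw [← ncard_eq_toFinset_card _ (hfin i.1)]
  have hW : ∀ i : {i // IsWhitney E i}, IsWhitney (excSet p f lam) i.1 := by
    rw [← hE]
    exact fun i => i.2
  have hloc := fun i : {i // IsWhitney E i} =>
    exists_local_decomposition hfm hp1 hp2 hf hlam (hW i) (F i) D (N i) (hFN i)
  choose G hGc hβi hβ0 hβle hG2 using hloc
  set S : Set ℝ := {x | counting T r x ≠ 0} with hSdef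
  have hSm : MeasurableSet S := (hn (measurableSet_singleton 0)).compl
  have hS : ∀ x ∈ S, 1 ≤ counting T r x := by
    intro x hx
    obtain ⟨d, hd⟩ : ∃ d : T, (Ival.dilate r d.1.1).indicator (1 : ℝ → ℝ≥0∞) x ≠ 0 := by
      by_contra! h
      exact hx (ENNReal.tsum_eq_zero.2 h)
    have := card_le_counting (T := T) (r := r) (x := x) {d.1} fun e he => by
      rw [Finset.mem_singleton] at he
      rw [he]
      exact ⟨d.2, mem_of_indicator_ne_zero hd⟩
    simpa using this
  set g : ℝ → ℂ := fun x => (S \ E).indicator f x +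
    ∑' i : {i // IsWhitney E i}, (gridIval i.1).triple.indicator (G i) x with hg
  set b₀ : ℝ → ℂ := (E ∪ S)ᶜ.indicator f with hb₀
  have hEm := hEo.measurableSet
  have hsm := summable_triple_indicator E G
  have htm : AEStronglyMeasurable
      (fun x => ∑' i : {i // IsWhitney E i}, (gridIval i.1).triple.indicator (G i) x) volume := by
    refine aestronglyMeasurable_of_tendsto_ae
      (u := (Filter.atTop : Filter (Finset {i // IsWhitney E i})))
      (f := fun s x => ∑ i ∈ s, (gridIval i.1).triple.indicator (G i) x) (fun s => ?_)
      (Filter.Eventually.of_forall fun x => (hsm x).hasSum)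
    exact Finset.aestronglyMeasurable_fun_sum _ fun i _ =>
      (hGc i).aestronglyMeasurable.indicator
        (show MeasurableSet (gridIval i.1).triple from measurableSet_Ico)
  have hgm : AEStronglyMeasurable g volume := (hfm.indicator (hSm.diff hEm)).add htm
  refine ⟨g, fun x => f x - g x, b₀, fun i x => (gridIval i.1).toSet.indicator f x -
    (gridIval i.1).triple.indicator (G i) x, F, hgm, hfm.sub hgm, fun x => by ring, ?_,
    hfm.indicator (hEm.union hSm).compl, ?_, ?_, ?_, ?_, hβi, ?_, hβ0, ?_, ?_⟩
  · rw [← lintegral_counting hTc hr.le]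
    refine lintegral_good_le hfm hp1 hp2 hf hlam hE hn hS hGc hD (fun i x hx => ?_) hG2
    simp only [hNdef]
    rw [Nat.cast_mul, mul_comm]
    gcongr
    exact ncard_nearTops_le (hfin i.1) hx
  · filter_upwards [ae_norm_le_of_not_mem_excSet hp0 hlam hf] with x hx
    by_cases h : x ∈ (E ∪ S)ᶜ
    · rw [hb₀, indicator_of_mem h]
      rw [← hE] at hx
      exact hx fun hxE => h (Or.inl hxE)
    · rw [hb₀, indicator_of_notMem h, norm_zero]
      exact hlam.le
  · exact fun x hx => indicator_of_notMem (s := (E ∪ S)ᶜ) (fun h => h (Or.inl hx)) f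
  · intro d hd x hx
    refine indicator_of_notMem (s := (E ∪ S)ᶜ) (fun h => h (Or.inr ?_)) f
    have := card_le_counting (T := T) (r := r) (x := x) {d} fun e he => by
      rw [Finset.mem_singleton] at he
      rw [he]
      exact ⟨hd, hx⟩
    rw [Finset.card_singleton, Nat.cast_one] at this
    exact (zero_lt_one.trans_le this).ne'
  · intro x
    have h := (hasSum_indicator_gridIval hEo hEfin f x).sub (hsm x).hasSum
    have e : f x - g x - b₀ x = E.indicator f x -
        ∑' i : {i // IsWhitney E i}, (gridIval i.1).triple.indicator (G i) x := by
      rw [hg, hb₀]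
      by_cases hxE : x ∈ E <;> by_cases hxS : x ∈ S <;> simp [hxE, hxS]
    rw [e]
    exact h
  · intro i x hx
    by_contra h
    have h' : x ∉ (gridIval i.1).toSet := fun h1 => h ((gridIval i.1).toSet_subset_triple h1)
    refine hx ?_
    show (gridIval i.1).toSet.indicator f x - (gridIval i.1).triple.indicator (G i) x = 0
    rw [indicator_of_notMem h, indicator_of_notMem h', sub_zero]
  · intro i d hd hsub
    simp only [hF, Finset.mem_image, Finite.mem_toFinset]
    exact ⟨d, ⟨hd, hsub⟩, rfl⟩
  · intro i
    refine (hβle i).trans ?_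
    have hl := (gridIval i.1).len_pos
    have h1 : (N i : ℝ) ≤ B * D := by
      simp only [hNdef]
      rw [Nat.cast_mul]
      gcongr
      have := (finite_nearTops hcount i.1).2
      rwa [max_eq_left hB] at this
    gcongr

/-! ### The estimates for the bad function -/

/-- The square function estimate for a family of numbers `c J` dominated by the integrals of the
packet weights. -/
theorem tsum_enorm_sq_le {E : Set ℝ} {I J₀ : Ival} {𝒥 : Set Ival}
    (h𝒥 : ∀ J ∈ 𝒥, J ∈ I.dyadic ∧ J.toSet ⊆ J₀.toSet) {c : Ival → ℂ} {K : ℝ} (hK : 0 ≤ K)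
    (hc : ∀ J ∈ 𝒥, ‖c J‖ₑ ≤ ENNReal.ofReal (K * (√J.len)⁻¹) *
      ∫⁻ x, ENNReal.ofReal (packetWeight E I.len J x)) :
    ((∑' J : 𝒥, ‖c J‖ₑ ^ 2) / ENNReal.ofReal J₀.len) ^ (1 / 2 : ℝ) ≤ ENNReal.ofReal (28 * K) := by
  have hJ₀ := J₀.len_pos
  have h1 : ∀ J : 𝒥, ‖c J‖ₑ ^ 2 ≤ ENNReal.ofReal (2 * Real.pi * K ^ 2) *
      ∫⁻ x, ENNReal.ofReal (packetWeight E I.len J x) := by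
    intro J
    have hJ := J.1.len_pos
    have h2 := hc J.1 J.2
    have h3 := h2.trans (mul_le_mul' le_rfl
      (lintegral_packetWeight_le E (Ival.dyadic_len_le (h𝒥 J.1 J.2).1)))
    rw [← ENNReal.ofReal_mul (by positivity)] at h3
    calc ‖c J‖ₑ ^ 2 = ‖c J‖ₑ * ‖c J‖ₑ := sq _
      _ ≤ ENNReal.ofReal (K * (√J.1.len)⁻¹ * (2 * Real.pi * J.1.len)) *
          (ENNReal.ofReal (K * (√J.1.len)⁻¹) *
            ∫⁻ x, ENNReal.ofReal (packetWeight E I.len J x)) := mul_le_mul' h3 h2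
      _ = _ := by
          rw [← mul_assoc, ← ENNReal.ofReal_mul (by positivity)]
          congr 2
          have : (√J.1.len)⁻¹ * (√J.1.len)⁻¹ * J.1.len = 1 := by
            rw [← mul_inv, Real.mul_self_sqrt hJ.le, inv_mul_cancel₀ hJ.ne']
          linear_combination 2 * Real.pi * K ^ 2 * this
  have h2 : (∑' J : 𝒥, ‖c J‖ₑ ^ 2) ≤ ENNReal.ofReal ((28 * K) ^ 2 * J₀.len) := by
    calc (∑' J : 𝒥, ‖c J‖ₑ ^ 2) ≤ ENNReal.ofReal (2 * Real.pi * K ^ 2) *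
          ∑' J : 𝒥, ∫⁻ x, ENNReal.ofReal (packetWeight E I.len J x) := by
          rw [← ENNReal.tsum_mul_left]
          exact ENNReal.tsum_le_tsum h1
      _ ≤ ENNReal.ofReal (2 * Real.pi * K ^ 2) * ENNReal.ofReal (12 * Real.pi ^ 2 * J₀.len) := by
          gcongr
          exact tsum_lintegral_packetWeight_le E I J₀ 𝒥 h𝒥
      _ ≤ _ := by
          rw [← ENNReal.ofReal_mul (by positivity)]
          apply ENNReal.ofReal_le_ofReal
          have hpi : Real.pi ^ 3 ≤ 3.15 ^ 3 := by
            gcongr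
            exact Real.pi_lt_d2.le
          calc 2 * Real.pi * K ^ 2 * (12 * Real.pi ^ 2 * J₀.len)
              = 24 * Real.pi ^ 3 * (K ^ 2 * J₀.len) := by ring
            _ ≤ 24 * 3.15 ^ 3 * (K ^ 2 * J₀.len) := by gcongr
            _ ≤ 784 * (K ^ 2 * J₀.len) := by gcongr; norm_num
            _ = _ := by ring
  calc _ ≤ (ENNReal.ofReal ((28 * K) ^ 2 * J₀.len) / ENNReal.ofReal J₀.len) ^ (1 / 2 : ℝ) := by
        gcongr
    _ = ENNReal.ofReal (28 * K) := by
        rw [← ENNReal.ofReal_div_of_pos hJ₀, mul_div_cancel_right₀ _ hJ₀.ne',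
          ENNReal.ofReal_rpow_of_nonneg (by positivity) (by norm_num), ← Real.sqrt_eq_rpow,
          Real.sqrt_sq (by positivity)]

theorem norm_div_sqrt_le {E : Set ℝ} {I J : Ival} (hJ : J ∈ I.dyadic) {c : ℂ} {K : ℝ} (hK : 0 ≤ K)
    (hc : ‖c‖ₑ ≤ ENNReal.ofReal (K * (√J.len)⁻¹) *
      ∫⁻ x, ENNReal.ofReal (packetWeight E I.len J x)) : ‖c‖ / √J.len ≤ 28 * K := by
  have hJl := J.len_pos
  have h3 := hc.trans (mul_le_mul' le_rfl (lintegral_packetWeight_le E (Ival.dyadic_len_le hJ)))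
  rw [← ENNReal.ofReal_mul (by positivity), ← ofReal_norm,
    ENNReal.ofReal_le_ofReal_iff (by positivity)] at h3
  rw [div_le_iff₀ (by positivity)]
  refine h3.trans ?_
  have h4 : (√J.len)⁻¹ * J.len = √J.len := by
    rw [inv_mul_eq_div, Real.div_sqrt]
  calc K * (√J.len)⁻¹ * (2 * Real.pi * J.len) = 2 * Real.pi * (K * ((√J.len)⁻¹ * J.len)) := by ring
    _ ≤ 28 * (K * √J.len) := by
        rw [h4]
        gcongr
        linarith [Real.pi_lt_d2]
    _ = _ := by ring

end

end MFCZ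

theorem proposition3p1 (u : ℝ → ℝ) (hu : MFCZ.IsOsgood u) (R : ℝ) (hR : 1 ≤ R)
    (a : ℝ) (ha : 0 < a) (ha' : a ≤ 1 / 100) (A : ℝ) (hA : 0 < A) :
    ∃ c : ℝ, 0 < c ∧
      ∀ ε : ℝ, 0 < ε → ε ≤ 2⁻¹ ^ 8 →
      ∀ k : ℝ, 1 ≤ k →
      ∀ T : Set (MFCZ.Ival × ℝ),
        eLpNorm (MFCZ.counting T (3 * u (1000 / a * k))) ∞ volume ≤ ENNReal.ofReal (2 ^ k) →
      ∀ p : ℝ, 1 ≤ p → p < 2 →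
      ∀ f : ℝ → ℂ, MemLp f (ENNReal.ofReal p) volume →
      ∀ lam : ℝ, 0 < lam →
      ∃ g b : ℝ → ℂ,
        AEStronglyMeasurable g volume ∧ AEStronglyMeasurable b volume ∧
        (∀ x, f x = g x + b x) ∧
        eLpNorm g 2 volume ≤
          ENNReal.ofReal (c * lam ^ (2 - p)) * eLpNorm f (ENNReal.ofReal p) volume ^ (p - 1) *
            (ENNReal.ofReal (u (1000 / a * k) ^ 2 * Real.log (u (1000 / a * k))) *
              eLpNorm (MFCZ.counting T 1) 1 volume) ^ (1 / p - 1 / 2) ∧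
        ∀ d ∈ T,
          (∀ φ : MFCZ.Ival → ℝ → ℂ, MFCZ.IsWavePackets u R ε a A d.1 d.2 φ →
            (∀ J ∈ d.1.dyadic, Integrable (fun x => b x * conj (φ J x)) volume) ∧
            ∀ J ∈ d.1.dyadic, ¬ J.toSet ⊆ MFCZ.excSet p f lam →
              ‖MFCZ.pair b (φ J)‖ / √J.len ≤ c * 2 ^ (-4 * k) * lam) ∧
          (∀ φ : MFCZ.Ival → ℝ → ℂ, MFCZ.IsMeanZeroWavePackets u R ε a A d.1 d.2 φ →
            ∀ J₀ ∈ d.1.dyadic, ¬ J₀.toSet ⊆ MFCZ.excSet p f lam →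
              ((∑' J : {J : MFCZ.Ival // J ∈ d.1.dyadic ∧ ¬ J.toSet ⊆ MFCZ.excSet p f lam ∧
                    J.toSet ⊆ J₀.toSet}, ‖MFCZ.pair b (φ J)‖ₑ ^ 2) /
                  ENNReal.ofReal J₀.len) ^ (1 / 2 : ℝ) ≤
                ENNReal.ofReal (c * 2 ^ (-4 * k) * lam)) := by
  open MFCZ in
  obtain ⟨C2, hC21, hC2⟩ := hu.exists_decay ha 2
  obtain ⟨C6, hC61, hC6⟩ := hu.exists_decay (b := a / 2) (by positivity) 6
  obtain ⟨Bu, hBu1, hBu⟩ := hu.exists_le_exp (τ := a / 1000) (by positivity)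
  set K₀ : ℝ := A * (2000000 * C2 + 12 * C6) * (2 ^ 25 * (R + 2) * Bu) with hK₀
  have hK₀0 : 0 < K₀ := by positivity
  refine ⟨28 * K₀ + 221184 * (R + 2), by positivity,
    fun ε hε0 hε k hk T hT p hp1 hp2 f hf lam hlam => ?_⟩
  have hp0 : 0 < p := by linarith
  set M : ℝ := u (1000 / a * k) with hMdef
  have hCk : 100000 ≤ 1000 / a * k := by
    have : 100000 ≤ 1000 / a := by
      rw [le_div_iff₀ ha]; linarith
    nlinarith
  have hM : 1000 ≤ M := by linarith [hu.le_self (show 0 ≤ 1000 / a * k by linarith)]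
  have hMk : M ≤ Bu * Real.exp k := by
    have h := hBu (1000 / a * k) (by linarith)
    rw [show a / 1000 * (1000 / a * k) = k by field_simp] at h
    linarith
  have h2k : (2 : ℝ) ^ k ≤ Real.exp k := by
    rw [Real.rpow_def_of_pos two_pos]
    apply Real.exp_le_exp.2
    nlinarith [Real.log_two_lt_d9]
  have h4k : Real.exp (-(498 * k)) ≤ 2 ^ (-4 * k) := by
    rw [Real.rpow_def_of_pos two_pos]
    apply Real.exp_le_exp.2
    nlinarith [Real.log_two_lt_d9]
  have hcount := ae_counting_le hT
  -- the degree dominates `M` times the distance, in units of `|J|⁻¹`, of the spectrum of a packet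
  -- on `J` from the frequency of its top
  set D : ℕ := ⌈(R + 1) * M⌉₊ with hDdef
  have hDge : (R + 1) * M ≤ D := Nat.le_ceil _
  have hDle : (D : ℝ) ≤ (R + 2) * M := by
    have := (Nat.ceil_lt_add_one (show 0 ≤ (R + 1) * M by positivity)).le
    linarith
  have hD1 : 1 ≤ D := by
    have : (1 : ℝ) ≤ D := by nlinarith
    exact_mod_cast this
  have hfi : Integrable fun x => ‖f x‖ ^ p := by
    have := hf.integrable_norm_rpow (by simpa using hp0) ENNReal.ofReal_ne_top
    rwa [ENNReal.toReal_ofReal hp0.le] at this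
  obtain ⟨E, hE⟩ : ∃ E, E = excSet p f lam := ⟨_, rfl⟩
  have hEfin : volume E ≠ ⊤ := by
    rw [hE]
    exact ((volume_excSet_le hp0 hlam hfi).trans_lt ENNReal.ofReal_lt_top).ne
  obtain ⟨g, b, b₀, β, F, hgm, hbm, hfgb, hg2, hb₀m, hb₀le, hb₀E, hb₀T, hsum, hβi, hβs, hβ0, hβF,
    hβle⟩ := exists_decomposition hf.1 hp1 hp2 hfi hlam hE (T := T) (r := 3 * M) (B := 2 ^ k)
      (by positivity) (by positivity) hcount hD1
  rw [← hE]
  -- the mass of the pieces of `b`, with the factor `exp (2 k)` to be absorbed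
  have hmass : ∀ i, ∫ x, ‖β i x‖ ≤
      2 ^ 25 * (R + 2) * Bu * Real.exp (2 * k) * lam * (gridIval i.1).len := by
    intro i
    refine (hβle i).trans ?_
    have hl := (gridIval i.1).len_pos
    have h1 : (2 : ℝ) ^ k * D ≤ (R + 2) * Bu * Real.exp (2 * k) := by
      calc (2 : ℝ) ^ k * D ≤ Real.exp k * ((R + 2) * (Bu * Real.exp k)) := by
            gcongr
            exact hDle.trans (by gcongr)
        _ = (R + 2) * Bu * Real.exp (2 * k) := by rw [two_mul k, Real.exp_add]; ring
    have h2 : 1 ≤ (R + 2) * Bu * Real.exp (2 * k) := by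
      have : 1 ≤ Real.exp (2 * k) := Real.one_le_exp (by linarith)
      exact one_le_mul_of_one_le_of_one_le
        (one_le_mul_of_one_le_of_one_le (by linarith) hBu1) this
    gcongr
    linarith
  have hβsum : Summable fun i => ∫ x, ‖β i x‖ :=
    Summable.of_nonneg_of_le (fun i => integral_nonneg fun x => norm_nonneg _) hmass
      ((summable_gridIval_len hEfin).mul_left _)
  have hφbd : ∀ {J : Ival} {ξ : ℝ} {φ : ℝ → ℂ}, IsAdapted u a A J ξ φ →
      ∀ x, ‖φ x‖ ≤ A * C2 * (√J.len)⁻¹ := fun {J ξ φ} hφ x =>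
    (hφ.norm_le_cauchyKernel hA.le hC2 x).trans
      (mul_le_of_le_one_right (by positivity) (cauchyKernel_le_one _ _ _))
  have hb₀i : ∀ {J : Ival} {ξ : ℝ} {φ : ℝ → ℂ}, IsAdapted u a A J ξ φ →
      Integrable fun x => b₀ x * conj (φ x) := by
    intro J ξ φ hφ
    have h1 : Integrable fun x => conj (φ x) :=
      (hφ.integrable hA.le hC2).mono
        (Complex.continuous_conj.comp hφ.continuous).aestronglyMeasurable
        (Filter.Eventually.of_forall fun x => (RCLike.norm_conj _).le)
    exact h1.bdd_mul hb₀m hb₀le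
  have hint : ∀ {J : Ival} {ξ : ℝ} {φ : ℝ → ℂ}, IsAdapted u a A J ξ φ →
      Integrable fun x => b x * conj (φ x) := by
    intro J ξ φ hφ
    have h := (hb₀i hφ).add
      (integrable_sub_mul_conj_of_hasSum hsum hβi hβsum hφ.continuous (hφbd hφ)).1
    refine h.congr (Filter.Eventually.of_forall fun x => ?_)
    simp only [Pi.add_apply]
    ring
  have hkey : ∀ d ∈ T, ∀ (η : Ival → ℝ) (φ : Ival → ℝ → ℂ),
      IsWavePacketsWith u R ε a A d.1 d.2 η φ → ∀ J ∈ d.1.dyadic, ¬ J.toSet ⊆ E →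
      ‖pair b (φ J)‖ₑ ≤ ENNReal.ofReal (K₀ * 2 ^ (-4 * k) * lam * (√J.len)⁻¹) *
        ∫⁻ x, ENNReal.ofReal (packetWeight E d.1.len J x) := by
    intro d hd η φ hφ J hJ hJE
    obtain ⟨hφa, hsupp, hη⟩ := hφ J hJ
    have hJl := J.len_pos
    have hexp : Real.exp (-(500 * k)) * Real.exp (2 * k) ≤ 2 ^ (-4 * k) := by
      rw [← Real.exp_add]
      convert h4k using 2
      ring
    have hw := packetWeight_nonneg E d.1.len_pos J
    refine enorm_pair_le hsum (hb₀i hφa) hβi hβsum hφa.continuous (hφbd hφa)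
      (fun i => (gridIval i.1).measurableSet_toSet) (pairwise_disjoint_gridIval E)
      (fun i => (gridIval i.1).len_pos) (fun i => (gridIval i.1).volume_toSet)
      (continuous_packetWeight E d.1.len J).measurable (by positivity) (fun i x hx => ?_)
      (fun x hx => hb₀E x (iUnion_gridIval_subset E hx)) ?_
    · have h := norm_pair_le_of_isWhitney hu ha (by linarith) hA.le (by linarith) hC2 hC6 hε0
        (hε.trans (by norm_num)) (by linarith) hM hJ hJE hφa hsupp hη i.2 (hβF i d hd) hDge
        (hβi i) (hβs i) (hβ0 i) hx
      have hl := (gridIval i.1).len_pos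
      have hwx := hw x
      refine h.trans ?_
      calc _ ≤ A * (2000000 * C2 + 12 * C6) * Real.exp (-(500 * k)) * (√J.len)⁻¹ *
            packetWeight E d.1.len J x *
            (2 ^ 25 * (R + 2) * Bu * Real.exp (2 * k) * lam * (gridIval i.1).len) := by
            gcongr
            exact hmass i
        _ = K₀ * (Real.exp (-(500 * k)) * Real.exp (2 * k)) * lam * (√J.len)⁻¹ *
            (gridIval i.1).len * packetWeight E d.1.len J x := by rw [hK₀]; ring
        _ ≤ _ := by gcongr
    · filter_upwards [hb₀le] with x hx
      have hwx := hw x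
      by_cases hxd : x ∈ Ival.dilate (3 * M) d.1
      · rw [hb₀T d hd x hxd, norm_zero, zero_mul]
        positivity
      · have h := hφa.norm_le_packetWeight hu ha hA.le hC6 (by linarith) hM E hJ hxd
        have h1 : A * C6 ≤ K₀ := by
          have h0 : 1 ≤ 2 ^ 25 * (R + 2) * Bu :=
            one_le_mul_of_one_le_of_one_le (by linarith) hBu1
          have : C6 ≤ (2000000 * C2 + 12 * C6) * (2 ^ 25 * (R + 2) * Bu) :=
            (show C6 ≤ 2000000 * C2 + 12 * C6 by linarith).trans
              (le_mul_of_one_le_right (by positivity) h0)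
          rw [hK₀, mul_assoc]
          gcongr
        have h2 : Real.exp (-(500 * k)) ≤ 2 ^ (-4 * k) :=
          (Real.exp_le_exp.2 (by linarith)).trans h4k
        calc ‖b₀ x‖ * ‖φ J x‖ ≤ lam * (A * C6 * Real.exp (-(500 * k)) * (√J.len)⁻¹ *
              packetWeight E d.1.len J x) := by gcongr
          _ ≤ lam * (K₀ * 2 ^ (-4 * k) * (√J.len)⁻¹ * packetWeight E d.1.len J x) := by gcongr
          _ = _ := by ring
  have hK0 : 0 ≤ K₀ * 2 ^ (-4 * k) * lam := by positivity
  have hconst : 28 * (K₀ * 2 ^ (-4 * k) * lam) ≤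
      (28 * K₀ + 221184 * (R + 2)) * 2 ^ (-4 * k) * lam := by
    have : 0 ≤ 221184 * (R + 2) * 2 ^ (-4 * k) * lam := by positivity
    linarith
  refine ⟨g, b, hgm, hbm, hfgb, ?_, fun d hd => ⟨?_, ?_⟩⟩
  · have h1 : eLpNorm (counting T 1) 1 volume = ∫⁻ x, counting T 1 x := by
      rw [eLpNorm_one_eq_lintegral_enorm]
      rfl
    rw [h1]
    refine (eLpNorm_two_le_of_lintegral_le hp1 hp2 hlam (by linarith) hM hDle hg2).trans ?_
    gcongr
    linarith
  · rintro φ ⟨η, hφ⟩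
    exact ⟨fun J hJ => hint (hφ J hJ).1, fun J hJ hJE =>
      (norm_div_sqrt_le hJ hK0 (hkey d hd η φ hφ J hJ hJE)).trans hconst⟩
  · rintro φ ⟨η, hφ, -⟩ J₀ - -
    refine (tsum_enorm_sq_le (𝒥 := {J | J ∈ d.1.dyadic ∧ ¬ J.toSet ⊆ E ∧ J.toSet ⊆ J₀.toSet})
      (fun J hJ => ⟨hJ.1, hJ.2.2⟩) (c := fun J => pair b (φ J)) hK0
      fun J hJ => hkey d hd η φ hφ J hJ.1 hJ.2.1).trans (ENNReal.ofReal_le_ofReal hconst)
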